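/- Fix $i\in\{a,b\}$ and consider in $\mathbb{R}^3$ the discontinuous piecewise linear differential system $$(\dot x,\dot y,\dot z)=\begin{cases}X_{i,0}^{+}(x,y,z)+\varepsilon X_1^{+}(x,y,z), & z>0,\\ X_{i,0}^{-}(x,y,z)+\varepsilon X_1^{-}(x,y,z), & z<0,\end{cases}$$ with switching plane $\Sigma=\{z=0\}$, where $$X_{a,0}^{\pm}=(x,\,-z\mp1,\,x+y),\qquad X_{b,0}^{\pm}=(x,\,z\mp1,\,x+y),$$ $$X_1^{\pm}=\big(\alpha_0^\pm+\alpha_1^\pm x+\alpha_2^\pm y+\alpha_3^\pm z,\ \beta_0^\pm+\beta_1^\pm x+\beta_2^\pm y+\beta_3^\pm z,\ \kappa_0^\pm+\kappa_1^\pm x+\kappa_2^\pm y+\kappa_3^\pm z\big).$$ Solutions are understood in the sense of Filippov. A periodic orbit is the trace of a nonconstant periodic solution. A periodic orbit is a crossing one if it meets $\Sigma$, and only at points where the $z$-components of the two one-sided fields are nonzero and have the same sign. A crossing limit cycle is a crossing periodic orbit having a neighbourhood that contains no other periodic orbit. Theorem. For each $i\in\{a,b\}$ there are real coefficients $\alpha_j^\pm,\beta_j^\pm,\kappa_j^\pm$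 ($0\le j\le 3$) for which the system admits at least two limit cycles for every sufficiently small $\varepsilon\ne0$, converging to crossing periodic orbits in the plane $x=0$. Precisely: there are two distinct crossing periodic orbits $\Gamma_1,\Gamma_2\subset\{x=0\}$ of the unperturbed system ($\varepsilon=0$) and $\varepsilon_0>0$ such that, for every $\varepsilon$ with $0<|\varepsilon|<\varepsilon_0$, the system has two distinct crossing limit cycles $L_1(\varepsilon),L_2(\varepsilon)$, and $L_k(\varepsilon)\to\Gamma_k$ in the Hausdorff distance as $\varepsilon\to0$, for $k=1,2$. -/

import Mathlib

open Set Filter Topology MeasureTheory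

/-- Phase space `ℝ³`, a point being `(x, y, z)`. -/
abbrev R3 : Type := ℝ × ℝ × ℝ

/-- A piecewise smooth vector field: `plus` where `f > 0`, `minus` where `f < 0`;
the switching manifold is `Σ = f⁻¹(0)`. -/
structure PiecewiseField where
  f : R3 → ℝ
  plus : R3 → R3
  minus : R3 → R3

namespace PiecewiseField

/-- The switching manifold `Σ`. -/
def switchingSet (X : PiecewiseField) : Set R3 := {p | X.f p = 0}

/-- Filippov's set-valued right-hand side: the field itself off `Σ`, and on `Σ` the segment
joining the two one-sided vectors. -/
def filippov (X : PiecewiseField) (p : R3) : Set R3 :=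
  {v | (0 < X.f p ∧ v = X.plus p) ∨ (X.f p < 0 ∧ v = X.minus p) ∨
    (X.f p = 0 ∧ v ∈ segment ℝ (X.minus p) (X.plus p))}

/-- Solutions defined for all times: locally absolutely continuous curves whose derivative lies
almost everywhere in Filippov's set. Absolute continuity is expressed by saying that the curve
is the integral of a locally integrable velocity `v`. -/
def IsSolution (X : PiecewiseField) (γ : ℝ → R3) : Prop :=
  ∃ v : ℝ → R3, (∀ a b : ℝ, IntervalIntegrable v volume a b) ∧
    (∀ᵐ t : ℝ, v t ∈ X.filippov (γ t)) ∧
    ∀ t : ℝ, γ t = γ 0 + ∫ s in (0 : ℝ)..t, v s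

/-- A periodic orbit: the trace of a nonconstant periodic solution. -/
def IsPeriodicOrbit (X : PiecewiseField) (Γ : Set R3) : Prop :=
  ∃ (γ : ℝ → R3) (T : ℝ), 0 < T ∧ X.IsSolution γ ∧ Function.Periodic γ T ∧
    (∃ t, γ t ≠ γ 0) ∧ Γ = range γ

/-- Crossing points of `Σ`: the Lie derivatives of `f` along the two fields are nonzero and have
the same sign. -/
def IsCrossingPoint (X : PiecewiseField) (p : R3) : Prop :=
  X.f p = 0 ∧ 0 < (fderiv ℝ X.f p (X.plus p)) * (fderiv ℝ X.f p (X.minus p))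

/-- A crossing periodic orbit: it meets `Σ`, and only at crossing points. -/
def IsCrossingPeriodicOrbit (X : PiecewiseField) (Γ : Set R3) : Prop :=
  X.IsPeriodicOrbit Γ ∧ (Γ ∩ X.switchingSet).Nonempty ∧
    ∀ p ∈ Γ ∩ X.switchingSet, X.IsCrossingPoint p

/-- A crossing limit cycle: a crossing periodic orbit which is isolated in the set of all
periodic orbits (sliding ones included), i.e. some open neighbourhood of it contains no other
periodic orbit. -/
def IsCrossingLimitCycle (X : PiecewiseField) (Γ : Set R3) : Prop :=
  X.IsCrossingPeriodicOrbit Γ ∧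
    ∃ U : Set R3, IsOpen U ∧ Γ ⊆ U ∧ ∀ Γ' : Set R3, X.IsPeriodicOrbit Γ' → Γ' ⊆ U → Γ' = Γ

end PiecewiseField

/-- The two families `a` and `b`. -/
inductive FamilyIndex
  | a
  | b

/-- The unperturbed fields; `s = 1` gives the field in `f > 0`, `s = -1` the one in `f < 0`. -/
def unperturbed (i : FamilyIndex) (s : ℝ) (p : R3) : R3 :=
  match i with
  | FamilyIndex.a => (p.1, -p.2.2 - s, p.1 + p.2.1)
  | FamilyIndex.b => (p.1, p.2.2 - s, p.1 + p.2.1)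

/-- The affine function `c₀ + c₁ x + c₂ y + c₃ z`. -/
def affineFun (c : Fin 4 → ℝ) (p : R3) : ℝ :=
  c 0 + c 1 * p.1 + c 2 * p.2.1 + c 3 * p.2.2

/-- Coefficients of a perturbation field on one side of `Σ`. -/
structure PerturbationCoeffs where
  α : Fin 4 → ℝ
  β : Fin 4 → ℝ
  κ : Fin 4 → ℝ

/-- The perturbation field with the given coefficients. -/
def PerturbationCoeffs.field (C : PerturbationCoeffs) (p : R3) : R3 :=
  (affineFun C.α p, affineFun C.β p, affineFun C.κ p)

/-- The perturbed piecewise linear system with switching function `f(x, y, z) = z`. -/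
def perturbedSystem (i : FamilyIndex) (Cplus Cminus : PerturbationCoeffs) (ε : ℝ) :
    PiecewiseField where
  f := fun p => p.2.2
  plus := fun p => unperturbed i 1 p + ε • Cplus.field p
  minus := fun p => unperturbed i (-1) p + ε • Cminus.field p

/-- The plane `x = 0`. -/
def planeS : Set R3 := {p | p.1 = 0}

/-! Both one-sided fields have first component `x`, hence so does every Filippov combination of
them: `x` grows exponentially and a periodic solution must lie in the plane `x = 0`
(`fst_eq_zero_of_periodic`). What remains is a planar piecewise affine system. The perturbation
makes each side a spiral (family `a`) or its hyperbolic analogue (family `b`) about an equilibrium,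
with growth rate `ε` above and `-ε` below. Writing `σ` for `sgn` and using `cs`, `sn`, `arc`, one
computation serves both families.

The half-return maps are not explicit in the starting ordinate, but they are in the flight time: a
normalised spiral of rate `δ` and duration `u` starts at `launch δ u` and lands at `-launch (-δ) u`,
and `launch` is strictly increasing. Closing an upper arc of duration `u` by a lower arc of
normalised duration `v` gives two equations. The first integral of the lower spiral, the logarithm
of a radius corrected by a multiple of the angle, eliminates `v` and leaves one equation `gap ε u =
0` (`Good.gap_eq_zero_of`, `Good.launch_lowerTime`).

For `ε = 0` the gap vanishes identically. The first-order term vanishes too, because the rates are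
opposite, and for fixed `u` the gap is `ε² * melnikov u + o(ε²)` (`tendsto_gap_div_sq`). The
function `melnikov` is a combination of `u`, `sn u` and `u * cs u` with free coefficients; it is
taken to be `u * (profile A u - c)`, where `c` is a value attained by the profile once while
decreasing and once while increasing. This gives two sign changes.

Each sign change yields a zero of `gap ε` by the intermediate value theorem, isolated because `gap
ε` is analytic. The orbit is then isolated among all Filippov periodic orbits
(`Small.isCrossingLimitCycle_orbit`): nonzero divergence forces a periodic orbit to meet `Σ`; inside
a suitable neighbourhood it meets `Σ` only in two crossing windows, so it alternates upper and lower
arcs; the return map is increasing, so a recurrent sequence of durations is constant and is a zero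
of the gap. Hausdorff convergence follows from continuous dependence of the arcs on their
parameters. -/

namespace FamilyIndex

/-! ### Common calculus for the trigonometric and hyperbolic functions -/

/-- The sign distinguishing the elliptic family `a` from the hyperbolic family `b`. -/
def sgn : FamilyIndex → ℝ
  | a => 1
  | b => -1

/-- `cos` or `cosh`. -/
noncomputable def cs : FamilyIndex → ℝ → ℝ
  | a => Real.cos
  | b => Real.cosh

/-- `sin` or `sinh`. -/
noncomputable def sn : FamilyIndex → ℝ → ℝ
  | a => Real.sin
  | b => Real.sinh

/-- `arctan` or `artanh`. -/
noncomputable def arc : FamilyIndex → ℝ → ℝ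
  | a => Real.arctan
  | b => Real.artanh

/-- The interval of admissible flight times. -/
noncomputable def dom : FamilyIndex → Set ℝ
  | a => Ioo 0 Real.pi
  | b => Ioi 0

variable (i : FamilyIndex)

theorem sgn_mul_sgn : i.sgn * i.sgn = 1 := by cases i <;> simp [sgn]

theorem sgn_sq : i.sgn ^ 2 = 1 := by rw [pow_two, sgn_mul_sgn]

theorem abs_sgn : |i.sgn| = 1 := by cases i <;> simp [sgn]

theorem hasDerivAt_cs (u : ℝ) : HasDerivAt i.cs (-i.sgn * i.sn u) u := by
  cases i
  · simpa [cs, sgn, sn] using Real.hasDerivAt_cos u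
  · simpa [cs, sgn, sn] using Real.hasDerivAt_cosh u

theorem hasDerivAt_sn (u : ℝ) : HasDerivAt i.sn (i.cs u) u := by
  cases i
  · simpa [cs, sn] using Real.hasDerivAt_sin u
  · simpa [cs, sn] using Real.hasDerivAt_sinh u

theorem cs_sq_add (u : ℝ) : i.cs u ^ 2 + i.sgn * i.sn u ^ 2 = 1 := by
  cases i
  · simp [cs, sn, sgn]
  · simp only [cs, sn, sgn]; linarith [Real.cosh_sq u]

theorem cs_zero : i.cs 0 = 1 := by cases i <;> simp [cs]

theorem sn_zero : i.sn 0 = 0 := by cases i <;> simp [sn]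

theorem cs_sub (x y : ℝ) : i.cs (x - y) = i.cs x * i.cs y + i.sgn * (i.sn x * i.sn y) := by
  cases i
  · simp [cs, sn, sgn, Real.cos_sub]
  · simp only [cs, sn, sgn, Real.cosh_sub]; ring

theorem sn_sub (x y : ℝ) : i.sn (x - y) = i.sn x * i.cs y - i.cs x * i.sn y := by
  cases i
  · simp [cs, sn, Real.sin_sub]
  · simp only [cs, sn, Real.sinh_sub]

@[fun_prop]
theorem continuous_cs : Continuous i.cs := by
  cases i
  · exact Real.continuous_cos
  · exact Real.continuous_cosh

@[fun_prop]
theorem continuous_sn : Continuous i.sn := by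
  cases i
  · exact Real.continuous_sin
  · exact Real.continuous_sinh

theorem analyticAt_cs (u : ℝ) : AnalyticAt ℝ i.cs u := by
  cases i
  · exact Real.analyticAt_cos
  · exact Real.analyticAt_cosh

theorem analyticAt_sn (u : ℝ) : AnalyticAt ℝ i.sn u := by
  cases i
  · exact Real.analyticAt_sin
  · exact Real.analyticAt_sinh

theorem isOpen_dom : IsOpen i.dom := by
  cases i
  · exact isOpen_Ioo
  · exact isOpen_Ioi

theorem ordConnected_dom : i.dom.OrdConnected := by
  cases i
  · exact ordConnected_Ioo
  · exact ordConnected_Ioi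

variable {i}

theorem pos_of_mem_dom {u : ℝ} (hu : u ∈ i.dom) : 0 < u := by
  cases i
  · exact hu.1
  · exact hu

theorem Ioc_subset_dom {u : ℝ} (hu : u ∈ i.dom) : Ioc 0 u ⊆ i.dom := by
  cases i
  · exact fun x hx => ⟨hx.1, hx.2.trans_lt hu.2⟩
  · exact fun x hx => hx.1

theorem sn_pos {u : ℝ} (hu : u ∈ i.dom) : 0 < i.sn u := by
  cases i
  · exact Real.sin_pos_of_pos_of_lt_pi hu.1 hu.2
  · exact Real.sinh_pos_iff.2 hu

/-- These facts characterise the angle of tangent `y`. The hypothesis is vacuous in family `a` and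
means `|y| < 1` in family `b`. The last relation converts squared radii `1 + σ y²` into values of
`cs`. -/
theorem arc_spec {y : ℝ} (hy : 0 < 1 + i.sgn * y ^ 2) :
    0 < i.cs (i.arc y) ∧ i.sn (i.arc y) = y * i.cs (i.arc y) ∧
      i.cs (i.arc y) ^ 2 * (1 + i.sgn * y ^ 2) = 1 := by
  have h : 0 < i.cs (i.arc y) ∧ i.sn (i.arc y) = y * i.cs (i.arc y) := by
    cases i
    · have h := Real.cos_arctan_pos y
      refine ⟨h, ?_⟩
      have := Real.tan_arctan y
      rw [Real.tan_eq_sin_div_cos, div_eq_iff h.ne'] at this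
      exact this
    · have h := Real.cosh_pos (Real.artanh y)
      refine ⟨h, ?_⟩
      have hy' : y ∈ Ioo (-1 : ℝ) 1 := by
        have : y ^ 2 < 1 := by simp only [sgn] at hy; linarith
        exact abs_lt.1 ((sq_lt_one_iff_abs_lt_one y).1 this)
      have := Real.tanh_artanh hy'
      rw [Real.tanh_eq_sinh_div_cosh, div_eq_iff h.ne'] at this
      exact this
  refine ⟨h.1, h.2, ?_⟩
  have := i.cs_sq_add (i.arc y)
  rw [h.2] at this
  linarith

theorem arc_pos {y : ℝ} (h0 : 0 < y) (hy : 0 < 1 + i.sgn * y ^ 2) : 0 < i.arc y := by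
  cases i
  · exact Real.arctan_pos.2 h0
  · apply Real.artanh_pos
    have : y ^ 2 < 1 := by simp only [sgn] at hy; linarith
    exact ⟨h0, (abs_lt.1 ((sq_lt_one_iff_abs_lt_one y).1 this)).2⟩

theorem arc_add_mem_dom {y y' : ℝ} (h0 : 0 < y) (hy : 0 < 1 + i.sgn * y ^ 2)
    (h0' : 0 < y') (hy' : 0 < 1 + i.sgn * y' ^ 2) : i.arc y + i.arc y' ∈ i.dom := by
  have h := add_pos (arc_pos h0 hy) (arc_pos h0' hy')
  cases i
  · exact ⟨h, by
      have h1 := Real.arctan_lt_pi_div_two y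
      have h2 := Real.arctan_lt_pi_div_two y'
      change Real.arctan y + Real.arctan y' < _
      linarith⟩
  · exact h

/-- The tangent alone determines the angle only modulo `π` in family `a`; there `0 < cos x` and
`-π/2 < x < π` select the principal branch. The hyperbolic tangent is injective, so family `b` needs
no location. -/
theorem arc_eq_of {x y : ℝ} (hc : 0 < i.cs x) (hs : i.sn x = y * i.cs x)
    (h1 : i = a → -(Real.pi / 2) < x ∧ x < Real.pi) : i.arc y = x := by
  have hy : y = i.sn x / i.cs x := by rw [hs]; field_simp
  cases i
  · obtain ⟨hl, hr⟩ := h1 rfl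
    have hx : x < Real.pi / 2 := by
      by_contra hcon
      have := Real.cos_nonpos_of_pi_div_two_le_of_le (not_lt.1 hcon) (by linarith)
      exact absurd hc (not_lt.2 this)
    rw [hy]
    change Real.arctan (Real.sin x / Real.cos x) = x
    rw [← Real.tan_eq_sin_div_cos, Real.arctan_tan hl hx]
  · rw [hy]
    change Real.artanh (Real.sinh x / Real.cosh x) = x
    rw [← Real.tanh_eq_sinh_div_cosh, Real.artanh_tanh]

theorem analyticAt_arc {y : ℝ} (hy : 0 < 1 + i.sgn * y ^ 2) : AnalyticAt ℝ i.arc y := by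
  cases i
  · exact Real.contDiff_arctan.contDiffAt.analyticAt
  · have hy' : |y| < 1 := by
      have : y ^ 2 < 1 := by simp only [sgn] at hy; linarith
      exact (sq_lt_one_iff_abs_lt_one y).1 this
    have h2 := abs_lt.1 hy'
    have h1 : AnalyticAt ℝ (fun y : ℝ => 1 / 2 * Real.log ((1 + y) / (1 - y))) y := by
      have : 0 < (1 + y) / (1 - y) := div_pos (by linarith) (by linarith)
      have h3 : (1 - y) ≠ 0 := by linarith
      have h4 : AnalyticAt ℝ (fun y : ℝ => (1 + y) / (1 - y)) y := by fun_prop (disch := assumption)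
      exact analyticAt_const.mul (h4.log this)
    refine h1.congr ?_
    filter_upwards [Ioo_mem_nhds h2.1 h2.2] with z hz
    exact (Real.artanh_eq_half_log ⟨hz.1.le, hz.2.le⟩).symm

theorem hasDerivAt_arc {y : ℝ} (hy : 0 < 1 + i.sgn * y ^ 2) :
    HasDerivAt i.arc (1 / (1 + i.sgn * y ^ 2)) y := by
  cases i
  · simpa [sgn, arc] using Real.hasDerivAt_arctan y
  · have hy' : |y| < 1 := by
      have : y ^ 2 < 1 := by simp only [sgn] at hy; linarith
      exact (sq_lt_one_iff_abs_lt_one y).1 this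
    have h2 := abs_lt.1 hy'
    have hp : 0 < (1 + y) / (1 - y) := div_pos (by linarith) (by linarith)
    have h3 : (1 - y) ≠ 0 := by linarith
    have h5 : (1 + y) ≠ 0 := by linarith
    have h1 : HasDerivAt (fun y : ℝ => 1 / 2 * Real.log ((1 + y) / (1 - y)))
        (1 / 2 * (((1 * (1 - y) - (1 + y) * (-1)) / (1 - y) ^ 2) / ((1 + y) / (1 - y)))) y :=
      ((((hasDerivAt_id y).const_add 1).div ((hasDerivAt_id y).const_sub 1) h3).log
        hp.ne').const_mul _
    have h6 : 1 - y ^ 2 ≠ 0 := by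
      have : (1 - y ^ 2) = (1 - y) * (1 + y) := by ring
      rw [this]; exact mul_ne_zero h3 h5
    have h4 : 1 / 2 * (((1 * (1 - y) - (1 + y) * (-1)) / (1 - y) ^ 2) / ((1 + y) / (1 - y)))
        = 1 / (1 + sgn b * y ^ 2) := by
      have : 1 + sgn b * y ^ 2 = (1 - y) * (1 + y) := by simp only [sgn]; ring
      rw [this]; field_simp; ring
    rw [h4] at h1
    refine h1.congr_of_eventuallyEq ?_
    filter_upwards [Ioo_mem_nhds h2.1 h2.2] with z hz
    exact (Real.artanh_eq_half_log ⟨hz.1.le, hz.2.le⟩)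

/-! ### Flight times of the normalised spiral -/

/-- The ordinate from which the spiral of rate `δ` flies for a time `u`. -/
noncomputable def launch (i : FamilyIndex) (δ u : ℝ) : ℝ :=
  i.sgn * (Real.exp (-(δ * u)) - i.cs u) / i.sn u

/-- This is the equation for the spiral starting at `(launch δ u, 0)` to have height zero at time
`u`, after division by `σ e^(δu)`. -/
theorem launch_add {δ u : ℝ} (hu : u ∈ i.dom) :
    i.cs u + i.sgn * (i.sn u * i.launch δ u) = Real.exp (-(δ * u)) := by
  have := (sn_pos hu).ne'
  rw [launch]
  field_simp
  rw [i.sgn_sq]; ring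

theorem launch_eq_of {δ u y : ℝ} (hu : u ∈ i.dom)
    (h : i.cs u + i.sgn * (i.sn u * y) = Real.exp (-(δ * u))) : i.launch δ u = y := by
  have := (sn_pos hu).ne'
  rw [launch, ← h]
  field_simp
  linear_combination (i.sn u * y) * i.sgn_sq

theorem hasDerivAt_launch {δ u : ℝ} (hu : u ∈ i.dom) :
    HasDerivAt (i.launch δ)
      (i.sgn * (1 - Real.exp (-(δ * u)) * (i.cs u + δ * i.sn u)) / i.sn u ^ 2) u := by
  have hs := (sn_pos hu).ne'
  have he : HasDerivAt (fun u : ℝ => Real.exp (-(δ * u))) (Real.exp (-(δ * u)) * (-(δ * 1))) u :=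
    (((hasDerivAt_id u).const_mul δ).neg).exp
  have := (((he.sub (i.hasDerivAt_cs u)).const_mul i.sgn).div (i.hasDerivAt_sn u) hs)
  convert! this using 1
  congr 1
  simp only [Pi.sub_apply]
  linear_combination (-i.sgn) * i.cs_sq_add u

/-- The quantity is the numerator of the derivative of `launch`. It vanishes at `0` and has
derivative `(1 + σ δ²) e^(-δu) sn u`; the bound `|δ| < 1` keeps the first factor positive in family
`b`. -/
theorem sgn_mul_one_sub_pos {δ : ℝ} (hδ : |δ| < 1) {u : ℝ} (hu : u ∈ i.dom) :
    0 < i.sgn * (1 - Real.exp (-(δ * u)) * (i.cs u + δ * i.sn u)) := by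
  set f : ℝ → ℝ := fun u => i.sgn * (1 - Real.exp (-(δ * u)) * (i.cs u + δ * i.sn u)) with hf
  have hd : ∀ u, HasDerivAt f ((1 + i.sgn * δ ^ 2) * (Real.exp (-(δ * u)) * i.sn u)) u := by
    intro u
    have he : HasDerivAt (fun u : ℝ => Real.exp (-(δ * u))) (Real.exp (-(δ * u)) * (-(δ * 1))) u :=
      (((hasDerivAt_id u).const_mul δ).neg).exp
    have := (((he.mul ((i.hasDerivAt_cs u).add
      ((i.hasDerivAt_sn u).const_mul δ))).const_sub 1).const_mul
      i.sgn)
    convert! this using 1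
    simp only [Pi.add_apply]
    linear_combination (-Real.exp (-(δ * u)) * i.sn u) * i.sgn_sq
  have h1 : 0 < 1 + i.sgn * δ ^ 2 := by
    have : δ ^ 2 < 1 := (sq_lt_one_iff_abs_lt_one δ).2 hδ
    cases i <;> simp only [sgn] <;> nlinarith [sq_nonneg δ]
  have hmono : StrictMonoOn f (Icc 0 u) := by
    apply strictMonoOn_of_deriv_pos (convex_Icc 0 u)
    · exact fun x _ => (hd x).continuousAt.continuousWithinAt
    · intro x hx
      rw [interior_Icc] at hx
      rw [(hd x).deriv]
      exact mul_pos h1 (mul_pos (Real.exp_pos _) (sn_pos (Ioc_subset_dom hu ⟨hx.1, hx.2.le⟩)))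
  have hu0 := pos_of_mem_dom hu
  have := hmono (left_mem_Icc.2 hu0.le) (right_mem_Icc.2 hu0.le) hu0
  simpa [hf, cs_zero, sn_zero] using this

theorem continuousOn_launch {δ : ℝ} : ContinuousOn (i.launch δ) i.dom :=
  fun _ hu => (hasDerivAt_launch hu).continuousAt.continuousWithinAt

theorem strictMonoOn_launch {δ : ℝ} (hδ : |δ| < 1) : StrictMonoOn (i.launch δ) i.dom := by
  apply strictMonoOn_of_deriv_pos
  · exact i.ordConnected_dom.convex
  · exact continuousOn_launch
  · intro x hx
    rw [i.isOpen_dom.interior_eq] at hx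
    rw [(hasDerivAt_launch hx).deriv]
    exact div_pos (sgn_mul_one_sub_pos hδ hx) (pow_pos (sn_pos hx) 2)

/-- First coordinate of the normalised spiral of rate `δ` issued from `(y₀, 0)`. -/
noncomputable def spiralY (i : FamilyIndex) (δ y₀ s : ℝ) : ℝ :=
  Real.exp (δ * s) * (y₀ * i.cs s - i.sn s)

/-- Second coordinate of the normalised spiral of rate `δ` issued from `(y₀, 0)`. -/
noncomputable def spiralZ (i : FamilyIndex) (δ y₀ s : ℝ) : ℝ :=
  Real.exp (δ * s) * (i.sgn * i.cs s + y₀ * i.sn s) - i.sgn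

theorem spiralY_zero (δ y₀ : ℝ) : i.spiralY δ y₀ 0 = y₀ := by simp [spiralY, cs_zero, sn_zero]

theorem spiralZ_zero (δ y₀ : ℝ) : i.spiralZ δ y₀ 0 = 0 := by simp [spiralZ, cs_zero, sn_zero]

theorem hasDerivAt_spiralY (δ y₀ s : ℝ) : HasDerivAt (i.spiralY δ y₀)
    (δ * i.spiralY δ y₀ s - i.sgn * (i.spiralZ δ y₀ s + i.sgn)) s := by
  have he : HasDerivAt (fun u : ℝ => Real.exp (δ * u)) (Real.exp (δ * s) * (δ * 1)) s :=
    ((hasDerivAt_id s).const_mul δ).exp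
  have := he.mul (((i.hasDerivAt_cs s).const_mul y₀).sub (i.hasDerivAt_sn s))
  convert! this using 1
  simp only [spiralY, spiralZ, Pi.sub_apply]
  linear_combination (-Real.exp (δ * s) * i.cs s) * i.sgn_sq

theorem hasDerivAt_spiralZ (δ y₀ s : ℝ) : HasDerivAt (i.spiralZ δ y₀)
    (i.spiralY δ y₀ s + δ * (i.spiralZ δ y₀ s + i.sgn)) s := by
  have he : HasDerivAt (fun u : ℝ => Real.exp (δ * u)) (Real.exp (δ * s) * (δ * 1)) s :=
    ((hasDerivAt_id s).const_mul δ).exp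
  have := (he.mul (((i.hasDerivAt_cs s).const_mul i.sgn).add
    ((i.hasDerivAt_sn s).const_mul y₀))).sub_const i.sgn
  convert! this using 1
  simp only [spiralY, spiralZ, Pi.add_apply]
  linear_combination (Real.exp (δ * s) * i.sn s) * i.sgn_sq

/-- The height at time `s` is affine in the starting ordinate and vanishes when that ordinate is
`launch δ s`. The sign of the height along an arc is therefore read off from the monotonicity of
`launch`. -/
theorem spiralZ_launch {δ u s : ℝ} (hs : s ∈ i.dom) :
    i.spiralZ δ (i.launch δ u) s = Real.exp (δ * s) * i.sn s * (i.launch δ u - i.launch δ s) := by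
  have h := launch_add (δ := δ) hs
  have he : Real.exp (δ * s) * Real.exp (-(δ * s)) = 1 := by rw [← Real.exp_add]; simp
  rw [spiralZ]
  linear_combination (i.sgn * Real.exp (δ * s)) * h + i.sgn * he -
    (Real.exp (δ * s) * i.sn s * i.launch δ s) * i.sgn_sq

theorem spiralZ_launch_self {δ u : ℝ} (hu : u ∈ i.dom) : i.spiralZ δ (i.launch δ u) u = 0 := by
  rw [spiralZ_launch hu, sub_self, mul_zero]

theorem spiralZ_launch_pos {δ u s : ℝ} (hδ : |δ| < 1) (hu : u ∈ i.dom) (hs : s ∈ Ioo 0 u) :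
    0 < i.spiralZ δ (i.launch δ u) s := by
  have hs' := Ioc_subset_dom hu ⟨hs.1, hs.2.le⟩
  rw [spiralZ_launch hs']
  exact mul_pos (mul_pos (Real.exp_pos _) (sn_pos hs'))
    (sub_pos.2 (strictMonoOn_launch hδ hs' hu hs.2))

/-- Reversing time and reflecting `y` exchanges the rates `δ` and `-δ`, so the landing point is
minus the launch point of the reversed spiral of equal duration. -/
theorem spiralY_launch_self {δ u : ℝ} (hu : u ∈ i.dom) :
    i.spiralY δ (i.launch δ u) u = -i.launch (-δ) u := by
  have hs := (sn_pos hu).ne'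
  have he : Real.exp (δ * u) * Real.exp (-(δ * u)) = 1 := by rw [← Real.exp_add]; simp
  have hc := i.cs_sq_add u
  rw [spiralY, launch, launch, show -(-δ * u) = δ * u by ring]
  field_simp
  linear_combination (i.sgn * i.cs u) * he - (Real.exp (δ * u) * i.sgn) * hc
    + (Real.exp (δ * u) * i.sn u ^ 2) * i.sgn_sq

end FamilyIndex

/-! ### Filippov solutions: regularity, crossing, closed orbits -/

theorem sub_eq_integral {v γ : ℝ → R3} (hv : ∀ a b : ℝ, IntervalIntegrable v volume a b)
    (hγ : ∀ t, γ t = γ 0 + ∫ s in (0 : ℝ)..t, v s) (a b : ℝ) :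
    γ b - γ a = ∫ s in a..b, v s := by
  rw [hγ b, hγ a, ← intervalIntegral.integral_interval_sub_left (hv 0 b) (hv 0 a)]
  abel

theorem continuous_of_integral {v γ : ℝ → R3} (hv : ∀ a b : ℝ, IntervalIntegrable v volume a b)
    (hγ : ∀ t, γ t = γ 0 + ∫ s in (0 : ℝ)..t, v s) : Continuous γ := by
  rw [show γ = fun t => γ 0 + ∫ s in (0 : ℝ)..t, v s from funext hγ]
  exact continuous_const.add (intervalIntegral.continuous_primitive hv 0)

theorem eq_integral_field {v γ : ℝ → R3} {F : R3 → R3} {a b : ℝ}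
    (hv : ∀ a b : ℝ, IntervalIntegrable v volume a b)
    (hγ : ∀ t, γ t = γ 0 + ∫ s in (0 : ℝ)..t, v s)
    (hF : ∀ᵐ t : ℝ, t ∈ Ioo a b → v t = F (γ t)) {s t : ℝ} (hs : s ∈ Icc a b) (ht : t ∈ Icc a b) :
    γ t = γ s + ∫ τ in s..t, F (γ τ) := by
  rw [← sub_eq_iff_eq_add', sub_eq_integral hv hγ]
  apply intervalIntegral.integral_congr_ae
  have hb : ∀ᵐ τ : ℝ, τ ≠ b := by simp [ae_iff, measure_singleton]
  filter_upwards [hF, hb] with τ hτ hτb hmem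
  have h1 : τ ∈ Ioc a b := by
    rcases le_total s t with h | h
    · rw [uIoc_of_le h] at hmem
      exact ⟨hs.1.trans_lt hmem.1, hmem.2.trans ht.2⟩
    · rw [uIoc_of_ge h] at hmem
      exact ⟨ht.1.trans_lt hmem.1, hmem.2.trans hs.2⟩
  exact hτ ⟨h1.1, lt_of_le_of_ne h1.2 hτb⟩

theorem hasDerivAt_primitive_field {γ : ℝ → R3} {F : R3 → R3} (hc : Continuous γ)
    (hF : Continuous F) (t : ℝ) :
    HasDerivAt (fun s => γ t + ∫ τ in t..s, F (γ τ)) (F (γ t)) t :=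
  ((hF.comp hc).integral_hasStrictDerivAt t t).hasDerivAt.const_add _

/-- The velocity is prescribed only almost everywhere, but there it equals a continuous function of
time, so the curve is a classical primitive. -/
theorem hasDerivWithinAt_of_ae_eq {v γ : ℝ → R3} {F : R3 → R3} {a b : ℝ} (hFc : Continuous F)
    (hv : ∀ a b : ℝ, IntervalIntegrable v volume a b)
    (hγ : ∀ t, γ t = γ 0 + ∫ s in (0 : ℝ)..t, v s)
    (hF : ∀ᵐ t : ℝ, t ∈ Ioo a b → v t = F (γ t)) {t : ℝ} (ht : t ∈ Ico a b) :
    HasDerivWithinAt γ (F (γ t)) (Ici t) t := by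
  have h := (hasDerivAt_primitive_field (continuous_of_integral hv hγ) hFc t).hasDerivWithinAt
    (s := Ici t)
  refine h.congr_of_eventuallyEq ?_ (by simp)
  filter_upwards [Icc_mem_nhdsGE ht.2] with s hs
  exact eq_integral_field hv hγ hF ⟨ht.1, ht.2.le⟩ ⟨ht.1.trans hs.1, hs.2⟩

theorem hasDerivAt_of_ae_eq {v γ : ℝ → R3} {F : R3 → R3} (hFc : Continuous F)
    (hv : ∀ a b : ℝ, IntervalIntegrable v volume a b)
    (hγ : ∀ t, γ t = γ 0 + ∫ s in (0 : ℝ)..t, v s)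
    (hF : ∀ᵐ t : ℝ, v t = F (γ t)) (t : ℝ) : HasDerivAt γ (F (γ t)) t := by
  have h := hasDerivAt_primitive_field (continuous_of_integral hv hγ) hFc t
  refine h.congr_of_eventuallyEq ?_
  filter_upwards [Icc_mem_nhds (show t - 1 < t by linarith) (show t < t + 1 by linarith)] with s hs
  exact eq_integral_field hv hγ (hF.mono fun _ h _ => h) (a := t - 1) (b := t + 1)
    ⟨by linarith, by linarith⟩ hs

/-- A curve which follows `F` while `h > 0` and enters `h > 0` at time `t₀` coincides with an
integral curve of `F` as long as the latter stays in `h > 0`. -/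
theorem eq_flow_of_enters {v γ c : ℝ → R3} {F : R3 → R3} {K : NNReal} {h : R3 → ℝ} {t₀ u : ℝ}
    (hFL : LipschitzWith K F) (hh : Continuous h)
    (hv : ∀ a b : ℝ, IntervalIntegrable v volume a b)
    (hγ : ∀ t, γ t = γ 0 + ∫ s in (0 : ℝ)..t, v s)
    (hF : ∀ᵐ t : ℝ, 0 < h (γ t) → v t = F (γ t))
    (henter : ∃ r > 0, ∀ t ∈ Ioo t₀ (t₀ + r), 0 < h (γ t))
    (hc0 : c 0 = γ t₀) (hc : ∀ s, HasDerivAt c (F (c s)) s)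
    (hpos : ∀ s ∈ Ioo 0 u, 0 < h (c s)) : ∀ s ∈ Icc 0 u, γ (t₀ + s) = c s := by
  have hcont := continuous_of_integral hv hγ
  -- Uniqueness holds up to any time before which `h` stays positive; leaving `b` free allows it to
  -- be the first exit time below.
  have key : ∀ b, (∀ t ∈ Ioo t₀ b, 0 < h (γ t)) → ∀ t ∈ Icc t₀ b, γ t = c (t - t₀) := by
    intro b hb
    have hae : ∀ᵐ t : ℝ, t ∈ Ioo t₀ b → v t = F (γ t) := by
      filter_upwards [hF] with t ht htm using ht (hb t htm)
    refine ODE_solution_unique_of_mem_Icc_right (v := fun _ => F) (s := fun _ => univ) (K := K)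
      (fun t _ => hFL.lipschitzOnWith) hcont.continuousOn
      (fun t ht => hasDerivWithinAt_of_ae_eq hFL.continuous hv hγ hae ht) (fun _ _ => trivial)
      ?_ ?_ (fun _ _ => trivial) (by simp [hc0])
    · exact fun t _ => ((hc (t - t₀)).comp_sub_const t t₀).continuousAt.continuousWithinAt
    · exact fun t _ => ((hc (t - t₀)).comp_sub_const t t₀).hasDerivWithinAt
  rcases le_or_gt u 0 with hu | hu
  · intro s hs
    have : s = 0 := le_antisymm (hs.2.trans hu) hs.1
    simp [this, hc0]
  have hpos' : ∀ t ∈ Ioo t₀ (t₀ + u), 0 < h (γ t) := by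
    by_contra! hcon
    obtain ⟨t, ht, hneg⟩ := hcon
    obtain ⟨r, hr, hent⟩ := henter
    -- Times at which positivity fails; the entry interval keeps them away from `t₀`. At the first
    -- one, `m`, the solution still equals `c (m - t₀)`, where `h` is positive.
    set S := {s | s ∈ Icc (t₀ + r) t ∧ h (γ s) ≤ 0} with hS
    have htS : t ∈ S := by
      refine ⟨⟨?_, le_rfl⟩, hneg⟩
      by_contra hlt
      exact absurd (hent t ⟨ht.1, not_le.1 hlt⟩) (not_lt.2 hneg)
    have hclosed : IsClosed S :=
      isClosed_Icc.inter (isClosed_le (hh.comp hcont) continuous_const)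
    have hbdd : BddBelow S := ⟨t₀ + r, fun s hs => hs.1.1⟩
    have hm := hclosed.csInf_mem ⟨t, htS⟩ hbdd
    set m := sInf S
    have hbefore : ∀ s ∈ Ioo t₀ m, 0 < h (γ s) := by
      intro s hs
      by_contra hle
      rcases lt_or_ge s (t₀ + r) with h1 | h1
      · exact hle (hent s ⟨hs.1, h1⟩)
      · have : s ∈ S := ⟨⟨h1, hs.2.le.trans hm.1.2⟩, not_lt.1 hle⟩
        exact absurd (csInf_le hbdd this) (not_le.2 hs.2)
    have htm : t₀ < m := by linarith [hm.1.1]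
    have h1 := key m hbefore m ⟨htm.le, le_rfl⟩
    have h2 := hpos (m - t₀) ⟨by linarith, by linarith [hm.1.2, ht.2]⟩
    rw [← h1] at h2
    exact absurd h2 (not_lt.2 hm.2)
  intro s hs
  have := key _ hpos' (t₀ + s) ⟨by linarith [hs.1], by linarith [hs.2]⟩
  simpa using this

/-- A Filippov solution goes through `f = 0` in the common direction of the two fields. -/
theorem enters_of_crossing {v γ : ℝ → R3} {P M : R3 → R3} {s t₀ : ℝ}
    (hP : Continuous P) (hM : Continuous M)
    (hv : ∀ a b : ℝ, IntervalIntegrable v volume a b)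
    (hγ : ∀ t, γ t = γ 0 + ∫ τ in (0 : ℝ)..t, v τ)
    (hseg : ∀ᵐ t : ℝ, v t ∈ segment ℝ (M (γ t)) (P (γ t)))
    (h0 : (γ t₀).2.2 = 0) (hp : 0 < s * (P (γ t₀)).2.2) (hm : 0 < s * (M (γ t₀)).2.2) :
    ∃ r > 0, ∀ t ∈ Ioo t₀ (t₀ + r), 0 < s * (γ t).2.2 := by
  have hcont := continuous_of_integral hv hγ
  have hcP : Continuous fun t => s * (P (γ t)).2.2 := by fun_prop
  have hcM : Continuous fun t => s * (M (γ t)).2.2 := by fun_prop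
  -- Half the smaller normal speed at `t₀` bounds both normal speeds from below nearby. Convex
  -- combinations inherit the bound, so `s * z` grows at least linearly, sliding being impossible.
  set c := min (s * (P (γ t₀)).2.2) (s * (M (γ t₀)).2.2) / 2 with hcdef
  have hmin : 0 < min (s * (P (γ t₀)).2.2) (s * (M (γ t₀)).2.2) := lt_min hp hm
  have hc : 0 < c := by positivity
  have e1 : ∀ᶠ t in 𝓝 t₀, c < s * (P (γ t)).2.2 :=
    hcP.continuousAt.eventually (lt_mem_nhds (by
      have := min_le_left (s * (P (γ t₀)).2.2) (s * (M (γ t₀)).2.2); linarith))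
  have e2 : ∀ᶠ t in 𝓝 t₀, c < s * (M (γ t)).2.2 :=
    hcM.continuousAt.eventually (lt_mem_nhds (by
      have := min_le_right (s * (P (γ t₀)).2.2) (s * (M (γ t₀)).2.2); linarith))
  obtain ⟨r, hr, hball⟩ := Metric.eventually_nhds_iff.1 (e1.and e2)
  refine ⟨r, hr, fun t ht => ?_⟩
  have hint : IntervalIntegrable (fun τ => s * (v τ).2.2) volume t₀ t := by
    have h1 := (ContinuousLinearMap.snd ℝ ℝ ℝ).comp (ContinuousLinearMap.snd ℝ ℝ (ℝ × ℝ))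
    have : IntervalIntegrable (fun τ => (v τ).2.2) volume t₀ t :=
      ⟨(hv t₀ t).1.snd.snd, (hv t₀ t).2.snd.snd⟩
    exact this.const_mul s
  have heq : s * (γ t).2.2 = ∫ τ in t₀..t, s * (v τ).2.2 := by
    have h1 := sub_eq_integral hv hγ t₀ t
    have h2 := ((ContinuousLinearMap.snd ℝ ℝ ℝ).comp
      (ContinuousLinearMap.snd ℝ ℝ (ℝ × ℝ))).intervalIntegral_comp_comm (hv t₀ t)
    rw [← h1] at h2
    rw [intervalIntegral.integral_const_mul]
    have h3 : (∫ τ in t₀..t, (v τ).2.2) = (γ t - γ t₀).2.2 := h2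
    rw [h3]
    simp [h0]
  have hle : ∫ _ in t₀..t, c ≤ ∫ τ in t₀..t, s * (v τ).2.2 := by
    apply intervalIntegral.integral_mono_ae_restrict ht.1.le (by simp) hint
    rw [EventuallyLE, ae_restrict_iff' measurableSet_Icc]
    filter_upwards [hseg] with τ hτ hmem
    have hb := hball (y := τ) (by
      rw [Real.dist_eq, abs_lt]; constructor <;> linarith [hmem.1, hmem.2, ht.2])
    obtain ⟨x, y, hx, hy, hxy, hval⟩ := hτ
    rw [← hval]
    simp only [Prod.snd_add, Prod.smul_snd, smul_eq_mul]
    nlinarith [hb.1, hb.2, mul_le_mul_of_nonneg_left hb.1.le hy,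
      mul_le_mul_of_nonneg_left hb.2.le hx]
  rw [heq]
  refine lt_of_lt_of_le ?_ hle
  rw [intervalIntegral.integral_const, smul_eq_mul]
  exact mul_pos (by linarith [ht.1]) hc

/-- A planar affine system with nonzero divergence has no nonconstant periodic solution. -/
theorem planar_affine_periodic_const {y z : ℝ → ℝ} {a b c d e f T : ℝ} (hT : 0 < T)
    (htr : a + e ≠ 0) (hd : d ≠ 0)
    (hy : ∀ t, HasDerivAt y (a * y t + b * z t + c) t)
    (hz : ∀ t, HasDerivAt z (d * y t + e * z t + f) t)
    (hyT : Function.Periodic y T) (hzT : Function.Periodic z T) :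
    ∀ t, y t = y 0 ∧ z t = z 0 := by
  set w : ℝ → ℝ := fun t => d * y t + e * z t + f with hw
  -- Here `z'' = (a + e) z' - (a e - b d) z + (d c - a f)`. `G` is the energy of this damped
  -- oscillator times `a + e`, a factor which makes it nondecreasing whatever the sign of the trace.
  -- Being periodic, it is constant, so `z' = 0`.
  set G : ℝ → ℝ := fun t => (a + e) * (1 / 2 * w t ^ 2 + 1 / 2 * (a * e - b * d) * z t ^ 2
    - (d * c - a * f) * z t) with hG
  have hG' : ∀ t, HasDerivAt G ((a + e) ^ 2 * w t ^ 2) t := by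
    intro t
    have h1 : HasDerivAt w (d * (a * y t + b * z t + c) + e * (d * y t + e * z t + f)) t :=
      (((hy t).const_mul d).add ((hz t).const_mul e)).add_const f
    have := ((((h1.pow 2).const_mul (1 / 2)).add (((hz t).pow 2).const_mul
      (1 / 2 * (a * e - b * d)))).sub ((hz t).const_mul (d * c - a * f))).const_mul (a + e)
    convert! this using 1
    simp only [hw]
    push_cast
    ring
  have hmono : Monotone G :=
    monotone_of_deriv_nonneg (fun t => (hG' t).differentiableAt)
      (fun t => by rw [(hG' t).deriv]; positivity)
  have hGT : Function.Periodic G T := fun t => by simp only [hG, hw, hyT t, hzT t]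
  have hw0 : ∀ t, w t = 0 := by
    intro t
    have hev : G =ᶠ[𝓝 t] fun _ => G (t - T / 2) := by
      filter_upwards [Icc_mem_nhds (show t - T / 2 < t by linarith)
        (show t < t - T / 2 + T by linarith)] with s hs
      exact le_antisymm ((hmono hs.2).trans (hGT (t - T / 2)).le) (hmono hs.1)
    have h1 := (hG' t).unique ((hasDerivAt_const t (G (t - T / 2))).congr_of_eventuallyEq hev)
    have h2 : (a + e) ^ 2 ≠ 0 := pow_ne_zero 2 htr
    exact pow_eq_zero_iff two_ne_zero |>.1 ((mul_eq_zero.1 h1).resolve_left h2)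
  have hzc : ∀ t, z t = z 0 := fun t =>
    is_const_of_deriv_eq_zero (fun t => (hz t).differentiableAt)
      (fun t => by rw [(hz t).deriv]; exact hw0 t) t 0
  intro t
  refine ⟨?_, hzc t⟩
  have h1 := hw0 t
  have h2 := hw0 0
  simp only [hw] at h1 h2
  rw [hzc t] at h1
  exact mul_left_cancel₀ hd (by linarith)

/-- Concatenation of an arc in `f > 0` and an arc in `f < 0` into a periodic orbit. -/
theorem isPeriodicOrbit_of_arcs {X : PiecewiseField} {c₁ c₂ : ℝ → R3} {τ₁ τ₂ : ℝ}
    (hτ₁ : 0 < τ₁) (hτ₂ : 0 < τ₂) (hP : Continuous X.plus) (hM : Continuous X.minus)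
    (h₁ : ∀ s, HasDerivAt c₁ (X.plus (c₁ s)) s) (h₂ : ∀ s, HasDerivAt c₂ (X.minus (c₂ s)) s)
    (h12 : c₁ τ₁ = c₂ 0) (h21 : c₂ τ₂ = c₁ 0) (hz1 : X.f (c₁ 0) = 0) (hz2 : X.f (c₂ 0) = 0)
    (hpos : ∀ s ∈ Ioo 0 τ₁, 0 < X.f (c₁ s)) (hneg : ∀ s ∈ Ioo 0 τ₂, X.f (c₂ s) < 0) :
    X.IsPeriodicOrbit (c₁ '' Icc 0 τ₁ ∪ c₂ '' Icc 0 τ₂) := by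
  have hc1 : Continuous c₁ := continuous_iff_continuousAt.2 fun s => (h₁ s).continuousAt
  have hc2 : Continuous c₂ := continuous_iff_continuousAt.2 fun s => (h₂ s).continuousAt
  set T := τ₁ + τ₂ with hTdef
  have hT : 0 < T := add_pos hτ₁ hτ₂
  set c : ℝ → R3 := fun s => if s < τ₁ then c₁ s else c₂ (s - τ₁) with hc
  set w : ℝ → R3 := fun s => if s < τ₁ then X.plus (c₁ s) else X.minus (c₂ (s - τ₁)) with hw
  have hcc : Continuous c := by
    have : c = fun s => if τ₁ ≤ s then c₂ (s - τ₁) else c₁ s := by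
      funext s
      by_cases h : s < τ₁
      · simp [hc, h, not_le.2 h]
      · simp [hc, h, not_lt.1 h]
    rw [this]
    refine Continuous.if_le (by fun_prop) hc1 continuous_const continuous_id ?_
    intro x hx
    rw [← hx, sub_self, h12]
  have hc0 : c 0 = c₁ 0 := by simp [hc, hτ₁]
  have hcT : c T = c₁ 0 := by
    simp only [hc, hTdef]
    rw [if_neg (by linarith), add_sub_cancel_left, h21]
  -- The phase in `[0, T)`; the periodic solution is the closed curve `c` read at this phase.
  set φ : ℝ → ℝ := fun t => T * Int.fract (t / T) with hφ
  have hφmem : ∀ t, φ t ∈ Ico 0 T := fun t =>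
    ⟨mul_nonneg hT.le (Int.fract_nonneg _), by
      have := Int.fract_lt_one (t / T)
      simp only [hφ]; nlinarith⟩
  have hφid : ∀ s ∈ Ico 0 T, φ s = s := by
    intro s hs
    simp only [hφ]
    rw [Int.fract_eq_self.2 ⟨div_nonneg hs.1 hT.le, (div_lt_one hT).2 hs.2⟩]
    field_simp
  have hφper : ∀ t, φ (t + T) = φ t := by
    intro t
    simp only [hφ]
    rw [add_div, div_self hT.ne', Int.fract_add_one]
  set γ : ℝ → R3 := fun t => c (φ t) with hγ
  have hγc : Continuous γ := by
    have h1 : Continuous ((fun x => c (T * x)) ∘ Int.fract) := by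
      refine ContinuousOn.comp_fract'' (Continuous.continuousOn (by fun_prop)) ?_
      simp [hc0, hcT]
    exact h1.comp (continuous_id.div_const T)
  have hcderiv : ∀ s ∈ Ico 0 T, HasDerivWithinAt c (w s) (Ioi s) s := by
    intro s hs
    by_cases h : s < τ₁
    · have hd : HasDerivWithinAt c₁ (w s) (Ioi s) s := by
        simp only [hw, if_pos h]; exact (h₁ s).hasDerivWithinAt
      refine hd.congr_of_eventuallyEq ?_ (by simp [hc, h])
      filter_upwards [Ioo_mem_nhdsGT h] with x hx
      simp [hc, hx.2]
    · have hd : HasDerivWithinAt (fun x => c₂ (x - τ₁)) (w s) (Ioi s) s := by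
        simp only [hw, if_neg h]
        exact ((h₂ (s - τ₁)).comp_sub_const s τ₁).hasDerivWithinAt
      refine hd.congr_of_eventuallyEq ?_ (by simp [hc, h])
      filter_upwards [self_mem_nhdsWithin] with x hx
      have : ¬ x < τ₁ := not_lt.2 ((not_lt.1 h).trans (le_of_lt hx))
      simp [hc, this]
  -- A right derivative exists at every time, corners included. With continuity and integrability
  -- this suffices for the fundamental theorem of calculus.
  have hγderiv : ∀ t, HasDerivWithinAt γ (w (φ t)) (Ioi t) t := by
    intro t
    set n : ℝ := T * (⌊t / T⌋ : ℝ) with hn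
    have hφt : φ t = t - n := by
      simp only [hφ, hn, Int.fract]; field_simp
    have hm := hφmem t
    rw [hφt] at hm
    have h1 : HasDerivWithinAt (fun x => c (x - n)) (w (φ t)) (Ioi t) t := by
      have h2 := hcderiv _ hm
      rw [hφt]
      have h3 : HasDerivWithinAt (fun x : ℝ => x - n) 1 (Ioi t) t :=
        ((hasDerivAt_id t).sub_const n).hasDerivWithinAt
      have := HasDerivWithinAt.scomp (t' := Ioi (t - n)) t h2 h3
        (fun x hx => by simp only [mem_Ioi] at hx ⊢; linarith)
      rw [one_smul] at this
      exact this
    have hev : ∀ x ∈ Ico t (T + n), γ x = c (x - n) := by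
      intro x hx
      have : φ x = x - n := by
        have h4 : φ x = φ (x - n) := by
          simp only [hφ, hn]
          rw [sub_div, mul_div_cancel_left₀ _ hT.ne', Int.fract_sub_intCast]
        rw [h4, hφid _ ⟨by linarith [hm.1, hx.1], by linarith [hx.2]⟩]
      simp only [hγ, this]
    refine h1.congr_of_eventuallyEq ?_ (hev t ⟨le_rfl, by linarith [hm.2]⟩)
    filter_upwards [Ioo_mem_nhdsGT (show t < T + n by linarith [hm.2])] with x hx
    exact hev x ⟨hx.1.le, hx.2⟩
  have hwm : Measurable w :=
    Measurable.ite measurableSet_Iio (hP.comp hc1).measurable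
      (hM.comp (hc2.comp (continuous_id.sub continuous_const))).measurable
  have hvm : Measurable fun t => w (φ t) :=
    hwm.comp ((measurable_fract.comp (measurable_id.div_const T)).const_mul T)
  obtain ⟨C, hC⟩ : ∃ C, ∀ s ∈ Icc 0 T, ‖w s‖ ≤ C := by
    obtain ⟨C1, h1⟩ := (isCompact_Icc (a := (0 : ℝ)) (b := T)).exists_bound_of_continuousOn
      (hP.comp hc1).continuousOn
    obtain ⟨C2, h2⟩ := (isCompact_Icc (a := (0 : ℝ)) (b := T)).exists_bound_of_continuousOn
      (hM.comp (hc2.comp (continuous_id.sub (continuous_const (y := τ₁))))).continuousOn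
    refine ⟨max C1 C2, fun s hs => ?_⟩
    by_cases h : s < τ₁
    · simp only [hw, if_pos h]; exact (h1 s hs).trans (le_max_left _ _)
    · simp only [hw, if_neg h]; exact (h2 s hs).trans (le_max_right _ _)
  have hvint : ∀ a b : ℝ, IntervalIntegrable (fun t => w (φ t)) volume a b := by
    intro a b
    refine (intervalIntegrable_const (c := C)).mono_fun hvm.aestronglyMeasurable ?_
    refine Eventually.of_forall fun t => ?_
    refine (hC _ (Ico_subset_Icc_self (hφmem t))).trans (le_abs_self _)
  have hγ0 : γ 0 = c₁ 0 := by
    simp only [hγ]; rw [hφid 0 ⟨le_rfl, hT⟩, hc0]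
  have hrange : range γ = c '' Icc 0 T := by
    apply Subset.antisymm
    · rintro _ ⟨t, rfl⟩
      exact ⟨φ t, Ico_subset_Icc_self (hφmem t), rfl⟩
    · rintro _ ⟨s, hs, rfl⟩
      rcases hs.2.eq_or_lt with h | h
      · exact ⟨0, by rw [hγ0, h, hcT]⟩
      · exact ⟨s, by simp only [hγ]; rw [hφid s ⟨hs.1, h⟩]⟩
  refine ⟨γ, T, hT, ⟨fun t => w (φ t), hvint, Eventually.of_forall fun t => ?_, fun t => ?_⟩,
    fun t => by simp only [hγ, hφper], ⟨τ₁ / 2, ?_⟩, ?_⟩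
  · have hm := hφmem t
    simp only [hγ]
    generalize φ t = s at hm
    by_cases h : s < τ₁
    · simp only [hc, hw, if_pos h]
      rcases hm.1.eq_or_lt with h0 | h0
      · right; right
        rw [← h0]
        exact ⟨hz1, right_mem_segment _ _ _⟩
      · left
        exact ⟨hpos s ⟨h0, h⟩, rfl⟩
    · simp only [hc, hw, if_neg h]
      rcases (not_lt.1 h).eq_or_lt with h0 | h0
      · right; right
        rw [← h0, sub_self]
        exact ⟨hz2, left_mem_segment _ _ _⟩
      · right; left
        exact ⟨hneg _ ⟨by linarith, by linarith [hm.2]⟩, rfl⟩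
  · rw [intervalIntegral.integral_eq_sub_of_hasDeriv_right hγc.continuousOn
      (fun x _ => hγderiv x) (hvint 0 t)]
    abel
  · intro hcon
    rw [hγ0] at hcon
    have h1 : γ (τ₁ / 2) = c₁ (τ₁ / 2) := by
      simp only [hγ]
      rw [hφid _ ⟨by linarith, by linarith⟩]
      simp only [hc]
      rw [if_pos (by linarith)]
    have h2 := hpos (τ₁ / 2) ⟨by linarith, by linarith⟩
    rw [← h1, hcon, hz1] at h2
    exact lt_irrefl _ h2
  · rw [hrange]
    apply Subset.antisymm
    · rintro _ (⟨s, hs, rfl⟩ | ⟨s, hs, rfl⟩)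
      · rcases hs.2.eq_or_lt with h | h
        · refine ⟨τ₁, ⟨hτ₁.le, by linarith⟩, ?_⟩
          simp [hc, h, h12]
        · exact ⟨s, ⟨hs.1, by linarith⟩, by simp [hc, h]⟩
      · refine ⟨s + τ₁, ⟨by linarith [hs.1], by linarith [hs.2]⟩, ?_⟩
        have : ¬ s + τ₁ < τ₁ := by linarith [hs.1]
        simp [hc, this]
    · rintro _ ⟨s, hs, rfl⟩
      by_cases h : s < τ₁
      · left; exact ⟨s, ⟨hs.1, h.le⟩, by simp [hc, h]⟩
      · right
        exact ⟨s - τ₁, ⟨by linarith [not_lt.1 h], by linarith [hs.2]⟩, by simp [hc, h]⟩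

/-! ### Division by the small parameter -/

/-- Since the second derivative vanishes at `0`, the mean value inequality applied to `f y - y`
gives `|f x - x| ≤ c |x|²` near `0` for every `c > 0`. After division by `x` this is exactly a zero
derivative of the quotient, whose removable value is `1`. -/
theorem exists_eq_mul_of_tangent_id {f f' : ℝ → ℝ} (hf : ∀ᶠ x in 𝓝 0, HasDerivAt f (f' x) x)
    (hf' : HasDerivAt f' 0 0) (h0 : f 0 = 0) (h1 : f' 0 = 1) :
    ∃ h : ℝ → ℝ, h 0 = 1 ∧ HasDerivAt h 0 0 ∧ ∀ x, f x = x * h x := by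
  refine ⟨fun x => if x = 0 then 1 else f x / x, by simp, ?_, fun x => ?_⟩
  · rw [hasDerivAt_iff_isLittleO]
    simp only [sub_zero, smul_zero, if_true]
    rw [Asymptotics.isLittleO_iff]
    intro c hc
    rw [hasDerivAt_iff_isLittleO] at hf'
    have h2 := (Asymptotics.isLittleO_iff.1 hf') hc
    simp only [sub_zero, smul_zero, h1] at h2
    obtain ⟨r, hr, hball⟩ := Metric.eventually_nhds_iff_ball.1 (hf.and h2)
    filter_upwards [Metric.ball_mem_nhds (0 : ℝ) hr] with x hx
    by_cases hx0 : x = 0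
    · simp [hx0]
    · rw [if_neg hx0]
      have hseg : segment ℝ 0 x ⊆ Metric.ball 0 r :=
        (convex_ball (0 : ℝ) r).segment_subset (Metric.mem_ball_self hr) hx
      have hnorm : ∀ y ∈ segment ℝ 0 x, ‖y‖ ≤ ‖x‖ := by
        intro y hy
        have := (convex_closedBall (0 : ℝ) ‖x‖).segment_subset (by simp) (by simp) hy
        simpa using this
      have := (convex_segment (0 : ℝ) x).norm_image_sub_le_of_norm_hasDerivWithin_le
        (f := fun y => f y - y) (f' := fun y => f' y - 1) (C := c * ‖x‖)
        (fun y hy => ((hball y (hseg hy)).1.sub (hasDerivAt_id y)).hasDerivWithinAt)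
        (fun y hy => (hball y (hseg hy)).2.trans
          (mul_le_mul_of_nonneg_left (hnorm y hy) hc.le))
        (left_mem_segment ℝ 0 x) (right_mem_segment ℝ 0 x)
      simp only [h0, sub_zero] at this
      have hx' : 0 < ‖x‖ := norm_pos_iff.2 hx0
      rw [show f x / x - 1 = (f x - x) / x by field_simp, norm_div, div_le_iff₀ hx']
      exact this
  · by_cases hx : x = 0
    · simp [hx, h0]
    · simp only [if_neg hx]; field_simp

theorem exists_sinh_eq_mul : ∃ h : ℝ → ℝ, h 0 = 1 ∧ HasDerivAt h 0 0 ∧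
    ∀ x, Real.sinh x = x * h x :=
  exists_eq_mul_of_tangent_id (f' := Real.cosh) (Eventually.of_forall Real.hasDerivAt_sinh)
    (by simpa using Real.hasDerivAt_cosh 0) (by simp) (by simp)

theorem exists_half_log_eq_mul : ∃ h : ℝ → ℝ, h 0 = 1 ∧ HasDerivAt h 0 0 ∧
    ∀ x, 1 / 2 * Real.log ((1 + x) / (1 - x)) = x * h x := by
  refine exists_eq_mul_of_tangent_id (f' := fun x => 1 / (1 - x ^ 2)) ?_ ?_ (by simp) (by simp)
  · filter_upwards [Ioo_mem_nhds (show (-1 : ℝ) < 0 by norm_num) (show (0 : ℝ) < 1 by norm_num)]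
      with y hy
    have hp : 0 < (1 + y) / (1 - y) := div_pos (by linarith [hy.1]) (by linarith [hy.2])
    have h3 : (1 - y) ≠ 0 := by linarith [hy.2]
    have h5 : (1 + y) ≠ 0 := by linarith [hy.1]
    have h1 : HasDerivAt (fun y : ℝ => 1 / 2 * Real.log ((1 + y) / (1 - y)))
        (1 / 2 * (((1 * (1 - y) - (1 + y) * (-1)) / (1 - y) ^ 2) / ((1 + y) / (1 - y)))) y :=
      ((((hasDerivAt_id y).const_add 1).div ((hasDerivAt_id y).const_sub 1) h3).log
        hp.ne').const_mul _
    convert! h1 using 1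
    rw [show 1 - y ^ 2 = (1 - y) * (1 + y) by ring]
    field_simp; ring
  · have h1 : HasDerivAt (fun x : ℝ => 1 - x ^ 2) (-(((2 : ℕ) : ℝ) * (0 : ℝ) ^ (2 - 1))) 0 :=
      (hasDerivAt_pow 2 (0 : ℝ)).const_sub 1
    have := (hasDerivAt_const (0 : ℝ) (1 : ℝ)).div h1 (by norm_num)
    convert! this using 1
    norm_num

/-! ### Arcs of zero rate -/

namespace FamilyIndex

variable {i : FamilyIndex}

theorem one_add_cs_pos {u : ℝ} (hu : u ∈ i.dom) : 0 < 1 + i.cs u := by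
  cases i
  · have h1 := Real.cos_lt_cos_of_nonneg_of_le_pi hu.1.le le_rfl hu.2
    rw [Real.cos_pi] at h1
    change 0 < 1 + Real.cos u
    linarith
  · have := Real.cosh_pos u
    change 0 < 1 + Real.cosh u
    linarith

/-- At rate zero the arc is symmetric about its midpoint, and the launch ordinate is the tangent of
half the angle `u`. -/
theorem launch_zero {u : ℝ} (hu : u ∈ i.dom) : i.launch 0 u = i.sn u / (1 + i.cs u) := by
  apply launch_eq_of hu
  have := (one_add_cs_pos hu).ne'
  have h := i.cs_sq_add u
  simp only [zero_mul, neg_zero, Real.exp_zero]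
  field_simp
  linear_combination h

theorem launch_zero_pos {u : ℝ} (hu : u ∈ i.dom) : 0 < i.launch 0 u := by
  rw [launch_zero hu]; exact div_pos (sn_pos hu) (one_add_cs_pos hu)

theorem one_add_sgn_mul_launch_zero_sq {u : ℝ} (hu : u ∈ i.dom) :
    1 + i.sgn * i.launch 0 u ^ 2 = 2 / (1 + i.cs u) := by
  have := (one_add_cs_pos hu).ne'
  have h := i.cs_sq_add u
  rw [launch_zero hu]
  field_simp
  linear_combination h

theorem one_add_sgn_mul_launch_zero_sq_pos {u : ℝ} (hu : u ∈ i.dom) :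
    0 < 1 + i.sgn * i.launch 0 u ^ 2 := by
  rw [one_add_sgn_mul_launch_zero_sq hu]
  exact div_pos two_pos (one_add_cs_pos hu)

theorem arc_launch_zero {u : ℝ} (hu : u ∈ i.dom) : i.arc (i.launch 0 u) = u / 2 := by
  have hne := (one_add_cs_pos hu).ne'
  have h0 := pos_of_mem_dom hu
  apply arc_eq_of
  · cases i
    · exact Real.cos_pos_of_mem_Ioo ⟨by linarith [Real.pi_pos], by linarith [hu.2]⟩
    · exact Real.cosh_pos _
  · rw [launch_zero hu]
    field_simp
    have := i.sn_sub u (u / 2)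
    rw [show u - u / 2 = u / 2 by ring] at this
    linarith
  · rintro rfl
    exact ⟨by linarith [Real.pi_pos], by linarith [hu.2]⟩

theorem analyticAt_launch {δ u : ℝ} (hu : u ∈ i.dom) : AnalyticAt ℝ (i.launch δ) u := by
  have h1 := i.analyticAt_cs u
  have h2 := i.analyticAt_sn u
  have h3 : AnalyticAt ℝ (fun u => Real.exp (-(δ * u))) u := by fun_prop
  exact (analyticAt_const.mul (h3.sub h1)).div h2 (sn_pos hu).ne'

end FamilyIndex

/-! ### The displacement function and its second-order expansion -/

/-- The parameters of the perturbation below the switching plane. -/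
structure LowerData where
  i : FamilyIndex
  b : ℝ
  k : ℝ
  l : ℝ

namespace LowerData

variable (P : LowerData)

/-- Frequency of the lower spiral. -/
noncomputable def freq (ε : ℝ) : ℝ := Real.sqrt ((1 + ε * P.b) * (1 + ε * P.k))

/-- The centre of the lower spiral lies at height `sgn * height`. -/
noncomputable def height (ε : ℝ) : ℝ :=
  1 + ε * ((1 + ε * P.k) * (P.l - P.b) / ((1 + ε * P.b) * (1 + ε * P.k) + P.i.sgn * ε ^ 2))

/-- Horizontal scale of the lower spiral. -/
noncomputable def scale (ε : ℝ) : ℝ := P.height ε * P.freq ε / (1 + ε * P.k)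

/-- The centre of the lower spiral has abscissa `ε * offset`. -/
noncomputable def offset (ε : ℝ) : ℝ := P.i.sgn * (P.height ε - 1) / (1 + ε * P.k)

/-- Normalised rate of the lower spiral. -/
noncomputable def rate (ε : ℝ) : ℝ := ε / P.freq ε

/-- Normalised endpoint of the lower arc closing the upper arc of duration `u`. -/
noncomputable def out (ε u : ℝ) : ℝ := (P.i.launch ε u - ε * P.offset ε) / P.scale ε

/-- Normalised starting point of the lower arc following the upper arc of duration `u`. -/
noncomputable def inn (ε u : ℝ) : ℝ := (P.i.launch (-ε) u + ε * P.offset ε) / P.scale ε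

/-- Duration, in normalised time, of the lower arc. -/
noncomputable def lowerTime (ε u : ℝ) : ℝ := P.i.arc (P.out ε u) + P.i.arc (P.inn ε u)

/-- Variation of the first integral of the lower spiral between the ends of the upper arc. -/
noncomputable def gap (ε u : ℝ) : ℝ :=
  1 / 2 * Real.log ((1 + P.i.sgn * P.out ε u ^ 2) / (1 + P.i.sgn * P.inn ε u ^ 2)) +
    P.rate ε * P.lowerTime ε u

/-- The leading coefficient of `gap`. -/
noncomputable def melnikov (u : ℝ) : ℝ :=
  -(P.l - P.b) * P.i.sn u - (P.b + P.k) / 2 * u +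
    (P.l - (P.b + P.k) / 2) * (u * (1 + P.i.cs u) - P.i.sn u)

theorem freq_zero : P.freq 0 = 1 := by simp [freq]
theorem height_zero : P.height 0 = 1 := by simp [height]
theorem scale_zero : P.scale 0 = 1 := by simp [scale, freq_zero, height_zero]
theorem offset_zero : P.offset 0 = 0 := by simp [offset, height_zero]
theorem rate_zero : P.rate 0 = 0 := by simp [rate]
theorem out_zero (u : ℝ) : P.out 0 u = P.i.launch 0 u := by simp [out, scale_zero]
theorem inn_zero (u : ℝ) : P.inn 0 u = P.i.launch 0 u := by simp [inn, scale_zero]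

/-- At `ε = 0` the normalised endpoints coincide and the rate vanishes, so every duration closes:
the unperturbed system has a continuum of periodic orbits. -/
theorem gap_zero {u : ℝ} (hu : u ∈ P.i.dom) : P.gap 0 u = 0 := by
  have := FamilyIndex.one_add_sgn_mul_launch_zero_sq_pos hu
  rw [gap, out_zero, inn_zero, rate_zero, div_self this.ne']
  simp

theorem hasDerivAt_affine (c : ℝ) : HasDerivAt (fun ε : ℝ => 1 + ε * c) c 0 := by
  simpa using ((hasDerivAt_id (0 : ℝ)).mul_const c).const_add 1

theorem hasDerivAt_freq : HasDerivAt P.freq ((P.b + P.k) / 2) 0 := by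
  have := ((hasDerivAt_affine P.b).mul (hasDerivAt_affine P.k)).sqrt (by simp)
  convert! this using 1
  simp

theorem hasDerivAt_height : HasDerivAt P.height (P.l - P.b) 0 := by
  have h1 : HasDerivAt (fun ε : ℝ => (1 + ε * P.b) * (1 + ε * P.k) + P.i.sgn * ε ^ 2)
      (P.b * (1 + 0 * P.k) + (1 + 0 * P.b) * P.k +
        P.i.sgn * (((2 : ℕ) : ℝ) * (0 : ℝ) ^ (2 - 1))) 0 :=
    ((hasDerivAt_affine P.b).mul (hasDerivAt_affine P.k)).add
      ((hasDerivAt_pow 2 (0 : ℝ)).const_mul P.i.sgn)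
  have h2 := ((hasDerivAt_affine P.k).mul_const (P.l - P.b)).div h1 (by simp)
  have h3 := ((hasDerivAt_id (0 : ℝ)).mul h2).const_add 1
  convert! h3 using 1
  simp

theorem hasDerivAt_scale : HasDerivAt P.scale (P.l - (P.b + P.k) / 2) 0 := by
  have := (P.hasDerivAt_height.mul P.hasDerivAt_freq).div (hasDerivAt_affine P.k) (by simp)
  convert! this using 1
  simp [height_zero, freq_zero]
  ring

theorem hasDerivAt_offset : HasDerivAt P.offset (P.i.sgn * (P.l - P.b)) 0 := by
  have := ((P.hasDerivAt_height.sub_const 1).const_mul P.i.sgn).div (hasDerivAt_affine P.k)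
    (by simp)
  convert! this using 1
  simp [height_zero]

/-- The squared radii at the two ends are proportional to `1 + ε X` and `1 - ε X`, so the
logarithmic term is `artanh (ε X)`. Both terms of the gap then contain a factor `ε`, and the
quotient `W` starts at `-u + u = 0`: growth above and decay below compensate at first order.
Differentiating `W` once gives the coefficient of `ε²`. -/
theorem hasDerivAt_gap_div {u : ℝ} (hu : u ∈ P.i.dom) : ∃ W : ℝ → ℝ, W 0 = 0 ∧
    HasDerivAt W (P.melnikov u) 0 ∧ ∀ᶠ ε in 𝓝 0, P.gap ε u = ε * W ε := by
  obtain ⟨h, hh0, hh', hh⟩ := exists_sinh_eq_mul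
  obtain ⟨g, hg0, hg', hg⟩ := exists_half_log_eq_mul
  have hS := (FamilyIndex.sn_pos hu).ne'
  have hCpos := FamilyIndex.one_add_cs_pos hu
  have hC := hCpos.ne'
  have hσ := P.i.sgn_sq
  set σ := P.i.sgn with hσdef
  set S := P.i.sn u with hSdef
  set C := P.i.cs u with hCdef
  set t := P.i.launch 0 u with ht
  have htv : t = S / (1 + C) := FamilyIndex.launch_zero hu
  have hDv : 1 + σ * t ^ 2 = 2 / (1 + C) := FamilyIndex.one_add_sgn_mul_launch_zero_sq hu
  have hDpos : 0 < 1 + σ * t ^ 2 := FamilyIndex.one_add_sgn_mul_launch_zero_sq_pos hu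
  set r1 := P.l - (P.b + P.k) / 2 with hr1
  -- `m` is the part of `launch ε u` even in `ε`. The odd part and the displacement of the lower
  -- centre form `ε * q`, so that `out` and `inn` are `(m ± ε q) / scale`.
  set m : ℝ → ℝ := fun ε => σ * (Real.cosh (ε * u) - C) / S with hm
  set q : ℝ → ℝ := fun ε => -σ * u * h (ε * u) / S - P.offset ε with hq
  have hm0 : m 0 = t := by
    simp only [hm, ht, FamilyIndex.launch]
    simp [← hσdef, ← hSdef, ← hCdef]
  have hq0 : q 0 = -σ * u / S := by simp [hq, hh0, offset_zero]
  have hlin : HasDerivAt (fun ε : ℝ => ε * u) u 0 := by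
    simpa using (hasDerivAt_id (0 : ℝ)).mul_const u
  have hm' : HasDerivAt m 0 0 := by
    have := (((hlin.cosh).sub_const C).const_mul σ).div_const S
    convert! this using 1
    simp
  have hhc : HasDerivAt (fun ε => h (ε * u)) 0 0 := by
    have h1 : HasDerivAt h 0 ((fun ε : ℝ => ε * u) 0) := by simpa using hh'
    have := h1.comp (0 : ℝ) hlin
    rw [zero_mul] at this
    exact this
  have hq' : HasDerivAt q (-(σ * (P.l - P.b))) 0 := by
    have := ((hhc.const_mul (-σ * u)).div_const S).sub P.hasDerivAt_offset
    convert! this using 1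
    simp [← hσdef]
  set D : ℝ → ℝ := fun ε => P.scale ε ^ 2 + σ * (m ε ^ 2 + (ε * q ε) ^ 2) with hD
  have hD0 : D 0 = 1 + σ * t ^ 2 := by simp [hD, scale_zero, hm0]
  have hεq : HasDerivAt (fun ε => ε * q ε) (q 0) 0 := by
    have := (hasDerivAt_id (0 : ℝ)).mul hq'
    convert! this using 1
    simp
  have hD' : HasDerivAt D (2 * r1) 0 := by
    have := (P.hasDerivAt_scale.pow 2).add (((hm'.pow 2).add (hεq.pow 2)).const_mul σ)
    convert! this using 1
    simp [scale_zero, hr1]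
  set X : ℝ → ℝ := fun ε => 2 * σ * m ε * q ε / D ε with hX
  have hX' : HasDerivAt X (((2 * σ * t * (-(σ * (P.l - P.b)))) * (1 + σ * t ^ 2) -
      2 * σ * t * (-σ * u / S) * (2 * r1)) / (1 + σ * t ^ 2) ^ 2) 0 := by
    have := ((hm'.const_mul (2 * σ)).mul hq').div hD' (by rw [hD0]; exact hDpos.ne')
    convert! this using 1
    simp only [Pi.mul_apply, hm0, hq0, hD0]
    ring
  have hX0 : X 0 = -u := by
    simp only [hX, hm0, hq0, hD0, hDv]
    rw [htv]
    field_simp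
    linear_combination (-u) * hσ
  set A : ℝ → ℝ := fun ε => P.i.arc (P.out ε u) + P.i.arc (P.inn ε u) with hA
  have hout : ∀ ε, P.out ε u = (m ε + ε * q ε) / P.scale ε := by
    intro ε
    have h1 : Real.exp (-(ε * u)) = Real.cosh (ε * u) - ε * u * h (ε * u) := by
      rw [← hh, Real.cosh_sub_sinh]
    simp only [out, FamilyIndex.launch, h1, hm, hq, ← hσdef, ← hSdef, ← hCdef]
    congr 1
    ring
  have hinn : ∀ ε, P.inn ε u = (m ε - ε * q ε) / P.scale ε := by
    intro ε
    have h1 : Real.exp (-(-ε * u)) = Real.cosh (ε * u) + ε * u * h (ε * u) := by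
      rw [← hh, Real.cosh_add_sinh]; ring_nf
    simp only [inn, FamilyIndex.launch, h1, hm, hq, ← hσdef, ← hSdef, ← hCdef]
    congr 1
    ring
  have hout' : HasDerivAt (fun ε => P.out ε u) (q 0 - t * r1) 0 := by
    have := (hm'.add hεq).div P.hasDerivAt_scale (by simp [scale_zero])
    rw [show (fun ε => P.out ε u) = fun ε => (m ε + ε * q ε) / P.scale ε from funext hout]
    convert! this using 1
    simp [scale_zero, hm0, hr1]
  have hinn' : HasDerivAt (fun ε => P.inn ε u) (-q 0 - t * r1) 0 := by
    have := (hm'.sub hεq).div P.hasDerivAt_scale (by simp [scale_zero])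
    rw [show (fun ε => P.inn ε u) = fun ε => (m ε - ε * q ε) / P.scale ε from funext hinn]
    convert! this using 1
    simp [scale_zero, hm0, hr1]
  have harc : HasDerivAt P.i.arc (1 / (1 + σ * t ^ 2)) t := FamilyIndex.hasDerivAt_arc hDpos
  have hA' : HasDerivAt A (-2 * t * r1 / (1 + σ * t ^ 2)) 0 := by
    have h1 := HasDerivAt.comp (0 : ℝ) (h₂ := P.i.arc) (h := fun ε => P.out ε u)
      (by simpa only [out_zero] using harc) hout'
    have h2 := HasDerivAt.comp (0 : ℝ) (h₂ := P.i.arc) (h := fun ε => P.inn ε u)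
      (by simpa only [inn_zero] using harc) hinn'
    convert! h1.add h2 using 1
    ring
  have hA0 : A 0 = u := by
    simp only [hA, out_zero, inn_zero, FamilyIndex.arc_launch_zero hu]
    ring
  have hfreqinv : HasDerivAt (fun ε => 1 / P.freq ε) (-((P.b + P.k) / 2)) 0 := by
    have := (hasDerivAt_const (0 : ℝ) (1 : ℝ)).div P.hasDerivAt_freq (by simp [freq_zero])
    convert! this using 1
    simp [freq_zero]
  have hgX : HasDerivAt (fun ε => g (ε * X ε)) 0 0 := by
    have h1 : HasDerivAt (fun ε => ε * X ε) (X 0) 0 := by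
      have := (hasDerivAt_id (0 : ℝ)).mul hX'
      convert! this using 1
      simp
    have h2 : HasDerivAt g 0 ((fun ε => ε * X ε) 0) := by simpa using hg'
    have := h2.comp (0 : ℝ) h1
    rw [zero_mul] at this
    exact this
  -- The factor `g` has zero derivative at `0`, so the derivative of `W` comes only from `X`, the
  -- inverse frequency and the total angle `A`.
  refine ⟨fun ε => X ε * g (ε * X ε) + 1 / P.freq ε * A ε, ?_, ?_, ?_⟩
  · simp [hX0, hg0, freq_zero, hA0]
  · have := (hX'.mul hgX).add (hfreqinv.mul hA')
    convert! this using 1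
    simp only [zero_mul, hg0, freq_zero, hA0, melnikov, ← hSdef, ← hCdef, ← hr1, hDv]
    rw [htv]
    field_simp
    linear_combination (2 * S * (P.l - P.b) - 2 * u * r1 * (1 + C)) * hσ
  · have e1 : ∀ᶠ ε in 𝓝 0, D ε ≠ 0 :=
      hD'.continuousAt.eventually_ne (by rw [hD0]; exact hDpos.ne')
    have e2 : ∀ᶠ ε in 𝓝 0, P.scale ε ≠ 0 :=
      P.hasDerivAt_scale.continuousAt.eventually_ne (by simp [scale_zero])
    filter_upwards [e1, e2] with ε h1 h2
    have hlog : (1 + σ * P.out ε u ^ 2) / (1 + σ * P.inn ε u ^ 2) =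
        (1 + ε * X ε) / (1 - ε * X ε) := by
      have n1 : 1 + σ * P.out ε u ^ 2 = D ε / P.scale ε ^ 2 * (1 + ε * X ε) := by
        rw [hout]; simp only [hX]; field_simp; simp only [hD]; ring
      have n2 : 1 + σ * P.inn ε u ^ 2 = D ε / P.scale ε ^ 2 * (1 - ε * X ε) := by
        rw [hinn]; simp only [hX]; field_simp; simp only [hD]; ring
      rw [n1, n2, mul_div_mul_left _ _ (div_ne_zero h1 (pow_ne_zero 2 h2))]
    rw [gap, ← hσdef, hlog, hg, rate, lowerTime]
    simp only [hA]
    ring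

theorem tendsto_gap_div_sq {u : ℝ} (hu : u ∈ P.i.dom) :
    Tendsto (fun ε => P.gap ε u / ε ^ 2) (𝓝[≠] 0) (𝓝 (P.melnikov u)) := by
  obtain ⟨W, hW0, hW', hW⟩ := P.hasDerivAt_gap_div hu
  refine (hasDerivAt_iff_tendsto_slope.1 hW').congr' ?_
  filter_upwards [self_mem_nhdsWithin, nhdsWithin_le_nhds hW] with ε hε h
  have hε' : ε ≠ 0 := hε
  rw [slope_def_field, h, hW0]
  field_simp
  ring

/-! ### Uniform validity and elimination of the lower flight time -/

/-- Validity of the normal form, for a given `ε`. -/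
structure Small (ε : ℝ) : Prop where
  abs_lt : |ε| < 1
  b_pos : 0 < 1 + ε * P.b
  k_pos : 0 < 1 + ε * P.k
  det_pos : 0 < (1 + ε * P.b) * (1 + ε * P.k) + P.i.sgn * ε ^ 2
  height_pos : 0 < P.height ε
  rate_lt : |P.rate ε| < 1

/-- The upper arc of duration `u` crosses the switching plane at both ends and lands in the domain
of the lower return map. -/
structure Good (ε u : ℝ) : Prop where
  mem_dom : u ∈ P.i.dom
  out_pos : 0 < P.out ε u
  inn_pos : 0 < P.inn ε u
  out_lt : 0 < 1 + P.i.sgn * P.out ε u ^ 2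
  inn_lt : 0 < 1 + P.i.sgn * P.inn ε u ^ 2
  cross_out : |ε| < P.i.launch ε u
  cross_out' : |ε| < (1 + ε * P.k) * P.i.launch ε u
  cross_inn : |ε| < P.i.launch (-ε) u
  cross_inn' : |ε| < (1 + ε * P.k) * P.i.launch (-ε) u

variable {P}

theorem Small.freq_pos {ε : ℝ} (h : P.Small ε) : 0 < P.freq ε :=
  Real.sqrt_pos.2 (mul_pos h.b_pos h.k_pos)

theorem Small.scale_pos {ε : ℝ} (h : P.Small ε) : 0 < P.scale ε :=
  div_pos (mul_pos h.height_pos h.freq_pos) h.k_pos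

variable (P)

theorem continuousAt_rate : ContinuousAt P.rate 0 :=
  continuousAt_id.div P.hasDerivAt_freq.continuousAt (by simp [freq_zero])

theorem eventually_small : ∀ᶠ ε in 𝓝 0, P.Small ε := by
  have hc : ∀ c : ℝ, ∀ᶠ ε in 𝓝 (0 : ℝ), 0 < 1 + ε * c := fun c =>
    (hasDerivAt_affine c).continuousAt.eventually (lt_mem_nhds (by simp))
  have h1 : ∀ᶠ ε in 𝓝 (0 : ℝ), |ε| < 1 :=
    continuous_abs.continuousAt.eventually (gt_mem_nhds (by simp))
  have h2 : ∀ᶠ ε in 𝓝 (0 : ℝ), 0 < (1 + ε * P.b) * (1 + ε * P.k) + P.i.sgn * ε ^ 2 := by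
    have : Continuous fun ε : ℝ => (1 + ε * P.b) * (1 + ε * P.k) + P.i.sgn * ε ^ 2 := by fun_prop
    exact this.continuousAt.eventually (lt_mem_nhds (by simp))
  have h3 : ∀ᶠ ε in 𝓝 (0 : ℝ), 0 < P.height ε :=
    P.hasDerivAt_height.continuousAt.eventually (lt_mem_nhds (by simp [height_zero]))
  have h4 : ∀ᶠ ε in 𝓝 (0 : ℝ), |P.rate ε| < 1 :=
    P.continuousAt_rate.abs.eventually (gt_mem_nhds (by simp [rate_zero]))
  filter_upwards [h1, hc P.b, hc P.k, h2, h3, h4] with ε a1 a2 a3 a4 a5 a6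
  exact ⟨a1, a2, a3, a4, a5, a6⟩

theorem continuous_launch_left {i : FamilyIndex} (u : ℝ) :
    Continuous (fun ε => i.launch ε u) := by
  unfold FamilyIndex.launch
  fun_prop

theorem continuousAt_out (u : ℝ) : ContinuousAt (fun ε => P.out ε u) 0 :=
  ((continuous_launch_left u).continuousAt.sub
    (continuousAt_id.mul P.hasDerivAt_offset.continuousAt)).div
    P.hasDerivAt_scale.continuousAt (by simp [scale_zero])

theorem continuousAt_inn (u : ℝ) : ContinuousAt (fun ε => P.inn ε u) 0 :=
  (((continuous_launch_left u).comp continuous_neg).continuousAt.add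
    (continuousAt_id.mul P.hasDerivAt_offset.continuousAt)).div
    P.hasDerivAt_scale.continuousAt (by simp [scale_zero])

/-- Monotonicity of `launch` reduces lower bounds to `u₁` and upper bounds to `u₂`. Continuity in
`ε` at these two durations then controls the whole interval. -/
theorem eventually_good {u₁ u₂ : ℝ} (h1 : u₁ ∈ P.i.dom) (h2 : u₂ ∈ P.i.dom) :
    ∀ᶠ ε in 𝓝 0, ∀ u ∈ Icc u₁ u₂, P.Good ε u := by
  have ht1 := FamilyIndex.launch_zero_pos h1
  have hl : ContinuousAt (fun ε => P.i.launch ε u₁) 0 := (continuous_launch_left u₁).continuousAt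
  have hl' : ContinuousAt (fun ε => P.i.launch (-ε) u₁) 0 :=
    ((continuous_launch_left u₁).comp continuous_neg).continuousAt
  have hk := (hasDerivAt_affine P.k).continuousAt
  have e1 : ∀ᶠ ε in 𝓝 0, |ε| < P.i.launch ε u₁ :=
    ((continuous_abs.continuousAt).prodMk hl).eventually
      (isOpen_lt continuous_fst continuous_snd |>.mem_nhds (by simpa using ht1))
  have e2 : ∀ᶠ ε in 𝓝 0, |ε| < P.i.launch (-ε) u₁ :=
    ((continuous_abs.continuousAt).prodMk hl').eventually
      (isOpen_lt continuous_fst continuous_snd |>.mem_nhds (by simpa using ht1))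
  have e3 : ∀ᶠ ε in 𝓝 0, |ε| < (1 + ε * P.k) * P.i.launch ε u₁ :=
    ((continuous_abs.continuousAt).prodMk (hk.mul hl)).eventually
      (isOpen_lt continuous_fst continuous_snd |>.mem_nhds (by simpa using ht1))
  have e4 : ∀ᶠ ε in 𝓝 0, |ε| < (1 + ε * P.k) * P.i.launch (-ε) u₁ :=
    ((continuous_abs.continuousAt).prodMk (hk.mul hl')).eventually
      (isOpen_lt continuous_fst continuous_snd |>.mem_nhds (by simpa using ht1))
  have e5 : ∀ᶠ ε in 𝓝 0, 0 < P.out ε u₁ :=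
    (P.continuousAt_out u₁).eventually (lt_mem_nhds (by simpa [out_zero] using ht1))
  have e6 : ∀ᶠ ε in 𝓝 0, 0 < P.inn ε u₁ :=
    (P.continuousAt_inn u₁).eventually (lt_mem_nhds (by simpa [inn_zero] using ht1))
  have hD := FamilyIndex.one_add_sgn_mul_launch_zero_sq_pos h2
  have e7 : ∀ᶠ ε in 𝓝 0, 0 < 1 + P.i.sgn * P.out ε u₂ ^ 2 :=
    ((((P.continuousAt_out u₂).pow 2).const_mul P.i.sgn).const_add 1).eventually
      (lt_mem_nhds (by simpa [out_zero] using hD))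
  have e8 : ∀ᶠ ε in 𝓝 0, 0 < 1 + P.i.sgn * P.inn ε u₂ ^ 2 :=
    ((((P.continuousAt_inn u₂).pow 2).const_mul P.i.sgn).const_add 1).eventually
      (lt_mem_nhds (by simpa [inn_zero] using hD))
  filter_upwards [e1, e2, e3, e4, e5, e6, e7, e8, P.eventually_small] with ε a1 a2 a3 a4 a5 a6 a7 a8
    hs u hu
  have hud : u ∈ P.i.dom := P.i.ordConnected_dom.out h1 h2 hu
  have hε := hs.abs_lt
  have hε' : |-ε| < 1 := by rwa [abs_neg]
  have m1 := (FamilyIndex.strictMonoOn_launch hε).monotoneOn h1 hud hu.1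
  have m2 := (FamilyIndex.strictMonoOn_launch hε).monotoneOn hud h2 hu.2
  have m3 := (FamilyIndex.strictMonoOn_launch hε').monotoneOn h1 hud hu.1
  have m4 := (FamilyIndex.strictMonoOn_launch hε').monotoneOn hud h2 hu.2
  have hr := hs.scale_pos
  have o1 : P.out ε u₁ ≤ P.out ε u := by unfold out; gcongr
  have o2 : P.out ε u ≤ P.out ε u₂ := by unfold out; gcongr
  have o3 : P.inn ε u₁ ≤ P.inn ε u := by unfold inn; gcongr
  have o4 : P.inn ε u ≤ P.inn ε u₂ := by unfold inn; gcongr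
  have key : ∀ x y : ℝ, 0 < x → x ≤ y → 0 < 1 + P.i.sgn * y ^ 2 → 0 < 1 + P.i.sgn * x ^ 2 := by
    intro x y hx hxy h
    cases hi : P.i
    · simp only [FamilyIndex.sgn]; positivity
    · simp only [hi, FamilyIndex.sgn] at h ⊢; nlinarith
  have hk0 := hs.k_pos.le
  exact ⟨hud, a5.trans_le o1, a6.trans_le o3, key _ _ (a5.trans_le o1) o2 a7,
    key _ _ (a6.trans_le o3) o4 a8, a1.trans_le m1,
    a3.trans_le (mul_le_mul_of_nonneg_left m1 hk0), a2.trans_le m3,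
    a4.trans_le (mul_le_mul_of_nonneg_left m3 hk0)⟩

variable {P}

theorem Good.lowerTime_mem {ε u : ℝ} (h : P.Good ε u) : P.lowerTime ε u ∈ P.i.dom :=
  FamilyIndex.arc_add_mem_dom h.out_pos h.out_lt h.inn_pos h.inn_lt

/-- Analyticity in `u` later isolates the zeros of the gap; the expansion in `ε` is only pointwise
in `u` and controls no derivative in `u`. -/
theorem Good.analyticAt_gap {ε u : ℝ} (h : P.Good ε u) (hs : P.Small ε) :
    AnalyticAt ℝ (P.gap ε) u := by
  have h1 : AnalyticAt ℝ (P.out ε) u :=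
    ((FamilyIndex.analyticAt_launch h.mem_dom).sub analyticAt_const).div analyticAt_const
      hs.scale_pos.ne'
  have h2 : AnalyticAt ℝ (P.inn ε) u :=
    ((FamilyIndex.analyticAt_launch h.mem_dom).add analyticAt_const).div analyticAt_const
      hs.scale_pos.ne'
  have h3 : AnalyticAt ℝ (fun u => 1 + P.i.sgn * P.out ε u ^ 2) u :=
    analyticAt_const.add (analyticAt_const.mul (h1.pow 2))
  have h4 : AnalyticAt ℝ (fun u => 1 + P.i.sgn * P.inn ε u ^ 2) u :=
    analyticAt_const.add (analyticAt_const.mul (h2.pow 2))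
  have h5 : AnalyticAt ℝ (fun u => P.i.arc (P.out ε u)) u :=
    (FamilyIndex.analyticAt_arc h.out_lt).comp h1
  have h6 : AnalyticAt ℝ (fun u => P.i.arc (P.inn ε u)) u :=
    (FamilyIndex.analyticAt_arc h.inn_lt).comp h2
  exact (analyticAt_const.mul ((h3.div h4 h.inn_lt.ne').log (div_pos h.out_lt h.inn_lt))).add
    (analyticAt_const.mul (h5.add h6))

/-- The first integral of the lower spiral takes the same value at the ends of a lower arc. -/
theorem Good.gap_eq_zero_of {ε u v : ℝ} (h : P.Good ε u) (hv : v ∈ P.i.dom)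
    (hout : P.i.launch (P.rate ε) v = P.out ε u)
    (hinn : P.i.launch (-P.rate ε) v = P.inn ε u) : P.gap ε u = 0 := by
  obtain ⟨c1, s1, n1⟩ := FamilyIndex.arc_spec h.out_lt
  obtain ⟨c2, s2, n2⟩ := FamilyIndex.arc_spec h.inn_lt
  have e1 := FamilyIndex.launch_add (δ := P.rate ε) hv
  have e2 := FamilyIndex.launch_add (δ := -P.rate ε) hv
  rw [hout] at e1
  rw [hinn] at e2
  set δ := P.rate ε
  set x := P.i.arc (P.out ε u) with hx
  have hcs : P.i.cs (v - x) = P.i.cs x * Real.exp (-(δ * v)) := by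
    rw [P.i.cs_sub, s1, ← e1]; ring
  have hS := (FamilyIndex.sn_pos hv).ne'
  -- Multiplying the two launch equations cancels the exponentials. What is left is the addition
  -- formula saying that `v` is the sum of the angles with tangents `out` and `inn`.
  have hprod : (P.i.cs v + P.i.sgn * (P.i.sn v * P.out ε u)) *
      (P.i.cs v + P.i.sgn * (P.i.sn v * P.inn ε u)) = 1 := by
    rw [e1, e2, ← Real.exp_add]; simp
  have hrel : P.i.cs v * (P.out ε u + P.inn ε u) =
      P.i.sn v * (1 - P.i.sgn * (P.out ε u * P.inn ε u)) := by
    have h1 := P.i.cs_sq_add v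
    apply mul_left_cancel₀ hS
    linear_combination P.i.sgn * (hprod - h1) + (P.i.sn v ^ 2 -
      P.i.cs v * P.i.sn v * (P.out ε u + P.inn ε u) -
      P.i.sgn * P.i.sn v ^ 2 * (P.out ε u * P.inn ε u)) * P.i.sgn_sq
  have hx0 : 0 < x := FamilyIndex.arc_pos h.out_pos h.out_lt
  have harc : P.i.arc (P.inn ε u) = v - x := by
    apply FamilyIndex.arc_eq_of
    · rw [hcs]; exact mul_pos c1 (Real.exp_pos _)
    · rw [hcs, P.i.sn_sub, s1, ← e1]
      linear_combination (-P.i.cs x) * hrel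
    · intro hi
      have hv' : v < Real.pi := by
        rw [hi] at hv; exact hv.2
      have hx' : x < Real.pi / 2 := by
        rw [hx, hi]; exact Real.arctan_lt_pi_div_two _
      have := FamilyIndex.pos_of_mem_dom hv
      exact ⟨by linarith, by linarith⟩
  rw [gap, lowerTime, harc]
  rw [harc, hcs] at n2
  have hratio : (1 + P.i.sgn * P.out ε u ^ 2) / (1 + P.i.sgn * P.inn ε u ^ 2) =
      Real.exp (-(2 * (δ * v))) := by
    rw [div_eq_iff h.inn_lt.ne']
    have h1 : Real.exp (-(2 * (δ * v))) = Real.exp (-(δ * v)) ^ 2 := by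
      rw [← Real.exp_nat_mul]; push_cast; ring_nf
    rw [h1]
    apply mul_left_cancel₀ (pow_ne_zero 2 c1.ne')
    linear_combination n1 - n2
  rw [hratio, Real.log_exp]
  ring

/-- Exponentiating `gap = 0` gives the ratio of the squares of `cs` at the two angles; positivity of
`cs` removes the squares. The subtraction formula then turns this ratio into the launch equations.
-/
theorem Good.launch_lowerTime {ε u : ℝ} (h : P.Good ε u) (h0 : P.gap ε u = 0) :
    P.i.launch (P.rate ε) (P.lowerTime ε u) = P.out ε u ∧
      P.i.launch (-P.rate ε) (P.lowerTime ε u) = P.inn ε u := by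
  obtain ⟨c1, s1, n1⟩ := FamilyIndex.arc_spec h.out_lt
  obtain ⟨c2, s2, n2⟩ := FamilyIndex.arc_spec h.inn_lt
  have hv := h.lowerTime_mem
  set δ := P.rate ε with hδ
  set v := P.lowerTime ε u with hvdef
  set x := P.i.arc (P.out ε u) with hx
  set y := P.i.arc (P.inn ε u) with hy
  have hexp : P.i.cs y = P.i.cs x * Real.exp (-(δ * v)) := by
    have hpos : 0 < (1 + P.i.sgn * P.out ε u ^ 2) / (1 + P.i.sgn * P.inn ε u ^ 2) :=
      div_pos h.out_lt h.inn_lt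
    have h1 : Real.log ((1 + P.i.sgn * P.out ε u ^ 2) / (1 + P.i.sgn * P.inn ε u ^ 2)) =
        -(δ * v) + -(δ * v) := by
      rw [gap] at h0; linarith
    have h2 : (1 + P.i.sgn * P.out ε u ^ 2) / (1 + P.i.sgn * P.inn ε u ^ 2) =
        Real.exp (-(δ * v)) ^ 2 := by
      rw [← Real.exp_log hpos, h1, Real.exp_add, pow_two]
    rw [div_eq_iff h.inn_lt.ne'] at h2
    have h3 : P.i.cs y ^ 2 = (P.i.cs x * Real.exp (-(δ * v))) ^ 2 := by
      apply mul_right_cancel₀ h.inn_lt.ne'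
      linear_combination n2 - n1 + P.i.cs x ^ 2 * h2
    exact (pow_left_inj₀ c2.le (mul_pos c1 (Real.exp_pos _)).le two_ne_zero).1 h3
  have hexp' : P.i.cs x = P.i.cs y * Real.exp (-(-δ * v)) := by
    rw [hexp, mul_assoc, ← Real.exp_add]; simp
  constructor
  · apply FamilyIndex.launch_eq_of hv
    have h1 := P.i.cs_sub v x
    rw [show v - x = y by rw [hvdef, lowerTime]; ring, s1, hexp] at h1
    apply mul_left_cancel₀ c1.ne'
    linear_combination -h1
  · apply FamilyIndex.launch_eq_of hv
    have h1 := P.i.cs_sub v y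
    rw [show v - y = x by rw [hvdef, lowerTime]; ring, s2, hexp'] at h1
    apply mul_left_cancel₀ c2.ne'
    linear_combination -h1

end LowerData

/-! ### The perturbed system and its closed orbits -/

theorem exists_lipschitzWith_affine (a b c d : ℝ) :
    ∃ K, LipschitzWith K fun p : R3 => a * p.1 + b * p.2.1 + c * p.2.2 + d := by
  let L : R3 →L[ℝ] ℝ := a • ContinuousLinearMap.fst ℝ ℝ (ℝ × ℝ) +
    b • (ContinuousLinearMap.fst ℝ ℝ ℝ).comp (ContinuousLinearMap.snd ℝ ℝ (ℝ × ℝ)) +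
    c • (ContinuousLinearMap.snd ℝ ℝ ℝ).comp (ContinuousLinearMap.snd ℝ ℝ (ℝ × ℝ))
  exact ⟨_, L.lipschitz.add (LipschitzWith.const d)⟩

/-- The perturbation coefficients above the switching plane. -/
noncomputable def FamilyIndex.upperCoeffs (i : FamilyIndex) : PerturbationCoeffs where
  α := ![0, 0, 0, 0]
  -- On `x = 0`, in the coordinates `(y, z + σ)`, the perturbation is `ε` times the identity:
  -- equilibrium and frequency are unchanged and a rate `ε` is added.
  β := ![0, 0, 1, 0]
  κ := ![i.sgn, 0, 0, 1]

namespace LowerData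

/-- The perturbation coefficients below the switching plane. -/
noncomputable def lowerCoeffs (P : LowerData) : PerturbationCoeffs where
  α := ![0, 0, 0, 0]
  -- The diagonal entries give the opposite rate `-ε`; `b` and `k` change the off-diagonal entries
  -- and `l` the constant term.
  β := ![P.l, 0, -1, -P.i.sgn * P.b]
  κ := ![P.i.sgn, 0, P.k, -1]

/-- The perturbed system with the chosen coefficients. -/
noncomputable def system (P : LowerData) (ε : ℝ) : PiecewiseField :=
  perturbedSystem P.i P.i.upperCoeffs P.lowerCoeffs ε

variable (P : LowerData)

theorem system_f (ε : ℝ) : (P.system ε).f = fun p => p.2.2 := rfl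

theorem unperturbed_eq (i : FamilyIndex) (s : ℝ) (p : R3) :
    unperturbed i s p = (p.1, -i.sgn * p.2.2 - s, p.1 + p.2.1) := by
  cases i <;> simp [unperturbed, FamilyIndex.sgn]

theorem system_plus (ε : ℝ) : (P.system ε).plus = fun p =>
    (p.1, -P.i.sgn * p.2.2 - 1 + ε * p.2.1, p.1 + p.2.1 + ε * (P.i.sgn + p.2.2)) := by
  funext p
  simp [system, perturbedSystem, unperturbed_eq, PerturbationCoeffs.field, affineFun,
    FamilyIndex.upperCoeffs]

theorem system_minus (ε : ℝ) : (P.system ε).minus = fun p =>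
    (p.1, -P.i.sgn * p.2.2 + 1 + ε * (P.l - p.2.1 - P.i.sgn * P.b * p.2.2),
      p.1 + p.2.1 + ε * (P.i.sgn + P.k * p.2.1 - p.2.2)) := by
  funext p
  simp [system, perturbedSystem, unperturbed_eq, PerturbationCoeffs.field, affineFun,
    lowerCoeffs]
  constructor <;> left <;> ring

theorem exists_lipschitz_plus (ε : ℝ) : ∃ K, LipschitzWith K (P.system ε).plus := by
  obtain ⟨K1, h1⟩ := exists_lipschitzWith_affine 1 0 0 0
  obtain ⟨K2, h2⟩ := exists_lipschitzWith_affine 0 ε (-P.i.sgn) (-1)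
  obtain ⟨K3, h3⟩ := exists_lipschitzWith_affine 1 1 ε (ε * P.i.sgn)
  have h := h1.prodMk (h2.prodMk h3)
  refine ⟨max K1 (max K2 K3), ?_⟩
  convert h using 1
  rw [system_plus]
  funext p
  refine Prod.ext ?_ (Prod.ext ?_ ?_) <;> simp only <;> ring

theorem exists_lipschitz_minus (ε : ℝ) : ∃ K, LipschitzWith K (P.system ε).minus := by
  obtain ⟨K1, h1⟩ := exists_lipschitzWith_affine 1 0 0 0
  obtain ⟨K2, h2⟩ := exists_lipschitzWith_affine 0 (-ε) (-P.i.sgn * (1 + ε * P.b)) (1 + ε * P.l)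
  obtain ⟨K3, h3⟩ := exists_lipschitzWith_affine 1 (1 + ε * P.k) (-ε) (ε * P.i.sgn)
  have h := h1.prodMk (h2.prodMk h3)
  refine ⟨max K1 (max K2 K3), ?_⟩
  convert h using 1
  rw [system_minus]
  funext p
  refine Prod.ext ?_ (Prod.ext ?_ ?_) <;> simp only <;> ring

theorem continuous_plus (ε : ℝ) : Continuous (P.system ε).plus :=
  (P.exists_lipschitz_plus ε).choose_spec.continuous

theorem continuous_minus (ε : ℝ) : Continuous (P.system ε).minus :=
  (P.exists_lipschitz_minus ε).choose_spec.continuous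

/-- The trajectory above the switching plane which comes back after the time `u`. -/
noncomputable def upperArc (ε u t : ℝ) : R3 :=
  (0, P.i.spiralY ε (P.i.launch ε u) t, P.i.spiralZ ε (P.i.launch ε u) t)

/-- The trajectory below the switching plane which comes back after the normalised time `v`. -/
noncomputable def lowerArc (ε v t : ℝ) : R3 :=
  (0, ε * P.offset ε -
      P.scale ε * P.i.spiralY (-P.rate ε) (P.i.launch (-P.rate ε) v) (P.freq ε * t),
    -(P.height ε * P.i.spiralZ (-P.rate ε) (P.i.launch (-P.rate ε) v) (P.freq ε * t)))

theorem hasDerivAt_upperArc (ε u t : ℝ) :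
    HasDerivAt (P.upperArc ε u) ((P.system ε).plus (P.upperArc ε u t)) t := by
  have h1 := FamilyIndex.hasDerivAt_spiralY (i := P.i) ε (P.i.launch ε u) t
  have h2 := FamilyIndex.hasDerivAt_spiralZ (i := P.i) ε (P.i.launch ε u) t
  have := (hasDerivAt_const t (0 : ℝ)).prodMk (h1.prodMk h2)
  convert! this using 1
  rw [system_plus]
  simp only [upperArc]
  refine Prod.ext rfl (Prod.ext ?_ ?_) <;> simp only
  · linear_combination P.i.sgn_sq
  · ring

variable {P}

theorem Small.freq_sq {ε : ℝ} (h : P.Small ε) :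
    P.freq ε ^ 2 = (1 + ε * P.b) * (1 + ε * P.k) :=
  Real.sq_sqrt (mul_pos h.b_pos h.k_pos).le

theorem Small.freq_mul_rate {ε : ℝ} (h : P.Small ε) : P.freq ε * P.rate ε = ε := by
  rw [rate, mul_div_cancel₀ _ h.freq_pos.ne']

theorem Small.offset_eq {ε : ℝ} (h : P.Small ε) :
    (1 + ε * P.k) * P.offset ε = P.i.sgn * (P.height ε - 1) := by
  have h1 := h.k_pos.ne'
  rw [offset]
  field_simp

/-- With `Small.offset_eq`, this is the pair of equations placing the equilibrium of the lower field
at `y = ε * offset`, `z = σ * height`. -/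
theorem Small.centre_eq {ε : ℝ} (h : P.Small ε) :
    (1 + ε * P.b) * P.height ε + ε ^ 2 * P.offset ε = 1 + ε * P.l := by
  have h1 : (P.height ε - 1) * ((1 + ε * P.b) * (1 + ε * P.k) + P.i.sgn * ε ^ 2) =
      ε * ((1 + ε * P.k) * (P.l - P.b)) := by
    rw [height, add_sub_cancel_left, mul_assoc, div_mul_cancel₀ _ h.det_pos.ne']
  apply mul_left_cancel₀ h.k_pos.ne'
  linear_combination h1 + ε ^ 2 * h.offset_eq

/-- With `Small.scale_mul_freq`, this says that rescaling `y`, `z` and time by `scale`, `height` and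
`freq` brings the off-diagonal entries to those of the normalised spiral. -/
theorem Small.scale_mul_k {ε : ℝ} (h : P.Small ε) :
    P.scale ε * (1 + ε * P.k) = P.height ε * P.freq ε := by
  rw [scale, div_mul_cancel₀ _ h.k_pos.ne']

theorem Small.scale_mul_freq {ε : ℝ} (h : P.Small ε) :
    P.scale ε * P.freq ε = (1 + ε * P.b) * P.height ε := by
  apply mul_right_cancel₀ h.k_pos.ne'
  linear_combination P.freq ε * h.scale_mul_k + P.height ε * h.freq_sq

theorem Small.hasDerivAt_lowerArc {ε : ℝ} (h : P.Small ε) (v t : ℝ) :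
    HasDerivAt (P.lowerArc ε v) ((P.system ε).minus (P.lowerArc ε v t)) t := by
  have hl : HasDerivAt (fun t => P.freq ε * t) (P.freq ε) t := by
    simpa using (hasDerivAt_id t).const_mul (P.freq ε)
  set Y := P.i.spiralY (-P.rate ε) (P.i.launch (-P.rate ε) v) with hY
  set Z := P.i.spiralZ (-P.rate ε) (P.i.launch (-P.rate ε) v) with hZ
  have h1 := (FamilyIndex.hasDerivAt_spiralY (i := P.i) (-P.rate ε) (P.i.launch (-P.rate ε) v)
    (P.freq ε * t)).comp t hl
  have h2 := (FamilyIndex.hasDerivAt_spiralZ (i := P.i) (-P.rate ε) (P.i.launch (-P.rate ε) v)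
    (P.freq ε * t)).comp t hl
  have := (hasDerivAt_const t (0 : ℝ)).prodMk
    (((h1.const_mul (P.scale ε)).const_sub (ε * P.offset ε)).prodMk
      ((h2.const_mul (P.height ε)).neg))
  convert! this using 1
  rw [system_minus]
  simp only [lowerArc, ← hY, ← hZ]
  have e1 := h.freq_mul_rate
  have e2 := h.scale_mul_freq
  have e3 := h.centre_eq
  have e4 := h.offset_eq
  have e5 := h.scale_mul_k
  have hσ := P.i.sgn_sq
  refine Prod.ext rfl (Prod.ext ?_ ?_) <;> simp only
  · linear_combination (-P.scale ε * Y (P.freq ε * t)) * e1 -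
      (P.i.sgn * Z (P.freq ε * t) + 1) * e2 - e3 - P.scale ε * P.freq ε * hσ
  · linear_combination (-P.height ε * (Z (P.freq ε * t) + P.i.sgn)) * e1 + ε * e4 -
      Y (P.freq ε * t) * e5

variable (P)

theorem upperArc_zero (ε u : ℝ) : P.upperArc ε u 0 = (0, P.i.launch ε u, 0) := by
  simp [upperArc, FamilyIndex.spiralY_zero, FamilyIndex.spiralZ_zero]

theorem upperArc_end {ε u : ℝ} (hu : u ∈ P.i.dom) :
    P.upperArc ε u u = (0, -P.i.launch (-ε) u, 0) := by
  simp [upperArc, FamilyIndex.spiralY_launch_self hu, FamilyIndex.spiralZ_launch_self hu]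

theorem lowerArc_zero (ε v : ℝ) : P.lowerArc ε v 0 =
    (0, ε * P.offset ε - P.scale ε * P.i.launch (-P.rate ε) v, 0) := by
  simp [lowerArc, FamilyIndex.spiralY_zero, FamilyIndex.spiralZ_zero]

variable {P}

theorem Small.lowerArc_end {ε v : ℝ} (h : P.Small ε) (hv : v ∈ P.i.dom) :
    P.lowerArc ε v (v / P.freq ε) =
      (0, ε * P.offset ε + P.scale ε * P.i.launch (P.rate ε) v, 0) := by
  have : P.freq ε * (v / P.freq ε) = v := mul_div_cancel₀ _ h.freq_pos.ne'
  simp [lowerArc, this, FamilyIndex.spiralY_launch_self hv, FamilyIndex.spiralZ_launch_self hv]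

theorem Small.upperArc_pos {ε u s : ℝ} (h : P.Small ε) (hu : u ∈ P.i.dom) (hs : s ∈ Ioo 0 u) :
    0 < (P.upperArc ε u s).2.2 :=
  FamilyIndex.spiralZ_launch_pos h.abs_lt hu hs

theorem Small.lowerArc_neg {ε v s : ℝ} (h : P.Small ε) (hv : v ∈ P.i.dom)
    (hs : s ∈ Ioo 0 (v / P.freq ε)) : (P.lowerArc ε v s).2.2 < 0 := by
  have hf := h.freq_pos
  have := FamilyIndex.spiralZ_launch_pos (δ := -P.rate ε) (by rw [abs_neg]; exact h.rate_lt) hv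
    (s := P.freq ε * s) ⟨mul_pos hf hs.1, by
      have := (lt_div_iff₀ hf).1 hs.2; linarith⟩
  exact neg_neg_of_pos (mul_pos h.height_pos this)

variable (P)

/-- The closed curve formed by the upper arc of duration `u` and the lower arc following it. -/
noncomputable def orbit (ε u : ℝ) : Set R3 :=
  P.upperArc ε u '' Icc 0 u ∪
    P.lowerArc ε (P.lowerTime ε u) '' Icc 0 (P.lowerTime ε u / P.freq ε)

variable {P}

theorem Small.lowerArc_zero_eq {ε u : ℝ} (hs : P.Small ε) (h : P.Good ε u)
    (h0 : P.gap ε u = 0) :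
    P.lowerArc ε (P.lowerTime ε u) 0 = (0, -P.i.launch (-ε) u, 0) := by
  rw [lowerArc_zero, (h.launch_lowerTime h0).2, inn, mul_div_cancel₀ _ hs.scale_pos.ne']
  simp

theorem Small.lowerArc_end_eq {ε u : ℝ} (hs : P.Small ε) (h : P.Good ε u)
    (h0 : P.gap ε u = 0) :
    P.lowerArc ε (P.lowerTime ε u) (P.lowerTime ε u / P.freq ε) = (0, P.i.launch ε u, 0) := by
  rw [hs.lowerArc_end h.lowerTime_mem, (h.launch_lowerTime h0).1, out,
    mul_div_cancel₀ _ hs.scale_pos.ne']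
  simp

theorem orbit_subset_planeS (ε u : ℝ) : P.orbit ε u ⊆ planeS := by
  rintro _ (⟨s, _, rfl⟩ | ⟨s, _, rfl⟩) <;> rfl

theorem Small.isPeriodicOrbit_orbit {ε u : ℝ} (hs : P.Small ε) (h : P.Good ε u)
    (h0 : P.gap ε u = 0) : (P.system ε).IsPeriodicOrbit (P.orbit ε u) := by
  apply isPeriodicOrbit_of_arcs (FamilyIndex.pos_of_mem_dom h.mem_dom)
    (div_pos (FamilyIndex.pos_of_mem_dom h.lowerTime_mem) hs.freq_pos)
    (P.continuous_plus ε) (P.continuous_minus ε) (P.hasDerivAt_upperArc ε u)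
    (hs.hasDerivAt_lowerArc _)
  · rw [P.upperArc_end h.mem_dom, hs.lowerArc_zero_eq h h0]
  · rw [hs.lowerArc_end_eq h h0, upperArc_zero]
  · rw [upperArc_zero, system_f]
  · rw [hs.lowerArc_zero_eq h h0, system_f]
  · exact fun s hs' => hs.upperArc_pos h.mem_dom hs'
  · exact fun s hs' => hs.lowerArc_neg h.lowerTime_mem hs'

theorem Small.eq_of_mem_orbit {ε u : ℝ} (hs : P.Small ε) (h : P.Good ε u)
    (h0 : P.gap ε u = 0) {p : R3} (hp : p ∈ P.orbit ε u) (hz : p.2.2 = 0) :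
    p = (0, P.i.launch ε u, 0) ∨ p = (0, -P.i.launch (-ε) u, 0) := by
  rcases hp with ⟨s, hs', rfl⟩ | ⟨s, hs', rfl⟩
  · rcases hs'.1.eq_or_lt with e | e
    · left; rw [← e, upperArc_zero]
    rcases hs'.2.eq_or_lt with e' | e'
    · right; rw [e', P.upperArc_end h.mem_dom]
    · exact absurd hz (hs.upperArc_pos h.mem_dom ⟨e, e'⟩).ne'
  · rcases hs'.1.eq_or_lt with e | e
    · right; rw [← e, hs.lowerArc_zero_eq h h0]
    rcases hs'.2.eq_or_lt with e' | e'
    · left; rw [e', hs.lowerArc_end_eq h h0]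
    · exact absurd hz (hs.lowerArc_neg h.lowerTime_mem ⟨e, e'⟩).ne

theorem launch_mem_orbit {ε u : ℝ} (hu : u ∈ P.i.dom) :
    ((0, P.i.launch ε u, 0) : R3) ∈ P.orbit ε u :=
  Or.inl ⟨0, ⟨le_rfl, (FamilyIndex.pos_of_mem_dom hu).le⟩, P.upperArc_zero ε u⟩

theorem abs_mul_sgn (ε : ℝ) : |ε * P.i.sgn| = |ε| := by
  rw [abs_mul, FamilyIndex.abs_sgn, mul_one]

theorem crossing_pos {ε y : ℝ} (h1 : |ε| < y) (h2 : |ε| < (1 + ε * P.k) * y) :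
    0 < ((P.system ε).plus (0, y, 0)).2.2 ∧ 0 < ((P.system ε).minus (0, y, 0)).2.2 := by
  have h3 := neg_abs_le (ε * P.i.sgn)
  rw [abs_mul_sgn] at h3
  rw [system_plus, system_minus]
  constructor <;> simp only <;> linarith

theorem crossing_neg {ε y : ℝ} (h1 : y < -|ε|) (h2 : (1 + ε * P.k) * y < -|ε|) :
    ((P.system ε).plus (0, y, 0)).2.2 < 0 ∧ ((P.system ε).minus (0, y, 0)).2.2 < 0 := by
  have h3 := le_abs_self (ε * P.i.sgn)
  rw [abs_mul_sgn] at h3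
  rw [system_plus, system_minus]
  constructor <;> simp only <;> linarith

theorem isCrossingPoint_iff {ε : ℝ} {p : R3} : (P.system ε).IsCrossingPoint p ↔
    p.2.2 = 0 ∧ 0 < ((P.system ε).plus p).2.2 * ((P.system ε).minus p).2.2 := by
  have hf : fderiv ℝ (P.system ε).f p =
      (ContinuousLinearMap.snd ℝ ℝ ℝ).comp (ContinuousLinearMap.snd ℝ ℝ (ℝ × ℝ)) :=
    ((ContinuousLinearMap.snd ℝ ℝ ℝ).comp (ContinuousLinearMap.snd ℝ ℝ (ℝ × ℝ))).fderiv
  rw [PiecewiseField.IsCrossingPoint, hf]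
  rfl

theorem Small.isCrossingPeriodicOrbit_orbit {ε u : ℝ} (hs : P.Small ε) (h : P.Good ε u)
    (h0 : P.gap ε u = 0) : (P.system ε).IsCrossingPeriodicOrbit (P.orbit ε u) := by
  refine ⟨hs.isPeriodicOrbit_orbit h h0, ⟨_, launch_mem_orbit h.mem_dom, rfl⟩, ?_⟩
  rintro p ⟨hp, hz⟩
  rw [isCrossingPoint_iff]
  refine ⟨hz, ?_⟩
  rcases hs.eq_of_mem_orbit h h0 hp hz with rfl | rfl
  · obtain ⟨h1, h2⟩ := crossing_pos h.cross_out h.cross_out'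
    exact mul_pos h1 h2
  · obtain ⟨h1, h2⟩ := crossing_neg (P := P) (ε := ε) (y := -P.i.launch (-ε) u)
      (neg_lt_neg h.cross_inn) (by linarith [h.cross_inn'])
    exact mul_pos_of_neg_of_neg h1 h2

/-- An orbit has a single point of `Σ` with `y > |ε|`, its launch point, which determines the
duration. -/
theorem Small.orbit_injective {ε u u' : ℝ} (hs : P.Small ε) (h : P.Good ε u)
    (h0 : P.gap ε u = 0) (hu' : P.Good ε u')
    (heq : P.orbit ε u = P.orbit ε u') : u = u' := by
  have hmem : ((0, P.i.launch ε u', 0) : R3) ∈ P.orbit ε u := by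
    rw [heq]; exact launch_mem_orbit hu'.mem_dom
  have hε := abs_nonneg ε
  rcases hs.eq_of_mem_orbit h h0 hmem rfl with e | e
  · simp only [Prod.mk.injEq, true_and, and_true] at e
    exact ((FamilyIndex.strictMonoOn_launch hs.abs_lt).injOn hu'.mem_dom h.mem_dom e).symm
  · simp only [Prod.mk.injEq, true_and, and_true] at e
    linarith [h.cross_inn, hu'.cross_out]

end LowerData

/-! ### Isolation among all periodic orbits -/

namespace LowerData

variable {P : LowerData}

theorem mem_segment_of_mem_filippov {X : PiecewiseField} {p v : R3} (h : v ∈ X.filippov p) :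
    v ∈ segment ℝ (X.minus p) (X.plus p) := by
  rcases h with ⟨_, rfl⟩ | ⟨_, rfl⟩ | ⟨_, h⟩
  · exact right_mem_segment _ _ _
  · exact left_mem_segment _ _ _
  · exact h

theorem eq_plus_of_mem_filippov {X : PiecewiseField} {p v : R3} (h : v ∈ X.filippov p)
    (hp : 0 < X.f p) : v = X.plus p := by
  rcases h with ⟨_, h⟩ | ⟨h, _⟩ | ⟨h, _⟩
  · exact h
  · exact absurd h hp.not_gt
  · exact absurd h hp.ne'

theorem eq_minus_of_mem_filippov {X : PiecewiseField} {p v : R3} (h : v ∈ X.filippov p)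
    (hp : X.f p < 0) : v = X.minus p := by
  rcases h with ⟨h, _⟩ | ⟨_, h⟩ | ⟨h, _⟩
  · exact absurd h hp.not_gt
  · exact h
  · exact absurd h hp.ne

/-- Periodic solutions stay in the plane `x = 0`. -/
theorem fst_eq_zero_of_periodic {ε T : ℝ} {γ : ℝ → R3} (hT : 0 < T)
    (hγ : (P.system ε).IsSolution γ) (hper : Function.Periodic γ T) (t : ℝ) : (γ t).1 = 0 := by
  obtain ⟨v, hv, hF, hint⟩ := hγ
  have hc := continuous_of_integral hv hint
  have hae : ∀ᵐ s : ℝ, (v s).1 = (γ s).1 := by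
    filter_upwards [hF] with s hs
    -- The two fields share the first component, so convex combinations do too, and sliding motion
    -- makes no difference.
    obtain ⟨a, b, _, _, hab, h⟩ := mem_segment_of_mem_filippov hs
    rw [← h, system_plus, system_minus]
    simp only [Prod.fst_add, Prod.smul_fst, smul_eq_mul]
    rw [← add_mul, hab, one_mul]
  have hx : ∀ t, (γ t).1 = (γ 0).1 + ∫ s in (0 : ℝ)..t, (γ s).1 := by
    intro t
    have h1 : (∫ s in (0 : ℝ)..t, (v s).1) = (∫ s in (0 : ℝ)..t, v s).1 :=
      (ContinuousLinearMap.fst ℝ ℝ (ℝ × ℝ)).intervalIntegral_comp_comm (hv 0 t)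
    have h2 : (∫ s in (0 : ℝ)..t, (v s).1) = ∫ s in (0 : ℝ)..t, (γ s).1 :=
      intervalIntegral.integral_congr_ae (hae.mono fun s h _ => h)
    rw [← h2, h1]
    nth_rewrite 1 [hint t]
    rfl
  have hd : ∀ t, HasDerivAt (fun t => (γ t).1) (γ t).1 t := by
    intro t
    rw [show (fun t => (γ t).1) = fun t => (γ 0).1 + ∫ s in (0 : ℝ)..t, (γ s).1 from funext hx]
    exact ((continuous_fst.comp hc).integral_hasStrictDerivAt 0 t).hasDerivAt.const_add _
  have hconst : ∀ s t, (γ s).1 * Real.exp (-s) = (γ t).1 * Real.exp (-t) := by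
    have hd' : ∀ t, HasDerivAt (fun t => (γ t).1 * Real.exp (-t)) 0 t := by
      intro t
      have := (hd t).mul ((hasDerivAt_neg t).exp)
      convert! this using 1
      ring
    exact is_const_of_deriv_eq_zero (fun t => (hd' t).differentiableAt) (fun t => (hd' t).deriv)
  have h1 := hconst (t + T) t
  rw [hper t] at h1
  by_contra hne
  have h2 := Real.exp_injective (mul_left_cancel₀ hne h1)
  linarith

/-- A nonconstant periodic solution meets the switching plane. -/
theorem Small.exists_zero_of_periodic {ε T : ℝ} {γ : ℝ → R3} (hs : P.Small ε) (hε : ε ≠ 0)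
    (hT : 0 < T) (hγ : (P.system ε).IsSolution γ) (hper : Function.Periodic γ T)
    (hne : ∃ t, γ t ≠ γ 0) : ∃ t, (γ t).2.2 = 0 := by
  by_contra! hz
  have hx := fst_eq_zero_of_periodic hT hγ hper
  obtain ⟨v, hv, hF, hint⟩ := hγ
  have hc := continuous_of_integral hv hint
  have hcz : Continuous fun t => (γ t).2.2 := by fun_prop
  obtain ⟨t, ht⟩ := hne
  apply ht
  have hyper : Function.Periodic (fun t => (γ t).2.1) T := fun t => by simp only [hper t]
  have hzper : Function.Periodic (fun t => (γ t).2.2) T := fun t => by simp only [hper t]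
  have hkey : ∀ G : R3 → R3, (∀ t, HasDerivAt γ (G (γ t)) t) → ∀ t,
      HasDerivAt (fun t => (γ t).2.1) (G (γ t)).2.1 t ∧
      HasDerivAt (fun t => (γ t).2.2) (G (γ t)).2.2 t := by
    intro G h t
    exact ⟨(ContinuousLinearMap.fst ℝ ℝ ℝ).hasFDerivAt.comp_hasDerivAt t
        ((ContinuousLinearMap.snd ℝ ℝ (ℝ × ℝ)).hasFDerivAt.comp_hasDerivAt t (h t)),
      (ContinuousLinearMap.snd ℝ ℝ ℝ).hasFDerivAt.comp_hasDerivAt t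
        ((ContinuousLinearMap.snd ℝ ℝ (ℝ × ℝ)).hasFDerivAt.comp_hasDerivAt t (h t))⟩
  have hconcl : (γ t).2.1 = (γ 0).2.1 ∧ (γ t).2.2 = (γ 0).2.2 := by
    -- Without zeros, `z` keeps its sign, and the solution is a classical one of a single affine
    -- field, whose planar trace is `-2ε` or `2ε`.
    rcases lt_or_gt_of_ne (hz 0) with h0 | h0
    · have hsign : ∀ t, (γ t).2.2 < 0 := by
        intro t
        by_contra hcon
        obtain ⟨s, hs⟩ := mem_range_of_exists_le_of_exists_ge hcz ⟨0, h0.le⟩ ⟨t, not_lt.1 hcon⟩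
        exact hz s hs
      have hd := hkey _ (hasDerivAt_of_ae_eq (P.continuous_minus ε) hv hint
        (hF.mono fun t h => eq_minus_of_mem_filippov h (hsign t)))
      refine planar_affine_periodic_const (a := -ε) (b := -P.i.sgn * (1 + ε * P.b))
        (c := 1 + ε * P.l) (d := 1 + ε * P.k) (e := -ε) (f := ε * P.i.sgn) hT ?_ hs.k_pos.ne'
        ?_ ?_ hyper hzper t
      · intro h; exact hε (by linarith)
      · intro t
        convert! (hd t).1 using 1
        rw [system_minus]; simp only; ring
      · intro t
        convert! (hd t).2 using 1
        rw [system_minus]; simp only [hx t]; ring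
    · have hsign : ∀ t, 0 < (γ t).2.2 := by
        intro t
        by_contra hcon
        obtain ⟨s, hs⟩ := mem_range_of_exists_le_of_exists_ge hcz ⟨t, not_lt.1 hcon⟩ ⟨0, h0.le⟩
        exact hz s hs
      have hd := hkey _ (hasDerivAt_of_ae_eq (P.continuous_plus ε) hv hint
        (hF.mono fun t h => eq_plus_of_mem_filippov h (hsign t)))
      refine planar_affine_periodic_const (a := ε) (b := -P.i.sgn)
        (c := -1) (d := 1) (e := ε) (f := ε * P.i.sgn) hT ?_ one_ne_zero
        ?_ ?_ hyper hzper t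
      · intro h; exact hε (by linarith)
      · intro t
        convert! (hd t).1 using 1
        rw [system_plus]; simp only; ring
      · intro t
        convert! (hd t).2 using 1
        rw [system_plus]; simp only [hx t]; ring
  exact Prod.ext ((hx t).trans (hx 0).symm) (Prod.ext hconcl.1 hconcl.2)

/-- At an upward crossing point both normal speeds are positive, which forces the solution into `z >
0`; there Lipschitz uniqueness makes it follow the arc until its return. -/
theorem Small.eq_upperArc {ε t y u : ℝ} {γ : ℝ → R3} (hs : P.Small ε)
    (hγ : (P.system ε).IsSolution γ) (ht : γ t = (0, y, 0)) (h1 : |ε| < y)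
    (h2 : |ε| < (1 + ε * P.k) * y) (hu : u ∈ P.i.dom) (hy : P.i.launch ε u = y) :
    ∀ s ∈ Icc 0 u, γ (t + s) = P.upperArc ε u s := by
  obtain ⟨v, hv, hF, hint⟩ := hγ
  obtain ⟨K, hK⟩ := P.exists_lipschitz_plus ε
  obtain ⟨c1, c2⟩ := crossing_pos h1 h2
  have henter := enters_of_crossing (s := 1) (t₀ := t) (P.continuous_plus ε) (P.continuous_minus ε)
    hv hint (hF.mono fun t h => mem_segment_of_mem_filippov h) (by rw [ht])
    (by rw [ht, one_mul]; exact c1) (by rw [ht, one_mul]; exact c2)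
  simp only [one_mul] at henter
  refine eq_flow_of_enters (h := fun p => p.2.2) hK (by fun_prop) hv hint
    (hF.mono fun t h hp => eq_plus_of_mem_filippov h hp) henter ?_ (P.hasDerivAt_upperArc ε u)
    (fun s hs' => hs.upperArc_pos hu hs')
  rw [upperArc_zero, ht, hy]

theorem Small.eq_lowerArc {ε t y v : ℝ} {γ : ℝ → R3} (hs : P.Small ε)
    (hγ : (P.system ε).IsSolution γ) (ht : γ t = (0, y, 0)) (h1 : y < -|ε|)
    (h2 : (1 + ε * P.k) * y < -|ε|) (hv : v ∈ P.i.dom)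
    (hy : ε * P.offset ε - P.scale ε * P.i.launch (-P.rate ε) v = y) :
    ∀ s ∈ Icc 0 (v / P.freq ε), γ (t + s) = P.lowerArc ε v s := by
  obtain ⟨w, hw, hF, hint⟩ := hγ
  obtain ⟨K, hK⟩ := P.exists_lipschitz_minus ε
  obtain ⟨c1, c2⟩ := crossing_neg h1 h2
  have henter := enters_of_crossing (s := -1) (t₀ := t) (P.continuous_plus ε)
    (P.continuous_minus ε) hw hint (hF.mono fun t h => mem_segment_of_mem_filippov h) (by rw [ht])
    (by rw [ht]; linarith) (by rw [ht]; linarith)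
  refine eq_flow_of_enters (h := fun p => -1 * p.2.2) hK (by fun_prop) hw hint
    (hF.mono fun t h hp => eq_minus_of_mem_filippov h (by
      have : 0 < -1 * (γ t).2.2 := hp
      rw [system_f]; linarith)) henter ?_
    (hs.hasDerivAt_lowerArc v) (fun s hs' => ?_)
  · rw [lowerArc_zero, ht, hy]
  · have := hs.lowerArc_neg hv hs'
    linarith

/-- An upper arc of duration `u`, the lower arc of normalised duration `v` which follows it, and
the next upper arc, of duration `u'`. -/
structure ReturnData (P : LowerData) (ε u v u' : ℝ) : Prop where
  mem_u : u ∈ P.i.dom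
  mem_v : v ∈ P.i.dom
  mem_u' : u' ∈ P.i.dom
  down : -P.i.launch (-ε) u = ε * P.offset ε - P.scale ε * P.i.launch (-P.rate ε) v
  up : P.i.launch ε u' = ε * P.offset ε + P.scale ε * P.i.launch (P.rate ε) v

/-- The passages `u ↦ v ↦ u'` are built from increasing functions `launch` and their inverses, so
the return map preserves order; `ReturnData.gt` is the reversed inequality. -/
theorem ReturnData.lt {ε u v u' v' u'' : ℝ} (hs : P.Small ε) (h : ReturnData P ε u v u')
    (h' : ReturnData P ε u' v' u'') (hlt : u < u') : u' < u'' := by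
  have hε : |-ε| < 1 := by rw [abs_neg]; exact hs.abs_lt
  have hr : |-P.rate ε| < 1 := by rw [abs_neg]; exact hs.rate_lt
  have hsc := hs.scale_pos
  have h1 := FamilyIndex.strictMonoOn_launch hε h.mem_u h.mem_u' hlt
  have h2 : P.i.launch (-P.rate ε) v < P.i.launch (-P.rate ε) v' := by
    have e1 := h.down
    have e2 := h'.down
    exact lt_of_mul_lt_mul_left (by linarith) hsc.le
  have h3 := ((FamilyIndex.strictMonoOn_launch hr).lt_iff_lt h.mem_v h'.mem_v).1 h2
  have h4 := FamilyIndex.strictMonoOn_launch hs.rate_lt h.mem_v h'.mem_v h3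
  have h5 : P.i.launch ε u' < P.i.launch ε u'' := by
    rw [h.up, h'.up]
    have := mul_lt_mul_of_pos_left h4 hsc
    linarith
  exact ((FamilyIndex.strictMonoOn_launch hs.abs_lt).lt_iff_lt h.mem_u' h'.mem_u').1 h5

theorem ReturnData.gt {ε u v u' v' u'' : ℝ} (hs : P.Small ε) (h : ReturnData P ε u v u')
    (h' : ReturnData P ε u' v' u'') (hlt : u' < u) : u'' < u' := by
  have hε : |-ε| < 1 := by rw [abs_neg]; exact hs.abs_lt
  have hr : |-P.rate ε| < 1 := by rw [abs_neg]; exact hs.rate_lt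
  have hsc := hs.scale_pos
  have h1 := FamilyIndex.strictMonoOn_launch hε h.mem_u' h.mem_u hlt
  have h2 : P.i.launch (-P.rate ε) v' < P.i.launch (-P.rate ε) v := by
    have e1 := h.down
    have e2 := h'.down
    exact lt_of_mul_lt_mul_left (by linarith) hsc.le
  have h3 := ((FamilyIndex.strictMonoOn_launch hr).lt_iff_lt h'.mem_v h.mem_v).1 h2
  have h4 := FamilyIndex.strictMonoOn_launch hs.rate_lt h'.mem_v h.mem_v h3
  have h5 : P.i.launch ε u'' < P.i.launch ε u' := by
    rw [h.up, h'.up]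
    have := mul_lt_mul_of_pos_left h4 hsc
    linarith
  exact ((FamilyIndex.strictMonoOn_launch hs.abs_lt).lt_iff_lt h'.mem_u' h.mem_u').1 h5

theorem ReturnData.eq {ε u v u' : ℝ} (hs : P.Small ε) (h : ReturnData P ε u v u')
    (hg : P.Good ε u) (heq : u' = u) : P.gap ε u = 0 ∧ v = P.lowerTime ε u := by
  subst heq
  have hsc := hs.scale_pos.ne'
  have e1 : P.i.launch (P.rate ε) v = P.out ε u' := by
    rw [out, h.up]; field_simp; ring
  have e2 : P.i.launch (-P.rate ε) v = P.inn ε u' := by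
    rw [inn, show P.i.launch (-ε) u' = -(-P.i.launch (-ε) u') by ring, h.down]; field_simp; ring
  have h0 := hg.gap_eq_zero_of h.mem_v e1 e2
  refine ⟨h0, ?_⟩
  have hl := (hg.launch_lowerTime h0).1
  rw [← e1] at hl
  exact ((FamilyIndex.strictMonoOn_launch hs.rate_lt).injOn hg.lowerTime_mem h.mem_v hl).symm

theorem exists_between_of_step {τ : ℕ → ℝ} {c : ℝ} (hc : 0 < c) (hτ : ∀ n, τ n + c ≤ τ (n + 1))
    {x : ℝ} (hx : τ 0 ≤ x) : ∃ n, τ n ≤ x ∧ x < τ (n + 1) := by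
  have hgrow : ∀ n : ℕ, τ 0 + n * c ≤ τ n := by
    intro n
    induction n with
    | zero => simp
    | succ n ih => push_cast; linarith [hτ n]
  have hex : ∃ n, x < τ (n + 1) := by
    obtain ⟨n, hn⟩ := exists_nat_gt ((x - τ 0) / c)
    rw [div_lt_iff₀ hc] at hn
    exact ⟨n, by have := hgrow (n + 1); push_cast at this; linarith⟩
  classical
  refine ⟨Nat.find hex, ?_, Nat.find_spec hex⟩
  rcases Nat.eq_zero_or_pos (Nat.find hex) with h | h
  · rw [h]; exact hx
  · have := Nat.find_min hex (Nat.sub_lt h one_pos)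
    rw [Nat.sub_one_add_one h.ne'] at this
    exact not_lt.1 this

/-- An isolated zero of `gap` gives an isolated periodic orbit. -/
theorem Small.isCrossingLimitCycle_orbit {ε u₀ u₁ u₂ : ℝ} (hs : P.Small ε) (hε : ε ≠ 0)
    (hgood : ∀ u ∈ Icc u₁ u₂, P.Good ε u) (hu₀ : u₀ ∈ Ioo u₁ u₂) (h0 : P.gap ε u₀ = 0)
    (hiso : ∀ u ∈ Icc u₁ u₂, P.gap ε u = 0 → u = u₀) :
    (P.system ε).IsCrossingLimitCycle (P.orbit ε u₀) := by
  have hg0 := hgood u₀ (Ioo_subset_Icc_self hu₀)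
  refine ⟨hs.isCrossingPeriodicOrbit_orbit hg0 h0, ?_⟩
  have hεabs := abs_nonneg ε
  have hsc := hs.scale_pos
  have hfr := hs.freq_pos
  have hrneg : |-P.rate ε| < 1 := by rw [abs_neg]; exact hs.rate_lt
  have hu12 : u₁ ≤ u₂ := (hu₀.1.trans hu₀.2).le
  have hd1 := (hgood u₁ (left_mem_Icc.2 hu12)).mem_dom
  have hd2 := (hgood u₂ (right_mem_Icc.2 hu12)).mem_dom
  set v₀ := P.lowerTime ε u₀ with hv₀
  have hv₀d : v₀ ∈ P.i.dom := hg0.lowerTime_mem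
  have hup0 : 0 < ε * P.offset ε + P.scale ε * P.i.launch (P.rate ε) v₀ := by
    rw [(hg0.launch_lowerTime h0).1, out, mul_div_cancel₀ _ hsc.ne']
    linarith [hg0.cross_out]
  have hdown0 : ε * P.offset ε - P.scale ε * P.i.launch (-P.rate ε) v₀ = -P.i.launch (-ε) u₀ := by
    rw [(hg0.launch_lowerTime h0).2, inn, mul_div_cancel₀ _ hsc.ne']; ring
  -- A window of lower durations around `v₀` whose arcs end at `y > 0`. As `J₁` contains only
  -- negative ordinates, such an endpoint on `Σ` can lie only in `J₀`.
  obtain ⟨v₁, v₂, hv1d, hv2d, hv₀mem, hupv⟩ : ∃ v₁ v₂, v₁ ∈ P.i.dom ∧ v₂ ∈ P.i.dom ∧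
      v₀ ∈ Ioo v₁ v₂ ∧ ∀ v ∈ Ioo v₁ v₂,
        0 < ε * P.offset ε + P.scale ε * P.i.launch (P.rate ε) v := by
    have hcont : ContinuousAt (fun v => ε * P.offset ε + P.scale ε * P.i.launch (P.rate ε) v) v₀ :=
      continuousAt_const.add (continuousAt_const.mul
        (FamilyIndex.hasDerivAt_launch hv₀d).continuousAt)
    have h1 := (hcont.eventually (lt_mem_nhds hup0)).and (P.i.isOpen_dom.mem_nhds hv₀d)
    obtain ⟨r, hr, hball⟩ := Metric.eventually_nhds_iff.1 h1
    have hd : ∀ x ∈ Icc (v₀ - r / 2) (v₀ + r / 2), dist x v₀ < r := fun x hx => by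
      rw [Real.dist_eq, _root_.abs_lt]; constructor <;> linarith [hx.1, hx.2]
    exact ⟨v₀ - r / 2, v₀ + r / 2, (hball (hd _ ⟨le_rfl, by linarith⟩)).2,
      (hball (hd _ ⟨by linarith, le_rfl⟩)).2, ⟨by linarith, by linarith⟩,
      fun v hv => (hball (hd v (Ioo_subset_Icc_self hv))).1⟩
  have hvd : ∀ v ∈ Ioo v₁ v₂, v ∈ P.i.dom := fun v hv =>
    P.i.ordConnected_dom.out hv1d hv2d (Ioo_subset_Icc_self hv)
  set J₀ := Ioo (P.i.launch ε u₁) (P.i.launch ε u₂) with hJ₀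
  set J₁ := Ioo (ε * P.offset ε - P.scale ε * P.i.launch (-P.rate ε) v₂)
    (ε * P.offset ε - P.scale ε * P.i.launch (-P.rate ε) v₁) ∩
      {y | y < -|ε| ∧ (1 + ε * P.k) * y < -|ε|} with hJ₁
  have hJ₁open : IsOpen J₁ := isOpen_Ioo.inter
    ((isOpen_lt continuous_id continuous_const).inter
      (isOpen_lt (continuous_const.mul continuous_id) continuous_const))
  have hJ₀u : ∀ y ∈ J₀, ∃ u ∈ Ioo u₁ u₂, P.i.launch ε u = y := fun y hy =>
    intermediate_value_Ioo hu12
      (FamilyIndex.continuousOn_launch.mono (P.i.ordConnected_dom.out hd1 hd2)) hy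
  have hJ₁v : ∀ y ∈ J₁, ∃ v ∈ Ioo v₁ v₂,
      ε * P.offset ε - P.scale ε * P.i.launch (-P.rate ε) v = y := by
    intro y hy
    refine intermediate_value_Ioo' (hv₀mem.1.trans hv₀mem.2).le ?_ hy.1
    exact continuousOn_const.sub (continuousOn_const.mul
      (FamilyIndex.continuousOn_launch.mono (P.i.ordConnected_dom.out hv1d hv2d)))
  have hmono := FamilyIndex.strictMonoOn_launch (i := P.i) hs.abs_lt
  -- Only the contact with `Σ` is restricted: arcs off `Σ` are determined by the crossing points at
  -- which they begin.
  set U : Set R3 := {p | p.2.2 ≠ 0} ∪ {p | p.2.1 ∈ J₀} ∪ {p | p.2.1 ∈ J₁} with hU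
  refine ⟨U, ?_, ?_, ?_⟩
  · exact ((isOpen_ne_fun (by fun_prop) (by fun_prop)).union
      (isOpen_Ioo.preimage (by fun_prop))).union (hJ₁open.preimage (by fun_prop))
  · intro p hp
    by_cases hz : p.2.2 = 0
    · rcases hs.eq_of_mem_orbit hg0 h0 hp hz with rfl | rfl
      · exact Or.inl (Or.inr ⟨hmono hd1 hg0.mem_dom hu₀.1, hmono hg0.mem_dom hd2 hu₀.2⟩)
      · refine Or.inr ⟨?_, neg_lt_neg hg0.cross_inn, ?_⟩
        · simp only
          rw [← hdown0]
          have m1 := FamilyIndex.strictMonoOn_launch hrneg hv1d hv₀d hv₀mem.1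
          have m2 := FamilyIndex.strictMonoOn_launch hrneg hv₀d hv2d hv₀mem.2
          have n1 := mul_lt_mul_of_pos_left m1 hsc
          have n2 := mul_lt_mul_of_pos_left m2 hsc
          constructor <;> linarith
        · have := hg0.cross_inn'
          simp only
          linarith
    · exact Or.inl (Or.inl hz)
  rintro Γ' ⟨γ, T, hT, hγ, hper, hne, rfl⟩ hsub
  have hx := fst_eq_zero_of_periodic hT hγ hper
  have hpt : ∀ t, (γ t).2.2 = 0 → γ t = (0, (γ t).2.1, 0) := fun t hz =>
    Prod.ext (hx t) (Prod.ext rfl hz)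
  have hJ : ∀ t, (γ t).2.2 = 0 → (γ t).2.1 ∈ J₀ ∨ (γ t).2.1 ∈ J₁ := by
    intro t hz
    rcases hsub ⟨t, rfl⟩ with (h | h) | h
    · exact absurd hz h
    · exact Or.inl h
    · exact Or.inr h
  have hlower : ∀ t, (γ t).2.2 = 0 → (γ t).2.1 ∈ J₁ → ∃ v ∈ Ioo v₁ v₂,
      ε * P.offset ε - P.scale ε * P.i.launch (-P.rate ε) v = (γ t).2.1 ∧
      (∀ s ∈ Icc 0 (v / P.freq ε), γ (t + s) = P.lowerArc ε v s) ∧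
      (γ (t + v / P.freq ε)).2.2 = 0 ∧ (γ (t + v / P.freq ε)).2.1 ∈ J₀ ∧
      (γ (t + v / P.freq ε)).2.1 =
        ε * P.offset ε + P.scale ε * P.i.launch (P.rate ε) v := by
    intro t hz hy
    obtain ⟨v, hv, hvy⟩ := hJ₁v _ hy
    have harc := hs.eq_lowerArc hγ (hpt t hz) hy.2.1 hy.2.2 (hvd v hv) hvy
    have hvpos := FamilyIndex.pos_of_mem_dom (hvd v hv)
    have hend := harc (v / P.freq ε) ⟨(div_pos hvpos hfr).le, le_rfl⟩
    rw [hs.lowerArc_end (hvd v hv)] at hend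
    have hz' : (γ (t + v / P.freq ε)).2.2 = 0 := by rw [hend]
    have hy' : (γ (t + v / P.freq ε)).2.1 =
        ε * P.offset ε + P.scale ε * P.i.launch (P.rate ε) v := by rw [hend]
    refine ⟨v, hv, hvy, harc, hz', ?_, hy'⟩
    rcases hJ _ hz' with h | h
    · exact h
    · have h1 := h.2.1
      have h2 := hupv v hv
      rw [hy'] at h1
      linarith
  have hupper : ∀ t, (γ t).2.2 = 0 → (γ t).2.1 ∈ J₀ → ∃ u ∈ Ioo u₁ u₂,
      P.i.launch ε u = (γ t).2.1 ∧ (∀ s ∈ Icc 0 u, γ (t + s) = P.upperArc ε u s) ∧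
      (γ (t + u)).2.2 = 0 ∧ (γ (t + u)).2.1 ∈ J₁ ∧ (γ (t + u)).2.1 = -P.i.launch (-ε) u := by
    intro t hz hy
    obtain ⟨u, hu, huy⟩ := hJ₀u _ hy
    have hg := hgood u (Ioo_subset_Icc_self hu)
    have harc := hs.eq_upperArc hγ (hpt t hz) (by rw [← huy]; exact hg.cross_out)
      (by rw [← huy]; exact hg.cross_out') hg.mem_dom huy
    have hend := harc u ⟨(FamilyIndex.pos_of_mem_dom hg.mem_dom).le, le_rfl⟩
    rw [P.upperArc_end hg.mem_dom] at hend
    have hz' : (γ (t + u)).2.2 = 0 := by rw [hend]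
    have hy' : (γ (t + u)).2.1 = -P.i.launch (-ε) u := by rw [hend]
    refine ⟨u, hu, huy, harc, hz', ?_, hy'⟩
    rcases hJ _ hz' with h | h
    · have h1 := (hgood u₁ (left_mem_Icc.2 hu12)).cross_out
      have h2 := h.1
      have h3 := hg.cross_inn
      rw [hy'] at h2
      linarith
    · exact h
  let Up : ℝ → Prop := fun t => (γ t).2.2 = 0 ∧ (γ t).2.1 ∈ J₀
  -- The condition `Up t` sits inside the existential so that `choose` gives total functions; the
  -- dummy values `0` occur only where `Up` fails.
  have hstep : ∀ t, ∃ u v, Up t → u ∈ Ioo u₁ u₂ ∧ v ∈ Ioo v₁ v₂ ∧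
      P.i.launch ε u = (γ t).2.1 ∧ (∀ s ∈ Icc 0 u, γ (t + s) = P.upperArc ε u s) ∧
      (∀ s ∈ Icc 0 (v / P.freq ε), γ (t + u + s) = P.lowerArc ε v s) ∧
      Up (t + u + v / P.freq ε) ∧
      -P.i.launch (-ε) u = ε * P.offset ε - P.scale ε * P.i.launch (-P.rate ε) v ∧
      (γ (t + u + v / P.freq ε)).2.1 =
        ε * P.offset ε + P.scale ε * P.i.launch (P.rate ε) v := by
    intro t
    by_cases h : Up t
    · obtain ⟨u, hu, h1, h2, h3, h4, h5⟩ := hupper t h.1 h.2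
      obtain ⟨v, hv, k1, k2, k3, k4, k5⟩ := hlower (t + u) h3 h4
      exact ⟨u, v, fun _ => ⟨hu, hv, h1, h2, k2, ⟨k3, k4⟩, by rw [k1, h5], k5⟩⟩
    · exact ⟨0, 0, fun h' => absurd h' h⟩
  choose fu fv hfuv using hstep
  obtain ⟨t₀, ht₀⟩ : ∃ t, Up t := by
    obtain ⟨t, ht⟩ := hs.exists_zero_of_periodic hε hT hγ hper hne
    rcases hJ t ht with h | h
    · exact ⟨t, ht, h⟩
    · obtain ⟨v, _, _, _, k3, k4, _⟩ := hlower t ht h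
      exact ⟨_, k3, k4⟩
  let τ : ℕ → ℝ := fun n => (fun t => t + fu t + fv t / P.freq ε)^[n] t₀
  have hτ0 : τ 0 = t₀ := rfl
  have hτs : ∀ n, τ (n + 1) = τ n + fu (τ n) + fv (τ n) / P.freq ε := fun n =>
    Function.iterate_succ_apply' _ n t₀
  have hUp : ∀ n, Up (τ n) := by
    intro n
    induction n with
    | zero => exact ht₀
    | succ n ih =>
      rw [hτs]
      exact (hfuv (τ n) ih).2.2.2.2.2.1
  have hfud : ∀ n, fu (τ n) ∈ Ioo u₁ u₂ := fun n => (hfuv _ (hUp n)).1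
  have hfug : ∀ n, P.Good ε (fu (τ n)) := fun n => hgood _ (Ioo_subset_Icc_self (hfud n))
  have hfvd : ∀ n, fv (τ n) ∈ P.i.dom := fun n => hvd _ (hfuv _ (hUp n)).2.1
  have hret : ∀ n, ReturnData P ε (fu (τ n)) (fv (τ n)) (fu (τ (n + 1))) := by
    intro n
    refine ⟨(hfug n).mem_dom, hfvd n, (hfug (n + 1)).mem_dom, (hfuv _ (hUp n)).2.2.2.2.2.2.1, ?_⟩
    rw [(hfuv _ (hUp (n + 1))).2.2.1, hτs]
    exact (hfuv _ (hUp n)).2.2.2.2.2.2.2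
  have hu₁pos := FamilyIndex.pos_of_mem_dom hd1
  have hvpos : ∀ n, 0 < fv (τ n) / P.freq ε := fun n =>
    div_pos (FamilyIndex.pos_of_mem_dom (hfvd n)) hfr
  have hgrow : ∀ n, τ n + u₁ ≤ τ (n + 1) := by
    intro n
    rw [hτs]
    linarith [(hfud n).1, hvpos n]
  have hseg : ∀ n, ∀ x ∈ Icc (τ n) (τ (n + 1)),
      (x - τ n ∈ Icc 0 (fu (τ n)) ∧ γ x = P.upperArc ε (fu (τ n)) (x - τ n)) ∨
      (x - τ n - fu (τ n) ∈ Icc 0 (fv (τ n) / P.freq ε) ∧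
        γ x = P.lowerArc ε (fv (τ n)) (x - τ n - fu (τ n))) := by
    intro n x hxm
    have h := hfuv _ (hUp n)
    rw [hτs] at hxm
    by_cases hle : x ≤ τ n + fu (τ n)
    · left
      have hm : x - τ n ∈ Icc 0 (fu (τ n)) := ⟨by linarith [hxm.1], by linarith⟩
      refine ⟨hm, ?_⟩
      have := h.2.2.2.1 _ hm
      rwa [add_sub_cancel] at this
    · right
      have hm : x - τ n - fu (τ n) ∈ Icc 0 (fv (τ n) / P.freq ε) :=
        ⟨by linarith [not_le.1 hle], by linarith [hxm.2]⟩
      refine ⟨hm, ?_⟩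
      have := h.2.2.2.2.1 _ hm
      rwa [show τ n + fu (τ n) + (x - τ n - fu (τ n)) = x by ring] at this
  -- One period after `τ 0` the solution is again at an upward crossing. Inside an arc `z ≠ 0`, and
  -- at the junction from upper to lower arc `y < 0`, so this time must be some `τ n`.
  have hrecur : ∃ n, 0 < n ∧ fu (τ n) = fu (τ 0) := by
    obtain ⟨n, hn1, hn2⟩ := exists_between_of_step hu₁pos hgrow
      (show τ 0 ≤ τ 0 + T by linarith)
    have hγT : γ (τ 0 + T) = γ (τ 0) := hper _
    have hUT := hUp 0
    have hpos : 0 < (γ (τ 0 + T)).2.1 := by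
      rw [hγT]
      have h1 := (hgood u₁ (left_mem_Icc.2 hu12)).cross_out
      have h2 := hUT.2.1
      linarith
    have hz : (γ (τ 0 + T)).2.2 = 0 := by rw [hγT]; exact hUT.1
    have heq : τ 0 + T = τ n := by
      by_contra hneq
      have hlt : τ n < τ 0 + T := lt_of_le_of_ne hn1 (Ne.symm hneq)
      rcases hseg n _ ⟨hn1, hn2.le⟩ with ⟨hm, he⟩ | ⟨hm, he⟩
      · rcases hm.2.eq_or_lt with e | e
        · rw [he, e, P.upperArc_end (hfug n).mem_dom] at hpos
          simp only at hpos
          linarith [(hfug n).cross_inn]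
        · have := hs.upperArc_pos (hfug n).mem_dom (s := τ 0 + T - τ n) ⟨by linarith, e⟩
          rw [← he, hz] at this
          exact lt_irrefl _ this
      · rcases hm.1.eq_or_lt with e | e
        · rw [he, ← e, lowerArc_zero, ← (hret n).down] at hpos
          simp only at hpos
          linarith [(hfug n).cross_inn]
        · have := hs.lowerArc_neg (hfvd n) (s := τ 0 + T - τ n - fu (τ n))
            ⟨e, by rw [hτs] at hn2; linarith⟩
          rw [← he, hz] at this
          exact lt_irrefl _ this
    refine ⟨n, ?_, ?_⟩
    · rcases Nat.eq_zero_or_pos n with h | h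
      · rw [h] at heq; linarith
      · exact h
    · apply hmono.injOn (hfug n).mem_dom (hfug 0).mem_dom
      rw [(hfuv _ (hUp n)).2.2.1, (hfuv _ (hUp 0)).2.2.1, ← heq, hγT]
  -- If the first two durations differed, order preservation would make the whole sequence strictly
  -- monotone, contradicting recurrence.
  have hfix : fu (τ 1) = fu (τ 0) := by
    obtain ⟨n, hn, hrec⟩ := hrecur
    rcases lt_trichotomy (fu (τ 0)) (fu (τ 1)) with h | h | h
    · have hall : ∀ m, fu (τ m) < fu (τ (m + 1)) := by
        intro m
        induction m with
        | zero => exact h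
        | succ m ih => exact (hret m).lt hs (hret (m + 1)) ih
      exact absurd hrec (strictMono_nat_of_lt_succ (f := fun m => fu (τ m)) hall hn).ne'
    · exact h.symm
    · have hall : ∀ m, fu (τ (m + 1)) < fu (τ m) := by
        intro m
        induction m with
        | zero => exact h
        | succ m ih => exact (hret m).gt hs (hret (m + 1)) ih
      exact absurd hrec (strictAnti_nat_of_succ_lt (f := fun m => fu (τ m)) hall hn).ne
  have hall : ∀ n, fu (τ n) = u₀ ∧ fv (τ n) = v₀ := by
    have hfixn : ∀ n, fu (τ (n + 1)) = fu (τ n) → fu (τ n) = u₀ ∧ fv (τ n) = v₀ := by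
      intro n h
      obtain ⟨g0, hv⟩ := (hret n).eq hs (hfug n) h
      have := hiso _ (Ioo_subset_Icc_self (hfud n)) g0
      exact ⟨this, by rw [hv, this]⟩
    intro n
    induction n with
    | zero => exact hfixn 0 hfix
    | succ n ih =>
      have hup := (hret n).up
      rw [ih.2, (hg0.launch_lowerTime h0).1, out, mul_div_cancel₀ _ hsc.ne',
        add_sub_cancel] at hup
      have h1 := hmono.injOn (hfug (n + 1)).mem_dom hg0.mem_dom hup
      have hdown := (hret (n + 1)).down
      rw [h1, ← hdown0] at hdown
      have h2 : P.i.launch (-P.rate ε) (fv (τ (n + 1))) = P.i.launch (-P.rate ε) v₀ :=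
        mul_left_cancel₀ hsc.ne' (by linarith)
      exact ⟨h1, (FamilyIndex.strictMonoOn_launch hrneg).injOn (hfvd _) hv₀d h2⟩
  apply Subset.antisymm
  · rintro _ ⟨t, rfl⟩
    -- The arcs found so far cover only times after `τ 0`; earlier times are moved there by whole
    -- periods.
    obtain ⟨N, hN⟩ := exists_nat_gt ((τ 0 - t) / T)
    rw [div_lt_iff₀ hT] at hN
    have hγN : γ (t + N * T) = γ t := (hper.nat_mul N) t
    rw [← hγN]
    obtain ⟨n, hn1, hn2⟩ := exists_between_of_step hu₁pos hgrow
      (show τ 0 ≤ t + N * T by linarith)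
    rcases hseg n _ ⟨hn1, hn2.le⟩ with ⟨hm, he⟩ | ⟨hm, he⟩
    · rw [(hall n).1] at hm he
      exact Or.inl ⟨_, hm, he.symm⟩
    · rw [(hall n).2] at hm he
      exact Or.inr ⟨_, hm, he.symm⟩
  · have h := hfuv _ (hUp 0)
    rw [(hall 0).1, (hall 0).2] at h
    rintro _ (⟨s, hs', rfl⟩ | ⟨s, hs', rfl⟩)
    · exact ⟨_, h.2.2.2.1 s hs'⟩
    · exact ⟨_, h.2.2.2.2.1 s hs'⟩

end LowerData

/-! ### Hausdorff convergence and selection of zeros -/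

/-- Currying gives a continuous map from parameters to curves in the compact-open topology.
Convergence is thus uniform on `[0, 1]`, and the uniform distance bounds the Hausdorff distance. -/
theorem tendsto_hausdorffEDist_image {ι Q : Type*} [TopologicalSpace Q]
    {l : Filter ι} {Ψ : Q × ℝ → R3} (hΨ : Continuous Ψ) {q : ι → Q} {q₀ : Q}
    (hq : Tendsto q l (𝓝 q₀)) :
    Tendsto (fun a => Metric.hausdorffEDist ((fun s => Ψ (q a, s)) '' Icc 0 1)
      ((fun s => Ψ (q₀, s)) '' Icc 0 1)) l (𝓝 0) := by
  have h1 : Tendsto (fun a => (ContinuousMap.mk Ψ hΨ).curry (q a)) l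
      (𝓝 ((ContinuousMap.mk Ψ hΨ).curry q₀)) :=
    ((ContinuousMap.mk Ψ hΨ).curry.continuous.tendsto q₀).comp hq
  have h2 := ContinuousMap.tendsto_iff_forall_isCompact_tendstoUniformlyOn.1 h1 (Icc (0 : ℝ) 1)
    isCompact_Icc
  rw [EMetric.tendstoUniformlyOn_iff] at h2
  rw [ENNReal.tendsto_nhds_zero]
  intro e he
  filter_upwards [h2 e he] with a ha
  refine Metric.hausdorffEDist_le_of_mem_edist ?_ ?_
  · rintro _ ⟨s, hs, rfl⟩
    exact ⟨_, ⟨s, hs, rfl⟩, by rw [edist_comm]; exact (ha s hs).le⟩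
  · rintro _ ⟨s, hs, rfl⟩
    exact ⟨_, ⟨s, hs, rfl⟩, (ha s hs).le⟩

theorem image_Icc_eq_image_unitInterval {g : ℝ → R3} {u : ℝ} (hu : 0 < u) :
    g '' Icc 0 u = (fun s => g (s * u)) '' Icc 0 1 := by
  have : Icc 0 u = (fun s => s * u) '' Icc 0 1 := by
    rw [Set.image_mul_right_Icc zero_le_one hu.le, zero_mul, one_mul]
  rw [this, image_image]

/-- Choosing, for each `ε`, a solution whose distance to `a` is within `|ε|` of the infimum gives
one function that serves every `η`, whether or not the infimum is attained. -/
theorem exists_selection {Q : ℝ → ℝ → Prop} {a : ℝ}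
    (h : ∀ η > 0, ∀ᶠ ε in 𝓝[≠] (0 : ℝ), ∃ u, |u - a| < η ∧ Q ε u) :
    ∃ f : ℝ → ℝ, Tendsto f (𝓝[≠] 0) (𝓝 a) ∧ ∀ᶠ ε in 𝓝[≠] (0 : ℝ), Q ε (f ε) := by
  have hex : ∀ ε : ℝ, ∃ u, (ε ≠ 0 → (∃ w, Q ε w) →
      Q ε u ∧ ∀ w, Q ε w → |u - a| < |w - a| + |ε|) := by
    intro ε
    by_cases hε : ε ≠ 0 ∧ ∃ w, Q ε w
    · obtain ⟨hε0, w₀, hw₀⟩ := hε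
      set S := {d | ∃ w, Q ε w ∧ d = |w - a|} with hS
      have hne : S.Nonempty := ⟨_, w₀, hw₀, rfl⟩
      have hbdd : BddBelow S := ⟨0, by rintro _ ⟨w, _, rfl⟩; exact abs_nonneg _⟩
      obtain ⟨_, ⟨u, hu, rfl⟩, hlt⟩ := exists_lt_of_csInf_lt hne
        (show sInf S < sInf S + |ε| by linarith [abs_pos.2 hε0])
      exact ⟨u, fun _ _ => ⟨hu, fun w hw =>
        hlt.trans_le (by linarith [csInf_le hbdd ⟨w, hw, rfl⟩])⟩⟩
    · exact ⟨0, fun h1 h2 => absurd ⟨h1, h2⟩ hε⟩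
  choose f hf using hex
  refine ⟨f, ?_, ?_⟩
  · rw [Metric.tendsto_nhds]
    intro e he
    have h1 : ∀ᶠ ε in 𝓝[≠] (0 : ℝ), |ε| < e / 2 :=
      nhdsWithin_le_nhds (continuous_abs.continuousAt.eventually
        (gt_mem_nhds (by simpa using half_pos he)))
    filter_upwards [h (e / 2) (half_pos he), h1, self_mem_nhdsWithin] with ε h2 h3 h4
    obtain ⟨w, hw, hQ⟩ := h2
    have := (hf ε h4 ⟨w, hQ⟩).2 w hQ
    rw [Real.dist_eq]
    linarith
  · filter_upwards [h 1 one_pos, self_mem_nhdsWithin] with ε h2 h4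
    obtain ⟨w, _, hQ⟩ := h2
    exact (hf ε h4 ⟨w, hQ⟩).1

namespace LowerData

variable (P : LowerData)

/-- After rescaling time to `[0, 1]`, both arcs are values of fixed continuous maps of finitely many
parameters, and all these parameters converge. -/
theorem tendsto_orbit {u₀ : ℝ} (hu₀ : u₀ ∈ P.i.dom) {f : ℝ → ℝ}
    (hf : Tendsto f (𝓝[≠] 0) (𝓝 u₀)) :
    Tendsto (fun ε => Metric.hausdorffEDist (P.orbit ε (f ε)) (P.orbit 0 u₀)) (𝓝[≠] 0) (𝓝 0) := by
  have hid : Tendsto (fun ε : ℝ => ε) (𝓝[≠] 0) (𝓝 0) := nhdsWithin_le_nhds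
  have hS := (FamilyIndex.sn_pos hu₀).ne'
  have hlaunch : ∀ d : ℝ → ℝ, Tendsto d (𝓝[≠] 0) (𝓝 0) → ∀ w : ℝ → ℝ, ∀ w₀ ∈ P.i.dom,
      Tendsto w (𝓝[≠] 0) (𝓝 w₀) →
      Tendsto (fun ε => P.i.launch (d ε) (w ε)) (𝓝[≠] 0) (𝓝 (P.i.launch 0 w₀)) := by
    intro d hd w w₀ hw₀ hw
    unfold FamilyIndex.launch
    exact (((Real.continuous_exp.tendsto _).comp (hd.mul hw).neg).sub
      ((P.i.continuous_cs.tendsto _).comp hw)).const_mul _ |>.div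
      ((P.i.continuous_sn.tendsto _).comp hw) (FamilyIndex.sn_pos hw₀).ne'
  have hpar : ∀ {g : ℝ → ℝ} {c : ℝ}, ContinuousAt g 0 → g 0 = c →
      Tendsto g (𝓝[≠] 0) (𝓝 c) := fun hg h => by
    rw [← h]; exact hg.tendsto.mono_left nhdsWithin_le_nhds
  have hoff := hpar P.hasDerivAt_offset.continuousAt P.offset_zero
  have hscale := hpar P.hasDerivAt_scale.continuousAt P.scale_zero
  have hheight := hpar P.hasDerivAt_height.continuousAt P.height_zero
  have hrate := hpar P.continuousAt_rate P.rate_zero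
  have hout : Tendsto (fun ε => P.out ε (f ε)) (𝓝[≠] 0) (𝓝 (P.out 0 u₀)) := by
    have := ((hlaunch _ hid f u₀ hu₀ hf).sub (hid.mul hoff)).div hscale one_ne_zero
    rwa [show (P.i.launch 0 u₀ - 0 * 0) / 1 = P.out 0 u₀ by simp [out_zero]] at this
  have hneg : Tendsto (fun ε : ℝ => -ε) (𝓝[≠] 0) (𝓝 0) := by simpa using hid.neg
  have hinn : Tendsto (fun ε => P.inn ε (f ε)) (𝓝[≠] 0) (𝓝 (P.inn 0 u₀)) := by
    have := ((hlaunch _ hneg f u₀ hu₀ hf).add (hid.mul hoff)).div hscale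
      one_ne_zero
    rwa [show (P.i.launch 0 u₀ + 0 * 0) / 1 = P.inn 0 u₀ by simp [inn_zero]] at this
  have hD := FamilyIndex.one_add_sgn_mul_launch_zero_sq_pos hu₀
  have htime : Tendsto (fun ε => P.lowerTime ε (f ε)) (𝓝[≠] 0) (𝓝 (P.lowerTime 0 u₀)) := by
    refine Tendsto.add ?_ ?_
    · exact ((FamilyIndex.hasDerivAt_arc (by rwa [out_zero])).continuousAt.tendsto).comp hout
    · exact ((FamilyIndex.hasDerivAt_arc (by rwa [inn_zero])).continuousAt.tendsto).comp hinn
  have hgood : P.Good 0 u₀ :=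
    (P.eventually_good hu₀ hu₀).self_of_nhds u₀ ⟨le_rfl, le_rfl⟩
  have htimed := hgood.lowerTime_mem
  have hnegrate : Tendsto (fun ε => -P.rate ε) (𝓝[≠] 0) (𝓝 0) := by simpa using hrate.neg
  let Ψ₁ : (ℝ × ℝ × ℝ) × ℝ → R3 := fun x =>
    (0, P.i.spiralY x.1.1 x.1.2.1 (x.2 * x.1.2.2), P.i.spiralZ x.1.1 x.1.2.1 (x.2 * x.1.2.2))
  let Ψ₂ : ((ℝ × ℝ × ℝ) × (ℝ × ℝ × ℝ)) × ℝ → R3 := fun x =>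
    (0, x.1.2.1 - x.1.2.2.1 * P.i.spiralY x.1.1.1 x.1.1.2.1 (x.2 * x.1.1.2.2),
      -(x.1.2.2.2 * P.i.spiralZ x.1.1.1 x.1.1.2.1 (x.2 * x.1.1.2.2)))
  have hΨ₁ : Continuous Ψ₁ := by
    simp only [Ψ₁, FamilyIndex.spiralY, FamilyIndex.spiralZ]; fun_prop
  have hΨ₂ : Continuous Ψ₂ := by
    simp only [Ψ₂, FamilyIndex.spiralY, FamilyIndex.spiralZ]; fun_prop
  let q₁ : ℝ → ℝ → ℝ × ℝ × ℝ := fun ε u => (ε, P.i.launch ε u, u)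
  let q₂ : ℝ → ℝ → (ℝ × ℝ × ℝ) × (ℝ × ℝ × ℝ) := fun ε u =>
    ((-P.rate ε, P.i.launch (-P.rate ε) (P.lowerTime ε u), P.lowerTime ε u),
      (ε * P.offset ε, P.scale ε, P.height ε))
  have horbit : ∀ ε u, P.Small ε → u ∈ P.i.dom → P.lowerTime ε u ∈ P.i.dom → P.orbit ε u =
      (fun s => Ψ₁ (q₁ ε u, s)) '' Icc 0 1 ∪ (fun s => Ψ₂ (q₂ ε u, s)) '' Icc 0 1 := by
    intro ε u hs hu hv
    have hv0 := FamilyIndex.pos_of_mem_dom hv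
    rw [orbit, image_Icc_eq_image_unitInterval (FamilyIndex.pos_of_mem_dom hu),
      image_Icc_eq_image_unitInterval (div_pos hv0 hs.freq_pos)]
    congr 1
    refine image_congr fun s _ => ?_
    have : P.freq ε * (s * (P.lowerTime ε u / P.freq ε)) = s * P.lowerTime ε u := by
      have := hs.freq_pos.ne'
      field_simp
    simp only [lowerArc, Ψ₂, q₂, this]
  have hq₁ : Tendsto (fun ε => q₁ ε (f ε)) (𝓝[≠] 0) (𝓝 (q₁ 0 u₀)) :=
    hid.prodMk_nhds ((hlaunch _ hid f u₀ hu₀ hf).prodMk_nhds hf)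
  have hq₂ : Tendsto (fun ε => q₂ ε (f ε)) (𝓝[≠] 0) (𝓝 (q₂ 0 u₀)) := by
    simp only [q₂, rate_zero, offset_zero, scale_zero, height_zero, neg_zero, zero_mul]
    refine Tendsto.prodMk_nhds (hnegrate.prodMk_nhds
      ((hlaunch _ hnegrate _ _ htimed htime).prodMk_nhds htime)) (Tendsto.prodMk_nhds ?_
      (hscale.prodMk_nhds hheight))
    simpa using hid.mul hoff
  have hmax := (tendsto_hausdorffEDist_image hΨ₁ hq₁).max (tendsto_hausdorffEDist_image hΨ₂ hq₂)
  rw [max_self] at hmax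
  refine tendsto_of_tendsto_of_tendsto_of_le_of_le' tendsto_const_nhds hmax
    (Eventually.of_forall fun _ => zero_le) ?_
  filter_upwards [nhdsWithin_le_nhds P.eventually_small,
    hf.eventually (P.i.isOpen_dom.mem_nhds hu₀),
    htime.eventually (P.i.isOpen_dom.mem_nhds htimed)] with ε h1 h2 h3
  rw [horbit ε _ h1 h2 h3, horbit 0 u₀ P.eventually_small.self_of_nhds hu₀ htimed]
  exact Metric.hausdorffEDist_union_le

/-- Each sign change of the leading coefficient of `gap` produces a family of limit cycles. -/
theorem exists_limitCycles {u₀ ρ : ℝ} (hρ : 0 < ρ) (hdom : Icc (u₀ - ρ) (u₀ + ρ) ⊆ P.i.dom)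
    (hsign : ∀ x ∈ Ioo (u₀ - ρ) u₀, ∀ y ∈ Ioo u₀ (u₀ + ρ), P.melnikov x * P.melnikov y < 0) :
    ∃ f : ℝ → ℝ, Tendsto f (𝓝[≠] 0) (𝓝 u₀) ∧ ∀ᶠ ε in 𝓝[≠] (0 : ℝ), P.Small ε ∧
      P.Good ε (f ε) ∧ P.gap ε (f ε) = 0 ∧
      (P.system ε).IsCrossingLimitCycle (P.orbit ε (f ε)) := by
  have hsmall : ∀ᶠ ε in 𝓝[≠] (0 : ℝ), P.Small ε := nhdsWithin_le_nhds P.eventually_small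
  have hgood : ∀ᶠ ε in 𝓝[≠] (0 : ℝ), ∀ u ∈ Icc (u₀ - ρ) (u₀ + ρ), P.Good ε u :=
    nhdsWithin_le_nhds (P.eventually_good (hdom ⟨le_rfl, by linarith⟩) (hdom ⟨by linarith, le_rfl⟩))
  have hprod : ∀ x ∈ Ioo (u₀ - ρ) u₀, ∀ y ∈ Ioo u₀ (u₀ + ρ),
      ∀ᶠ ε in 𝓝[≠] (0 : ℝ), P.gap ε x * P.gap ε y < 0 := by
    intro x hx y hy
    have h1 := P.tendsto_gap_div_sq (hdom ⟨hx.1.le, by linarith [hx.2]⟩)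
    have h2 := P.tendsto_gap_div_sq (hdom ⟨by linarith [hy.1], hy.2.le⟩)
    filter_upwards [(h1.mul h2).eventually (gt_mem_nhds (hsign x hx y hy)),
      self_mem_nhdsWithin] with ε h hε
    have hε' : ε ≠ 0 := hε
    have : P.gap ε x * P.gap ε y = (P.gap ε x / ε ^ 2 * (P.gap ε y / ε ^ 2)) * (ε ^ 2) ^ 2 := by
      field_simp
    rw [this]
    exact mul_neg_of_neg_of_pos h (by positivity)
  obtain ⟨f, hf, hfgap⟩ := exists_selection (Q := fun ε u => P.gap ε u = 0) (a := u₀) (by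
    intro η hη
    set r := min η ρ with hr
    have hr0 : 0 < r := lt_min hη hρ
    have hrη := min_le_left η ρ
    have hrρ := min_le_right η ρ
    filter_upwards [hprod (u₀ - r / 2) ⟨by linarith, by linarith⟩ (u₀ + r / 2)
      ⟨by linarith, by linarith⟩, hsmall, hgood] with ε h1 h2 h3
    have hcont : ContinuousOn (P.gap ε) (Icc (u₀ - r / 2) (u₀ + r / 2)) := fun u hu =>
      ((h3 u ⟨by linarith [hu.1], by linarith [hu.2]⟩).analyticAt_gap h2).continuousAt
        |>.continuousWithinAt
    have hle : u₀ - r / 2 ≤ u₀ + r / 2 := by linarith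
    obtain ⟨u, hu, hu0⟩ : ∃ u ∈ Icc (u₀ - r / 2) (u₀ + r / 2), P.gap ε u = 0 := by
      rcases mul_neg_iff.1 h1 with ⟨a1, a2⟩ | ⟨a1, a2⟩
      · exact intermediate_value_Icc' hle hcont ⟨a2.le, a1.le⟩
      · exact intermediate_value_Icc hle hcont ⟨a1.le, a2.le⟩
    refine ⟨u, ?_, hu0⟩
    rw [_root_.abs_lt]
    constructor <;> linarith [hu.1, hu.2])
  refine ⟨f, hf, ?_⟩
  filter_upwards [hsmall, hgood, hfgap, self_mem_nhdsWithin,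
    hf.eventually (Ioo_mem_nhds (show u₀ - ρ < u₀ by linarith) (show u₀ < u₀ + ρ by linarith)),
    hprod (u₀ - ρ / 2) ⟨by linarith, by linarith⟩ (u₀ + ρ / 2) ⟨by linarith, by linarith⟩]
    with ε hs hg h0 hε hmem hne
  refine ⟨hs, hg _ (Ioo_subset_Icc_self hmem), h0, ?_⟩
  have han : AnalyticOnNhd ℝ (P.gap ε) (Icc (u₀ - ρ) (u₀ + ρ)) :=
    fun u hu => (hg u hu).analyticAt_gap hs
  -- Accumulating zeros would make the analytic gap vanish on the whole interval, which the opposite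
  -- signs at `u₀ ± ρ / 2` exclude.
  have hev : ∀ᶠ u in 𝓝[≠] (f ε), P.gap ε u ≠ 0 := by
    by_contra hcon
    have hfreq : ∃ᶠ u in 𝓝[≠] (f ε), P.gap ε u = 0 := by
      rw [Filter.Frequently]; exact hcon
    have hzero := han.eqOn_zero_of_preconnected_of_frequently_eq_zero isPreconnected_Icc
      (Ioo_subset_Icc_self hmem) hfreq
    have := hzero (show u₀ - ρ / 2 ∈ Icc (u₀ - ρ) (u₀ + ρ) from ⟨by linarith, by linarith⟩)
    rw [this] at hne
    simp at hne
  rw [eventually_nhdsWithin_iff] at hev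
  obtain ⟨r, hr, hball⟩ := Metric.eventually_nhds_iff.1
    (hev.and (Ioo_mem_nhds hmem.1 hmem.2))
  have hd : ∀ x ∈ Icc (f ε - r / 2) (f ε + r / 2), dist x (f ε) < r := fun x hx => by
    rw [Real.dist_eq, _root_.abs_lt]; constructor <;> linarith [hx.1, hx.2]
  refine hs.isCrossingLimitCycle_orbit hε (u₁ := f ε - r / 2) (u₂ := f ε + r / 2)
    (fun u hu => hg u (Ioo_subset_Icc_self (hball (hd u hu)).2)) ⟨by linarith, by linarith⟩ h0 ?_
  intro u hu hu0
  by_contra hne'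
  exact (hball (hd u hu)).1 hne' hu0

end LowerData

/-! ### Sign changes of the leading coefficient -/

namespace FamilyIndex

/-- The profile whose level sets are the zeros of the leading coefficient of `gap`. -/
noncomputable def profile (i : FamilyIndex) (A u : ℝ) : ℝ := i.cs u + A * (i.sn u / u)

theorem hasDerivAt_profile (i : FamilyIndex) (A : ℝ) {u : ℝ} (hu : u ≠ 0) :
    HasDerivAt (i.profile A)
      ((-i.sgn * u ^ 2 * i.sn u + A * (u * i.cs u - i.sn u)) / u ^ 2) u := by
  have := (i.hasDerivAt_cs u).add
    (((i.hasDerivAt_sn u).div (hasDerivAt_id u) hu).const_mul A)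
  convert! this using 1
  simp only [id_eq]
  field_simp

theorem strictMonoOn_profile (i : FamilyIndex) {A c d : ℝ} (hc : 0 ≤ c)
    (h : ∀ u ∈ Ioo c d, 0 < -i.sgn * u ^ 2 * i.sn u + A * (u * i.cs u - i.sn u)) :
    StrictMonoOn (i.profile A) (Ioo c d) := by
  have hpos : ∀ u ∈ Ioo c d, 0 < u := fun u hu => hc.trans_lt hu.1
  apply strictMonoOn_of_deriv_pos (convex_Ioo c d)
  · exact fun u hu => (i.hasDerivAt_profile A (hpos u hu).ne').continuousAt.continuousWithinAt
  · intro u hu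
    rw [isOpen_Ioo.interior_eq] at hu
    rw [(i.hasDerivAt_profile A (hpos u hu).ne').deriv]
    exact div_pos (h u hu) (pow_pos (hpos u hu) 2)

theorem strictAntiOn_profile (i : FamilyIndex) {A c d : ℝ} (hc : 0 ≤ c)
    (h : ∀ u ∈ Ioo c d, -i.sgn * u ^ 2 * i.sn u + A * (u * i.cs u - i.sn u) < 0) :
    StrictAntiOn (i.profile A) (Ioo c d) := by
  have hpos : ∀ u ∈ Ioo c d, 0 < u := fun u hu => hc.trans_lt hu.1
  apply strictAntiOn_of_deriv_neg (convex_Ioo c d)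
  · exact fun u hu => (i.hasDerivAt_profile A (hpos u hu).ne').continuousAt.continuousWithinAt
  · intro u hu
    rw [isOpen_Ioo.interior_eq] at hu
    rw [(i.hasDerivAt_profile A (hpos u hu).ne').deriv]
    exact div_neg_of_neg_of_pos (h u hu) (pow_pos (hpos u hu) 2)

theorem hasDerivAt_profile_num (i : FamilyIndex) (A u : ℝ) :
    HasDerivAt (fun u => -i.sgn * u ^ 2 * i.sn u + A * (u * i.cs u - i.sn u))
      (-i.sgn * u * (u * i.cs u + (2 + A) * i.sn u)) u := by
  have := ((((hasDerivAt_pow 2 u).const_mul (-i.sgn)).mul (i.hasDerivAt_sn u))).add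
    ((((hasDerivAt_id u).mul (i.hasDerivAt_cs u)).sub (i.hasDerivAt_sn u)).const_mul A)
  convert! this using 1
  simp only [id_eq]
  push_cast
  ring

/-- For `A = -2` the numerator `N` of the derivative of the profile satisfies `N 0 = 0` and `N' =
-u² cos u`. Hence `N < 0` on `(0, π/2)`, and `N > 0` beyond `3π/4`, where it is already positive.
The value at `π/3`, about `-1.15`, lies between those at `3π/4`, about `-1.31`, and at `π`, which is
`-1`. -/
theorem exists_profile_a : ∃ u₁ u₂ : ℝ, u₁ ∈ Ioo 0 (Real.pi / 2) ∧
    u₂ ∈ Ioo (3 * Real.pi / 4) Real.pi ∧ a.profile (-2) u₁ = a.profile (-2) u₂ ∧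
    StrictAntiOn (a.profile (-2)) (Ioo 0 (Real.pi / 2)) ∧
    StrictMonoOn (a.profile (-2)) (Ioo (3 * Real.pi / 4) Real.pi) := by
  have hpi := Real.pi_pos
  have hpi1 := Real.pi_gt_d2
  have hpi2 := Real.pi_lt_d2
  set N : ℝ → ℝ := fun u => -a.sgn * u ^ 2 * a.sn u + (-2) * (u * a.cs u - a.sn u) with hN
  have hN' : ∀ u, HasDerivAt N (-u ^ 2 * Real.cos u) u := by
    intro u
    have := a.hasDerivAt_profile_num (-2) u
    convert! this using 1
    simp only [sgn, cs]; ring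
  have hNc : Continuous N := continuous_iff_continuousAt.2 fun u => (hN' u).continuousAt
  have hanti : StrictAntiOn N (Icc 0 (Real.pi / 2)) := by
    apply strictAntiOn_of_deriv_neg (convex_Icc _ _) hNc.continuousOn
    intro u hu
    rw [interior_Icc] at hu
    rw [(hN' u).deriv]
    have := Real.cos_pos_of_mem_Ioo (x := u) ⟨by linarith [hu.1], hu.2⟩
    have hu0 := hu.1
    have : 0 < u ^ 2 * Real.cos u := by positivity
    linarith
  have hmono : StrictMonoOn N (Icc (Real.pi / 2) Real.pi) := by
    apply strictMonoOn_of_deriv_pos (convex_Icc _ _) hNc.continuousOn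
    intro u hu
    rw [interior_Icc] at hu
    rw [(hN' u).deriv]
    have h1 := Real.cos_neg_of_pi_div_two_lt_of_lt hu.1 (by linarith [hu.2])
    have hu0 : 0 < u := by linarith [hu.1]
    have := mul_pos (pow_pos hu0 2) (neg_pos.2 h1)
    linarith
  have hs34 : Real.sin (3 * Real.pi / 4) = Real.sqrt 2 / 2 := by
    rw [show 3 * Real.pi / 4 = Real.pi - Real.pi / 4 by ring, Real.sin_pi_sub, Real.sin_pi_div_four]
  have hc34 : Real.cos (3 * Real.pi / 4) = -(Real.sqrt 2 / 2) := by
    rw [show 3 * Real.pi / 4 = Real.pi - Real.pi / 4 by ring, Real.cos_pi_sub, Real.cos_pi_div_four]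
  have hsq2 : 0 < Real.sqrt 2 := by positivity
  have hsq2' : (1.41 : ℝ) < Real.sqrt 2 := Real.lt_sqrt_of_sq_lt (by norm_num)
  have hsq3' : Real.sqrt 3 < 1.733 := (Real.sqrt_lt' (by norm_num)).2 (by norm_num)
  have hsq3'' : (1.73 : ℝ) < Real.sqrt 3 := Real.lt_sqrt_of_sq_lt (by norm_num)
  have hN34 : 0 < N (3 * Real.pi / 4) := by
    have : N (3 * Real.pi / 4) =
        Real.sqrt 2 / 2 * (2 + 3 * Real.pi / 2 - (3 * Real.pi / 4) ^ 2) := by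
      simp only [hN, sgn, sn, cs, hs34, hc34]; ring
    rw [this]
    apply mul_pos (by positivity)
    nlinarith
  have hAnti : StrictAntiOn (a.profile (-2)) (Ioo 0 (Real.pi / 2)) := by
    apply strictAntiOn_profile a le_rfl
    intro u hu
    have := hanti (left_mem_Icc.2 (by linarith)) (Ioo_subset_Icc_self hu) hu.1
    have h0 : N 0 = 0 := by simp [hN, sn_zero]
    rw [h0] at this
    exact this
  have hMono : StrictMonoOn (a.profile (-2)) (Ioo (3 * Real.pi / 4) Real.pi) := by
    apply strictMonoOn_profile a (by positivity)
    intro u hu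
    exact hN34.trans (hmono ⟨by linarith, by linarith⟩ ⟨by linarith [hu.1], hu.2.le⟩ hu.1)
  have hcont : ContinuousOn (a.profile (-2)) (Icc (3 * Real.pi / 4) Real.pi) := fun u hu =>
    (a.hasDerivAt_profile (-2) (by
      have := hu.1
      have : 0 < u := by linarith
      exact this.ne')).continuousAt.continuousWithinAt
  have hval : a.profile (-2) (Real.pi / 3) = 1 / 2 - 3 * Real.sqrt 3 / Real.pi := by
    simp only [profile, cs, sn, Real.cos_pi_div_three, Real.sin_pi_div_three]
    field_simp
    ring
  have hval1 : a.profile (-2) (3 * Real.pi / 4) =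
      -(Real.sqrt 2 / 2) * (1 + 8 / (3 * Real.pi)) := by
    simp only [profile, cs, sn, hs34, hc34]
    field_simp
    ring
  have hval2 : a.profile (-2) Real.pi = -1 := by simp [profile, cs, sn]
  obtain ⟨u₂, hu₂, he⟩ := intermediate_value_Ioo (by linarith) hcont
    (show a.profile (-2) (Real.pi / 3) ∈ Ioo _ _ by
      rw [hval, hval1, hval2]
      constructor
      · have h1 : 3 * Real.sqrt 3 / Real.pi < 1.66 := by
          rw [div_lt_iff₀ hpi]; nlinarith
        have h2 : (0.84 : ℝ) < 8 / (3 * Real.pi) := by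
          rw [lt_div_iff₀ (by positivity)]; nlinarith
        nlinarith
      · have h1 : 1.5 < 3 * Real.sqrt 3 / Real.pi := by
          rw [lt_div_iff₀ hpi]; nlinarith
        linarith)
  exact ⟨Real.pi / 3, u₂, ⟨by positivity, by linarith⟩, hu₂, he.symm, hAnti, hMono⟩

/-- For `A = -4` one has `N' = u (u cosh u - 2 sinh u)`, negative on `(0, 1)`, while `N = (u - 2)²
sinh u - 4 u e^(-u)` is positive on `(3, 4)`. The value at `1/2`, about `-3.04`, lies between those
at `3`, about `-3.29`, and at `4`, about `0.02`. -/
theorem exists_profile_b : ∃ u₁ u₂ : ℝ, u₁ ∈ Ioo (0 : ℝ) 1 ∧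
    u₂ ∈ Ioo (3 : ℝ) 4 ∧ b.profile (-4) u₁ = b.profile (-4) u₂ ∧
    StrictAntiOn (b.profile (-4)) (Ioo 0 1) ∧ StrictMonoOn (b.profile (-4)) (Ioo 3 4) := by
  set N : ℝ → ℝ := fun u => -b.sgn * u ^ 2 * b.sn u + (-4) * (u * b.cs u - b.sn u) with hN
  set g : ℝ → ℝ := fun u => u * Real.cosh u - 2 * Real.sinh u with hg
  have hg' : ∀ u, HasDerivAt g (u * Real.sinh u - Real.cosh u) u := by
    intro u
    have := ((hasDerivAt_id u).mul (Real.hasDerivAt_cosh u)).sub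
      ((Real.hasDerivAt_sinh u).const_mul 2)
    convert! this using 1
    simp only [id_eq]; ring
  have hN' : ∀ u, HasDerivAt N (u * g u) u := by
    intro u
    have := b.hasDerivAt_profile_num (-4) u
    convert! this using 1
    simp only [sgn, cs, sn, hg]; ring
  have hgneg : ∀ u ∈ Ioo (0 : ℝ) 1, g u < 0 := by
    have hganti : StrictAntiOn g (Icc 0 1) := by
      apply strictAntiOn_of_deriv_neg (convex_Icc _ _)
        (fun u _ => (hg' u).continuousAt.continuousWithinAt)
      intro u hu
      rw [interior_Icc] at hu
      rw [(hg' u).deriv]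
      have h1 := Real.sinh_lt_cosh u
      have h2 := Real.sinh_pos_iff.2 hu.1
      nlinarith [hu.2]
    intro u hu
    have := hganti (left_mem_Icc.2 zero_le_one) (Ioo_subset_Icc_self hu) hu.1
    simpa [hg] using this
  have hAnti : StrictAntiOn (b.profile (-4)) (Ioo 0 1) := by
    have hanti : StrictAntiOn N (Icc 0 1) := by
      apply strictAntiOn_of_deriv_neg (convex_Icc _ _)
        (fun u _ => (hN' u).continuousAt.continuousWithinAt)
      intro u hu
      rw [interior_Icc] at hu
      rw [(hN' u).deriv]
      exact mul_neg_of_pos_of_neg hu.1 (hgneg u hu)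
    apply strictAntiOn_profile b le_rfl
    intro u hu
    have := hanti (left_mem_Icc.2 zero_le_one) (Ioo_subset_Icc_self hu) hu.1
    have h0 : N 0 = 0 := by simp [hN, sn_zero]
    rw [h0] at this
    exact this
  have he1 := Real.exp_one_gt_d9
  have he2 := Real.exp_one_lt_d9
  have hexp3 : 20 < Real.exp 3 := by
    have : Real.exp 3 = Real.exp 1 ^ 3 := by rw [← Real.exp_nat_mul]; norm_num
    rw [this]
    calc (20 : ℝ) < 2.718 ^ 3 := by norm_num
      _ < Real.exp 1 ^ 3 := by gcongr; linarith
  have hsinh3 : 9.97 < Real.sinh 3 := by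
    have h1 : Real.exp (-3) < 0.05 := by
      rw [Real.exp_neg, inv_lt_comm₀ (by positivity) (by norm_num)]
      norm_num; linarith
    rw [Real.sinh_eq]; linarith
  have hMono : StrictMonoOn (b.profile (-4)) (Ioo 3 4) := by
    apply strictMonoOn_profile b (by norm_num)
    intro u hu
    have h1 : Real.cosh u = Real.sinh u + Real.exp (-u) := by
      rw [← Real.cosh_sub_sinh]; ring
    have h2 : Real.sinh 3 < Real.sinh u := Real.sinh_lt_sinh.2 hu.1
    have h3 : u * Real.exp (-u) < 1 := by
      rw [Real.exp_neg, ← div_eq_mul_inv, div_lt_one (Real.exp_pos _)]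
      linarith [Real.add_one_le_exp u]
    have h4 : -b.sgn * u ^ 2 * b.sn u + (-4) * (u * b.cs u - b.sn u) =
        Real.sinh u * (u - 2) ^ 2 - 4 * (u * Real.exp (-u)) := by
      simp only [sgn, sn, cs, h1]; ring
    rw [h4]
    have h5 : 1 < (u - 2) ^ 2 := by nlinarith [hu.1]
    nlinarith
  have hcont : ContinuousOn (b.profile (-4)) (Icc 3 4) := fun u hu =>
    (b.hasDerivAt_profile (-4) (by
      have : 0 < u := by linarith [hu.1]
      exact this.ne')).continuousAt.continuousWithinAt
  have hE : Real.exp (1 / 2) ^ 2 = Real.exp 1 := by rw [← Real.exp_nat_mul]; norm_num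
  have hE0 := Real.exp_pos (1 / 2)
  have hE1 : 1.648 < Real.exp (1 / 2) := by nlinarith
  have hE2 : Real.exp (1 / 2) < 1.649 := by nlinarith
  have hEinv1 : 0.606 < Real.exp (-(1 / 2)) := by
    rw [Real.exp_neg, lt_inv_comm₀ (by norm_num) hE0]; norm_num; linarith
  have hEinv2 : Real.exp (-(1 / 2)) < 0.607 := by
    rw [Real.exp_neg, inv_lt_comm₀ hE0 (by norm_num)]; norm_num; linarith
  have hval : b.profile (-4) (1 / 2) = Real.cosh (1 / 2) - 8 * Real.sinh (1 / 2) := by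
    simp only [profile, cs, sn]; ring
  have hval1 : b.profile (-4) 3 = Real.cosh 3 - 4 / 3 * Real.sinh 3 := by
    simp only [profile, cs, sn]; ring
  have hval2 : b.profile (-4) 4 = Real.cosh 4 - Real.sinh 4 := by
    simp only [profile, cs, sn]; ring
  have hch3 : Real.cosh 3 - Real.sinh 3 < 0.05 := by
    rw [Real.cosh_sub_sinh, Real.exp_neg, inv_lt_comm₀ (by positivity) (by norm_num)]
    norm_num; linarith
  obtain ⟨u₂, hu₂, he⟩ := intermediate_value_Ioo (by norm_num) hcont
    (show b.profile (-4) (1 / 2) ∈ Ioo _ _ by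
      rw [hval, hval1, hval2, Real.cosh_sub_sinh, Real.cosh_eq (1 / 2), Real.sinh_eq (1 / 2)]
      constructor
      · linarith
      · linarith [Real.exp_pos (-4)])
  exact ⟨1 / 2, u₂, ⟨by norm_num, by norm_num⟩, hu₂, he.symm, hAnti, hMono⟩

end FamilyIndex

/-- Parameters for which the leading coefficient of `gap` is `u * (profile A u - c)`. -/
noncomputable def LowerData.ofProfile (i : FamilyIndex) (A c : ℝ) : LowerData where
  i := i
  -- Solution of `l - b = -1 - A`, `(b + k) / 2 = 1 + c`, `l - (b + k) / 2 = 1`, which matches the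
  -- coefficients of `sn u`, `u` and `u * cs u`.
  b := 3 + c + A
  k := -1 + c - A
  l := 2 + c

theorem LowerData.melnikov_ofProfile (i : FamilyIndex) (A c : ℝ) {u : ℝ} (hu : u ≠ 0) :
    (LowerData.ofProfile i A c).melnikov u = u * (i.profile A u - c) := by
  simp only [melnikov, ofProfile, FamilyIndex.profile]
  field_simp
  ring

theorem exists_sign_changes (i : FamilyIndex) : ∃ (P : LowerData) (u₁ u₂ ρ₁ ρ₂ : ℝ), P.i = i ∧
    u₁ < u₂ ∧ 0 < ρ₁ ∧ 0 < ρ₂ ∧ Icc (u₁ - ρ₁) (u₁ + ρ₁) ⊆ P.i.dom ∧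
    Icc (u₂ - ρ₂) (u₂ + ρ₂) ⊆ P.i.dom ∧
    (∀ x ∈ Ioo (u₁ - ρ₁) u₁, ∀ y ∈ Ioo u₁ (u₁ + ρ₁), P.melnikov x * P.melnikov y < 0) ∧
    (∀ x ∈ Ioo (u₂ - ρ₂) u₂, ∀ y ∈ Ioo u₂ (u₂ + ρ₂), P.melnikov x * P.melnikov y < 0) := by
  have key : ∀ A c₁ d₁ c₂ d₂ u₁ u₂ : ℝ, d₁ ≤ c₂ → Ioo c₁ d₁ ⊆ i.dom → Ioo c₂ d₂ ⊆ i.dom →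
      u₁ ∈ Ioo c₁ d₁ → u₂ ∈ Ioo c₂ d₂ → i.profile A u₁ = i.profile A u₂ →
      StrictAntiOn (i.profile A) (Ioo c₁ d₁) → StrictMonoOn (i.profile A) (Ioo c₂ d₂) →
      ∃ (P : LowerData) (u₁ u₂ ρ₁ ρ₂ : ℝ), P.i = i ∧
        u₁ < u₂ ∧ 0 < ρ₁ ∧ 0 < ρ₂ ∧ Icc (u₁ - ρ₁) (u₁ + ρ₁) ⊆ P.i.dom ∧
        Icc (u₂ - ρ₂) (u₂ + ρ₂) ⊆ P.i.dom ∧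
        (∀ x ∈ Ioo (u₁ - ρ₁) u₁, ∀ y ∈ Ioo u₁ (u₁ + ρ₁), P.melnikov x * P.melnikov y < 0) ∧
        (∀ x ∈ Ioo (u₂ - ρ₂) u₂, ∀ y ∈ Ioo u₂ (u₂ + ρ₂), P.melnikov x * P.melnikov y < 0) := by
    intro A c₁ d₁ c₂ d₂ u₁ u₂ hdc hs1 hs2 hu1 hu2 heq hanti hmono
    have hrad : ∀ {c d u : ℝ}, u ∈ Ioo c d → ∃ ρ, 0 < ρ ∧ Icc (u - ρ) (u + ρ) ⊆ Ioo c d := by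
      intro c d u hu
      obtain ⟨r, hr, hball⟩ := Metric.mem_nhds_iff.1 (Ioo_mem_nhds hu.1 hu.2)
      refine ⟨r / 2, half_pos hr, fun x hx => hball ?_⟩
      rw [Metric.mem_ball, Real.dist_eq, abs_lt]
      constructor <;> linarith [hx.1, hx.2]
    obtain ⟨ρ₁, hρ₁, hi1⟩ := hrad hu1
    obtain ⟨ρ₂, hρ₂, hi2⟩ := hrad hu2
    -- Taking `c` to be the common profile value at `u₁` and `u₂` makes both of them zeros.
    refine ⟨LowerData.ofProfile i A (i.profile A u₁), u₁, u₂, ρ₁, ρ₂, rfl,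
      by linarith [hu1.2, hu2.1], hρ₁, hρ₂, hi1.trans hs1, hi2.trans hs2, ?_, ?_⟩
    · intro x hx y hy
      have hxm := hi1 (show x ∈ _ from ⟨hx.1.le, by linarith [hx.2]⟩)
      have hym := hi1 (show y ∈ _ from ⟨by linarith [hy.1], hy.2.le⟩)
      have hx0 := FamilyIndex.pos_of_mem_dom (hs1 hxm)
      have hy0 := FamilyIndex.pos_of_mem_dom (hs1 hym)
      rw [LowerData.melnikov_ofProfile _ _ _ hx0.ne', LowerData.melnikov_ofProfile _ _ _ hy0.ne']
      exact mul_neg_of_pos_of_neg (mul_pos hx0 (sub_pos.2 (hanti hxm hu1 hx.2)))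
        (mul_neg_of_pos_of_neg hy0 (sub_neg.2 (hanti hu1 hym hy.1)))
    · intro x hx y hy
      have hxm := hi2 (show x ∈ _ from ⟨hx.1.le, by linarith [hx.2]⟩)
      have hym := hi2 (show y ∈ _ from ⟨by linarith [hy.1], hy.2.le⟩)
      have hx0 := FamilyIndex.pos_of_mem_dom (hs2 hxm)
      have hy0 := FamilyIndex.pos_of_mem_dom (hs2 hym)
      rw [LowerData.melnikov_ofProfile _ _ _ hx0.ne', LowerData.melnikov_ofProfile _ _ _ hy0.ne',
        heq]
      exact mul_neg_of_neg_of_pos (mul_neg_of_pos_of_neg hx0 (sub_neg.2 (hmono hxm hu2 hx.2)))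
        (mul_pos hy0 (sub_pos.2 (hmono hu2 hym hy.1)))
  have hpi := Real.pi_pos
  cases i
  · obtain ⟨u₁, u₂, h1, h2, h3, h4, h5⟩ := FamilyIndex.exists_profile_a
    exact key _ _ _ _ _ u₁ u₂ (by linarith) (Ioo_subset_Ioo le_rfl (by linarith))
      (Ioo_subset_Ioo (by linarith) le_rfl) h1 h2 h3 h4 h5
  · obtain ⟨u₁, u₂, h1, h2, h3, h4, h5⟩ := FamilyIndex.exists_profile_b
    exact key _ _ _ _ _ u₁ u₂ (by norm_num) (fun x hx => hx.1)
      (fun x hx => (by norm_num : (0 : ℝ) < 3).trans hx.1) h1 h2 h3 h4 h5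

/-! ### The two limit cycles -/

theorem theorem2 (i : FamilyIndex) :
    ∃ (Cplus Cminus : PerturbationCoeffs) (Γ : Fin 2 → Set R3) (L : Fin 2 → ℝ → Set R3),
      Function.Injective Γ ∧
      (∀ k, (perturbedSystem i Cplus Cminus 0).IsCrossingPeriodicOrbit (Γ k) ∧ Γ k ⊆ planeS) ∧
      (∃ ε₀ : ℝ, 0 < ε₀ ∧ ∀ ε : ℝ, ε ≠ 0 → |ε| < ε₀ →
        (∀ k, (perturbedSystem i Cplus Cminus ε).IsCrossingLimitCycle (L k ε)) ∧
        Function.Injective (fun k => L k ε)) ∧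
      (∀ k, Tendsto (fun ε : ℝ => Metric.hausdorffEDist (L k ε) (Γ k)) (𝓝[≠] 0) (𝓝 0)) := by
  obtain ⟨P, u₁, u₂, ρ₁, ρ₂, rfl, hlt, hρ₁, hρ₂, hd1, hd2, hs1, hs2⟩ := exists_sign_changes i
  obtain ⟨f₁, hf₁, he₁⟩ := P.exists_limitCycles hρ₁ hd1 hs1
  obtain ⟨f₂, hf₂, he₂⟩ := P.exists_limitCycles hρ₂ hd2 hs2
  have hu1 : u₁ ∈ P.i.dom := hd1 ⟨by linarith, by linarith⟩
  have hu2 : u₂ ∈ P.i.dom := hd2 ⟨by linarith, by linarith⟩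
  have hsmall : P.Small 0 := P.eventually_small.self_of_nhds
  have hg1 : P.Good 0 u₁ := (P.eventually_good hu1 hu1).self_of_nhds u₁ ⟨le_rfl, le_rfl⟩
  have hg2 : P.Good 0 u₂ := (P.eventually_good hu2 hu2).self_of_nhds u₂ ⟨le_rfl, le_rfl⟩
  have hinj : ∀ {A B : Set R3}, A ≠ B → Function.Injective ![A, B] := by
    intro A B hAB k l hkl
    fin_cases k <;> fin_cases l <;> simp_all [eq_comm]
  -- The eventual inequality `f₁ ε < f₂ ε`, inherited from `u₁ < u₂`, keeps the two cycles distinct.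
  obtain ⟨ε₀, hε₀, hball⟩ := Metric.eventually_nhds_iff.1
    (eventually_nhdsWithin_iff.1 ((he₁.and he₂).and (hf₁.eventually_lt hf₂ hlt)))
  refine ⟨P.i.upperCoeffs, P.lowerCoeffs, ![P.orbit 0 u₁, P.orbit 0 u₂],
    ![fun ε => P.orbit ε (f₁ ε), fun ε => P.orbit ε (f₂ ε)], hinj ?_, ?_, ⟨ε₀, hε₀, ?_⟩, ?_⟩
  · intro heq
    exact hlt.ne (hsmall.orbit_injective hg1 (P.gap_zero hu1) hg2 heq)
  · rw [Fin.forall_fin_two]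
    exact ⟨⟨hsmall.isCrossingPeriodicOrbit_orbit hg1 (P.gap_zero hu1),
        LowerData.orbit_subset_planeS 0 u₁⟩,
      ⟨hsmall.isCrossingPeriodicOrbit_orbit hg2 (P.gap_zero hu2),
        LowerData.orbit_subset_planeS 0 u₂⟩⟩
  · intro ε hε hlt'
    obtain ⟨⟨⟨s, g1, z1, l1⟩, ⟨_, g2, z2, l2⟩⟩, hff⟩ := hball (y := ε) (by simpa using hlt') hε
    refine ⟨Fin.forall_fin_two.2 ⟨l1, l2⟩, ?_⟩
    have hne : P.orbit ε (f₁ ε) ≠ P.orbit ε (f₂ ε) := fun heq =>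
      hff.ne (s.orbit_injective g1 z1 g2 heq)
    have := hinj hne
    convert this using 1
    funext k
    fin_cases k <;> rfl
  · rw [Fin.forall_fin_two]
    exact ⟨P.tendsto_orbit hu1 hf₁, P.tendsto_orbit hu2 hf₂⟩
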